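/- Let $s>3/2$ be an integer and let $\Omega\subset\mathbb R^3$ be a bounded domain with Lipschitz boundary. Let $D=-i\nabla$, and for a real-valued $\sigma$ and a frequency $\omega\ge 1$ put $$\gamma=1+\tfrac{i\sigma}{\omega},\qquad \alpha=\log\gamma,\qquad \kappa=\omega\gamma^{1/2}\qquad\text{(principal branches)}.$$ **Maxwell system and Cauchy data.** Consider $$\nabla\times H+i\omega\gamma E=0,\qquad \nabla\times E-i\omega H=0\quad\text{in }\Omega. \tag{M}$$ Let $\|v\|_{H(\mathrm{curl};\Omega)}=\|v\|_{L^2(\Omega)}+\|\nabla\times v\|_{L^2(\Omega)}$. For $v\in H(\mathrm{curl};\Omega)$ the tangential trace $\nu\times v\in H^{-1/2}(\partial\Omega)$ is given by $\langle\nu\times v,w\rangle=\int_\Omega(\nabla\times v)\cdot\overline w-\int_\Omega v\cdot\overline{\nabla\times w}$ for $w\in H^1(\Omega)^3$. Let $TH(\partial\Omega)$ be the space of all such traces with the norm $\|T\|_{TH}=\inf\{\|v\|_{H(\mathrm{curl};\Omega)}:\nu\times v=T\}$, and let $\|(F,G)\|_{TH^2}=(\|F\|_{TH}^2+\|G\|_{TH}^2)^{1/2}$.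 The Cauchy data set $\mathcal C$ of $\sigma$ consists of all pairs $(\nu\times E,\nu\times H)$, where $(E,H)\in H(\mathrm{curl};\Omega)^2$ solves (M). For two coefficients $\sigma_1,\sigma_2$ with Cauchy data sets $\mathcal C_1,\mathcal C_2$ let $$\operatorname{dist}(\mathcal C_1,\mathcal C_2)=\max_{j\ne k}\ \sup_{(F_j,G_j)\in\mathcal C_j}\ \inf_{(F_k,G_k)\in\mathcal C_k}\frac{\|(F_j,G_j)-(F_k,G_k)\|_{TH^2}}{\|F_j\|_{TH}}\in[0,\infty],$$ where $0/0=0$ and $a/0=\infty$ for $a>0$. **The operator $P$ and the matrices $W$, $Q$.** On 8-vectors $(f^1,u^1,f^2,u^2)$, with $f^j$ scalar and $u^j$ a 3-vector, let $$P=\begin{pmatrix}0&P_-(D)\\P_+(D)&0\end{pmatrix},\qquad P_\pm(D)=\begin{pmatrix}0&D\cdot\\D&\pm D\times\end{pmatrix},$$ $$W=\kappa I_8+\frac12\begin{pmatrix}0&N\\0&0\end{pmatrix},\qquad N=\begin{pmatrix}0&D\alpha\cdot\\D\alpha&D\alpha\times\end{pmatrix},$$ $$Q=\frac12\begin{pmatrix}S&0\\0&0\end{pmatrix}-\kappa^2I_8-\begin{pmatrix}\frac14(D\alpha\cdot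 D\alpha)I_4&K\\K&0\end{pmatrix},$$ $$S=\begin{pmatrix}\Delta\alpha&0\\0&2\nabla^2\alpha-\Delta\alpha\, I_3\end{pmatrix},\qquad K=\begin{pmatrix}0&2D\kappa\cdot\\2D\kappa&0\end{pmatrix}.$$ $W^t$ is the transpose and $W^*=\overline W^{\,t}$. Write $W_j,Q_j,\gamma_j$ for the objects belonging to $\sigma_j$, $(Y,Y')_\Omega=\int_\Omega\sum_kY_k\overline{Y'_k}$, and $\|\cdot\|_{(k)}(\Omega)$ for the norm of $H^k(\Omega)$. **Theorem.** There is a constant $C$ depending only on $\Omega$ and $s$ such that the following holds for every $\omega\ge1$. Let $\sigma_1,\sigma_2\in H^{2s+2}(\Omega)$ be real-valued (and represented by $C^2$ functions in $\Omega$) with $\|\sigma_j\|_{(2s+2)}(\Omega)<1$ for $j=1,2$, and let $\operatorname{supp}(\sigma_1-\sigma_2)$ be a compact subset of $\Omega$. Let $Z_1\in H^{2s}(\Omega)$ be such that $$Y_1=(P-W_1^t)Z_1=(0,\ H_1^t,\ 0,\ \gamma_1^{1/2}E_1^t)^t$$ for some $H(\mathrm{curl};\Omega)^2$ solution $(E_1,H_1)$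 of (M) with $\sigma=\sigma_1$, and let $Y_2\in H^{2s}(\Omega)$ be a solution of $(P+W_2^*)Y_2=0$ in $\Omega$. Then $$|((Q_1-Q_2)Z_1,Y_2)_\Omega|\le C\operatorname{dist}(\mathcal C_1,\mathcal C_2)\,\|Y_1\|_{(1)}(\Omega)\,\|Y_2\|_{(1)}(\Omega).$$ -/

import Mathlib

open MeasureTheory Matrix
open scoped ENNReal NNReal

noncomputable section

namespace Maxwell

/-- The physical space `ℝ³` with its Euclidean norm. -/
abbrev E3 := EuclideanSpace ℝ (Fin 3)

/-- Index set of 4-vectors `(f, u)`, `f` scalar and `u` a 3-vector. -/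
abbrev I4 := Unit ⊕ Fin 3

/-- Index set of 8-vectors `(f¹, u¹, f², u²)`. -/
abbrev I8 := I4 ⊕ I4

/-! ### Domains -/

/-- `Ω` has Lipschitz boundary: near every boundary point, in suitable Cartesian coordinates,
`Ω` is the region strictly above the graph of a Lipschitz function of the first two
coordinates. -/
def HasLipschitzBoundary (Ω : Set E3) : Prop :=
  ∀ p ∈ frontier Ω, ∃ (e : E3 ≃ᵃⁱ[ℝ] E3) (g : EuclideanSpace ℝ (Fin 2) → ℝ) (L : ℝ≥0)
    (U : Set E3), LipschitzWith L g ∧ IsOpen U ∧ p ∈ U ∧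
      ∀ x ∈ U, x ∈ Ω ↔ g !₂[e x 0, e x 1] < e x 2

/-! ### Classical and weak derivatives -/

/-- The classical partial derivative `∂ᵢ f`. -/
def pd {F : Type*} [NormedAddCommGroup F] [NormedSpace ℝ F] (i : Fin 3) (f : E3 → F) : E3 → F :=
  fun x => fderiv ℝ f x (EuclideanSpace.single i 1)

/-- The classical derivative `∂^β f` of multi-index `β` (used for smooth `f` only). -/
def multiPd {F : Type*} [NormedAddCommGroup F] [NormedSpace ℝ F] (β : Fin 3 → ℕ) (f : E3 → F) :
    E3 → F :=
  (pd 0)^[β 0] ((pd 1)^[β 1] ((pd 2)^[β 2] f))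

/-- `φ` is a smooth function with compact support in `Ω`. -/
def IsTestFun {F : Type*} [NormedAddCommGroup F] [NormedSpace ℝ F] (Ω : Set E3) (φ : E3 → F) :
    Prop :=
  ContDiff ℝ (⊤ : ℕ∞) φ ∧ HasCompactSupport φ ∧ tsupport φ ⊆ Ω

/-- `g` is the weak derivative `∂^β f` in `Ω`. -/
def HasWeakDeriv (Ω : Set E3) (β : Fin 3 → ℕ) (f g : E3 → ℂ) : Prop :=
  LocallyIntegrableOn f Ω ∧ LocallyIntegrableOn g Ω ∧
    ∀ φ : E3 → ℝ, IsTestFun Ω φ →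
      ∫ x in Ω, f x * ((multiPd β φ x : ℝ) : ℂ) = (-1) ^ (∑ i, β i) * ∫ x in Ω, g x * (φ x : ℂ)

open Classical in
/-- A representative of the weak derivative `∂^β f` in `Ω` (`0` if there is none). -/
def weakDeriv (Ω : Set E3) (β : Fin 3 → ℕ) (f : E3 → ℂ) : E3 → ℂ :=
  if h : ∃ g, HasWeakDeriv Ω β f g then h.choose else 0

/-- The first order weak derivative `∂ᵢ f`. -/
def weakPd (Ω : Set E3) (i : Fin 3) (f : E3 → ℂ) : E3 → ℂ :=
  weakDeriv Ω (Pi.single i 1) f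

/-- The classical curl of a real vector field. -/
def curl (φ : E3 → Fin 3 → ℝ) (x : E3) : Fin 3 → ℝ :=
  ![pd 1 (fun y => φ y 2) x - pd 2 (fun y => φ y 1) x,
    pd 2 (fun y => φ y 0) x - pd 0 (fun y => φ y 2) x,
    pd 0 (fun y => φ y 1) x - pd 1 (fun y => φ y 0) x]

/-- `c` is the weak curl `∇ × v` in `Ω`. -/
def HasWeakCurl (Ω : Set E3) (v c : E3 → Fin 3 → ℂ) : Prop :=
  LocallyIntegrableOn v Ω ∧ LocallyIntegrableOn c Ω ∧
    ∀ φ : E3 → Fin 3 → ℝ, IsTestFun Ω φ →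
      ∫ x in Ω, ∑ i, v x i * ((curl φ x i : ℝ) : ℂ) = ∫ x in Ω, ∑ i, c x i * (φ x i : ℂ)

open Classical in
/-- A representative of the weak curl `∇ × v` in `Ω` (`0` if there is none). -/
def weakCurl (Ω : Set E3) (v : E3 → Fin 3 → ℂ) : E3 → Fin 3 → ℂ :=
  if h : ∃ c, HasWeakCurl Ω v c then h.choose else 0

/-! ### Sobolev spaces of integer order -/

/-- `f ∈ H^k(Ω)`: all weak derivatives of order at most `k` exist and are in `L²(Ω)`. -/
def MemH (Ω : Set E3) (k : ℕ) (f : E3 → ℂ) : Prop :=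
  ∀ β : Fin 3 → ℕ, ∑ i, β i ≤ k →
    ∃ g, HasWeakDeriv Ω β f g ∧ MemLp g 2 (volume.restrict Ω)

/-- The `L²(Ω)` norm of the weak derivative `∂^β f`, and `∞` if that does not exist. -/
def weakDerivNorm (Ω : Set E3) (β : Fin 3 → ℕ) (f : E3 → ℂ) : ℝ≥0∞ :=
  ⨅ (g : E3 → ℂ) (_ : HasWeakDeriv Ω β f g), eLpNorm g 2 (volume.restrict Ω)

/-- The norm of `H^k(Ω)`, the square root of `∑_{|β| ≤ k} ‖∂^β f‖²`. -/
def normH (Ω : Set E3) (k : ℕ) (f : E3 → ℂ) : ℝ≥0∞ :=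
  (∑ j ∈ Finset.range (k + 1), ∑ β ∈ Finset.piAntidiag (Finset.univ : Finset (Fin 3)) j,
    weakDerivNorm Ω β f ^ 2) ^ (1 / 2 : ℝ)

/-- Vector fields with all components in `H^k(Ω)`. -/
def MemHVec {ι : Type*} (Ω : Set E3) (k : ℕ) (Y : E3 → ι → ℂ) : Prop :=
  ∀ i, MemH Ω k (fun x => Y x i)

/-- The norm of `H^k(Ω)` for vector fields. -/
def normHVec {ι : Type*} [Fintype ι] (Ω : Set E3) (k : ℕ) (Y : E3 → ι → ℂ) : ℝ≥0∞ :=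
  (∑ i, normH Ω k (fun x => Y x i) ^ 2) ^ (1 / 2 : ℝ)

/-! ### `H(curl; Ω)` and tangential traces -/

/-- The norm of `L²(Ω)` for 3-vector fields. -/
def normL2 (Ω : Set E3) (v : E3 → Fin 3 → ℂ) : ℝ≥0∞ :=
  (∑ i, eLpNorm (fun x => v x i) 2 (volume.restrict Ω) ^ 2) ^ (1 / 2 : ℝ)

/-- `v ∈ H(curl; Ω)`. -/
def MemHcurl (Ω : Set E3) (v : E3 → Fin 3 → ℂ) : Prop :=
  (∀ i, MemLp (fun x => v x i) 2 (volume.restrict Ω)) ∧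
    ∃ c, HasWeakCurl Ω v c ∧ ∀ i, MemLp (fun x => c x i) 2 (volume.restrict Ω)

/-- The norm `‖v‖ + ‖∇ × v‖` of `H(curl; Ω)`. -/
def normHcurl (Ω : Set E3) (v : E3 → Fin 3 → ℂ) : ℝ≥0∞ :=
  normL2 Ω v + normL2 Ω (weakCurl Ω v)

/-- Vectorial distributions of class `H^{-1/2}` on `∂Ω` are regarded as functionals of
`w ∈ H¹(Ω)`. As the trace maps `H¹(Ω)` onto `H^{1/2}(∂Ω)`, such a distribution is determined
by its values on the traces of such `w`. -/
abbrev BdryFunctional (Ω : Set E3) := {w : E3 → Fin 3 → ℂ // MemHVec Ω 1 w} → ℂ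

/-- The tangential trace `ν × v`, that is
`⟨ν × v, w⟩ = ∫_Ω (∇ × v) · conj w - ∫_Ω v · conj (∇ × w)`. -/
def tangTrace (Ω : Set E3) (v : E3 → Fin 3 → ℂ) : BdryFunctional Ω := fun w =>
  (∫ x in Ω, ∑ i, weakCurl Ω v x i * star (w.1 x i)) -
    ∫ x in Ω, ∑ i, v x i * star (weakCurl Ω w.1 x i)

/-- The norm of `TH(∂Ω)`, the infimum of `‖v‖_{H(curl; Ω)}` over all `v` with `ν × v = T`
(and `∞` for `T` outside `TH(∂Ω)`). -/
def normTH (Ω : Set E3) (T : BdryFunctional Ω) : ℝ≥0∞ :=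
  ⨅ (v : E3 → Fin 3 → ℂ) (_ : MemHcurl Ω v) (_ : tangTrace Ω v = T), normHcurl Ω v

/-- The norm of `TH(∂Ω)²`. -/
def normTH2 (Ω : Set E3) (p : BdryFunctional Ω × BdryFunctional Ω) : ℝ≥0∞ :=
  (normTH Ω p.1 ^ 2 + normTH Ω p.2 ^ 2) ^ (1 / 2 : ℝ)

/-! ### The Maxwell system with `ε = μ = 1` -/

/-- `γ = 1 + i σ / ω`. -/
def gam (ω : ℝ) (σ : E3 → ℝ) (x : E3) : ℂ := 1 + Complex.I * (σ x : ℂ) / (ω : ℂ)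

/-- `(E, H)` is an `H(curl; Ω)²` solution of `∇ × H + i ω γ E = 0`, `∇ × E - i ω H = 0`. -/
def IsMaxwellSol (Ω : Set E3) (ω : ℝ) (σ : E3 → ℝ) (E H : E3 → Fin 3 → ℂ) : Prop :=
  MemHcurl Ω E ∧ MemHcurl Ω H ∧
    ∀ᵐ x ∂(volume.restrict Ω),
      weakCurl Ω H x + (Complex.I * (ω : ℂ) * gam ω σ x) • E x = 0 ∧
      weakCurl Ω E x - (Complex.I * (ω : ℂ)) • H x = 0

/-- The Cauchy data set: all pairs `(ν × E, ν × H)`. -/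
def cauchyData (Ω : Set E3) (ω : ℝ) (σ : E3 → ℝ) : Set (BdryFunctional Ω × BdryFunctional Ω) :=
  {p | ∃ E H, IsMaxwellSol Ω ω σ E H ∧ p = (tangTrace Ω E, tangTrace Ω H)}

/-- `sup_{p ∈ A} inf_{q ∈ B} ‖p - q‖ / ‖F‖`, where `p = (F, G)`
(with `0 / 0 = 0` and `a / 0 = ∞` for `a > 0`). -/
def halfDist (Ω : Set E3) (A B : Set (BdryFunctional Ω × BdryFunctional Ω)) : ℝ≥0∞ :=
  ⨆ p ∈ A, ⨅ q ∈ B, normTH2 Ω (p - q) / normTH Ω p.1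

/-- The distance of two Cauchy data sets. -/
def cauchyDist (Ω : Set E3) (A B : Set (BdryFunctional Ω × BdryFunctional Ω)) : ℝ≥0∞ :=
  max (halfDist Ω A B) (halfDist Ω B A)

/-! ### The operator `P` and the matrices `W`, `Q` -/

/-- `α = log γ`, principal branch. -/
def alp (ω : ℝ) (σ : E3 → ℝ) (x : E3) : ℂ := Complex.log (gam ω σ x)

/-- `γ^{1/2}`, principal branch. -/
def sqrtGam (ω : ℝ) (σ : E3 → ℝ) (x : E3) : ℂ := gam ω σ x ^ (1 / 2 : ℂ)

/-- `κ = ω γ^{1/2}`. -/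
def kap (ω : ℝ) (σ : E3 → ℝ) (x : E3) : ℂ := (ω : ℂ) * sqrtGam ω σ x

/-- `D f = -i ∇ f`, classically. -/
def gradD (f : E3 → ℂ) (x : E3) : Fin 3 → ℂ := fun j => -Complex.I * pd j f x

/-- The Hessian `∇² f`. -/
def hess (f : E3 → ℂ) (x : E3) : Matrix (Fin 3) (Fin 3) ℂ := Matrix.of fun i j => pd i (pd j f) x

/-- The Laplacian `Δ f`. -/
def lap (f : E3 → ℂ) (x : E3) : ℂ := (hess f x).trace

/-- The matrix of `u ↦ ζ × u`. -/
def crossMat (ζ : Fin 3 → ℂ) : Matrix (Fin 3) (Fin 3) ℂ :=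
  !![0, -ζ 2, ζ 1; ζ 2, 0, -ζ 0; -ζ 1, ζ 0, 0]

/-- The matrix `[0, ζ·; ζ, B]` on 4-vectors. -/
def bordered (ζ : Fin 3 → ℂ) (B : Matrix (Fin 3) (Fin 3) ℂ) : Matrix I4 I4 ℂ :=
  Matrix.fromBlocks 0 (Matrix.replicateRow Unit ζ) (Matrix.replicateCol Unit ζ) B

/-- `P` with `D` replaced by `ζ`: `[0, P₋(ζ); P₊(ζ), 0]`,
with `P₊(ζ) = [0, ζ·; ζ, ζ×]` and `P₋(ζ) = [0, ζ·; ζ, -ζ×]`. -/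
def symbolP (ζ : Fin 3 → ℂ) : Matrix I8 I8 ℂ :=
  Matrix.fromBlocks 0 (bordered ζ (-crossMat ζ)) (bordered ζ (crossMat ζ)) 0

/-- The first order operator `P = P(D)`, `D = -i ∇`, applied to an 8-vector field, with weak
derivatives in `Ω`. -/
def opP (Ω : Set E3) (Z : E3 → I8 → ℂ) (x : E3) : I8 → ℂ :=
  ∑ j : Fin 3, symbolP (Pi.single j 1) *ᵥ fun k => -Complex.I * weakPd Ω j (fun y => Z y k) x

/-- `W = κ I₈ + ½ [0, [0, Dα·; Dα, Dα×]; 0, 0]`. -/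
def potW (ω : ℝ) (σ : E3 → ℝ) (x : E3) : Matrix I8 I8 ℂ :=
  kap ω σ x • (1 : Matrix I8 I8 ℂ) +
    (1 / 2 : ℂ) • Matrix.fromBlocks 0
      (bordered (gradD (alp ω σ) x) (crossMat (gradD (alp ω σ) x))) 0 0

/-- The matrix potential `Q`. Its three terms are
`½ [diag(Δα, 2∇²α - Δα I₃), 0; 0, 0]`, `κ² I₈` and
`[¼ (Dα·Dα) I₄, [0, 2Dκ·; 2Dκ, 0]; [0, 2Dκ·; 2Dκ, 0], 0]`. -/
def potQ (ω : ℝ) (σ : E3 → ℝ) (x : E3) : Matrix I8 I8 ℂ :=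
  (1 / 2 : ℂ) • Matrix.fromBlocks
      (Matrix.fromBlocks (lap (alp ω σ) x • (1 : Matrix Unit Unit ℂ)) 0 0
        ((2 : ℂ) • hess (alp ω σ) x - lap (alp ω σ) x • (1 : Matrix (Fin 3) (Fin 3) ℂ))) 0 0 0
    - kap ω σ x ^ 2 • (1 : Matrix I8 I8 ℂ)
    - Matrix.fromBlocks
      ((1 / 4 : ℂ) • (gradD (alp ω σ) x ⬝ᵥ gradD (alp ω σ) x) • (1 : Matrix I4 I4 ℂ))
      (bordered ((2 : ℂ) • gradD (kap ω σ) x) 0)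
      (bordered ((2 : ℂ) • gradD (kap ω σ) x) 0) 0

/-- `(P - Wᵗ) Z`. -/
def opPsubWt (Ω : Set E3) (ω : ℝ) (σ : E3 → ℝ) (Z : E3 → I8 → ℂ) (x : E3) : I8 → ℂ :=
  opP Ω Z x - (potW ω σ x)ᵀ *ᵥ Z x

/-- `(P + W*) Y`. -/
def opPaddWstar (Ω : Set E3) (ω : ℝ) (σ : E3 → ℝ) (Y : E3 → I8 → ℂ) (x : E3) : I8 → ℂ :=
  opP Ω Y x + (potW ω σ x)ᴴ *ᵥ Y x

/-- The 8-vector `(f, u, g, v)`. -/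
def vec8 (f : ℂ) (u : Fin 3 → ℂ) (g : ℂ) (v : Fin 3 → ℂ) : I8 → ℂ :=
  Sum.elim (Sum.elim (fun _ => f) u) (Sum.elim (fun _ => g) v)

/-- The scalar product `(Y, Y')_Ω = ∫_Ω ∑ₖ Yₖ conj Y'ₖ`. -/
def innerΩ (Ω : Set E3) (Y Y' : E3 → I8 → ℂ) : ℂ :=
  ∫ x in Ω, ∑ k, Y x k * star (Y' x k)

end Maxwell

end

open Maxwell

namespace Maxwell

open Filter Topology Function
open scoped Convolution ContDiff

/-! ### Mollification in `L²` -/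

/-! Write `Y₂ = (f, u, g, v)`, bars for complex conjugates, `E`, `H` for `E₁`, `H₁`. Three
integrations by parts turn the pairing with `Q₁ - Q₂` into a pairing of Cauchy data.

(1) `Q` is the zero order part of `(P + W)(P - Wᵗ) + Δ`; the first order terms cancel because `W
P(ζ) = P(ζ) Wᵗ` for every `ζ` (`potW_mul_symbolP`, `IsC2Bounded.potQ_eq`). Subtracting two such
factorizations gives `(Q₁ - Q₂) Z = (W₁ - W₂)(P - W₁ᵗ) Z - (P + W₂)(W₁ - W₂)ᵗ Z`. The field `(W₁ -
W₂)ᵗ Z` vanishes near the boundary, so the last term is orthogonal to every solution of `(P + W₂*)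
Y₂ = 0`, and `((W₁ - W₂) Y₁, Y₂)` remains (`innerΩ_potQ_sub`).

(2) With `Y₁ = (0, H, 0, γ₁^{1/2} E)` this equals `-i ∫ (γ₁ - γ₂) E · (iω v̄ - ∇(γ₂^{-1/2} f̄))`, up
to two integrals that vanish: a curl against a compactly supported gradient, and the Green formula
of the curl for a compactly supported field (`innerΩ_potW_sub`).

(3) Put `a = γ₂^{1/2} ū - (iω)⁻¹ ∇ḡ` and `b = v̄ - (iω)⁻¹ ∇(γ₂^{-1/2} f̄)`. The vector rows of the
adjoint equation say that `∇ × b = -iω a` and `∇ × a = iωγ₂ b`, so `(b, -a)` solves the Maxwell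
system of `σ₂`. An Alessandrini identity follows: for every solution `(E', H')` for `σ₂`, the
integral in (2) is the pairing of `ν × (E - E')` with `a` minus that of `ν × (H - H')` with `b`.
Each pairing is at most a `TH` norm times an `H(curl)` norm of a test field. Gradients are curl
free, so these norms cost only first derivatives of `Y₂` (`enorm_integral_alessandriniDensity_le`).

Taking the infimum over `(E', H')` brings in the distance times `‖ν × E‖`, and `‖ν × E‖ ≤
‖E‖_{H(curl)} ≤ C ‖Y₁‖_(1)` because `E` is `γ₁^{-1/2}` times the last component of `Y₁`
(`normHcurl_le_normHVec`).

The constant is uniform in `ω ≥ 1` because `Re γ = 1`: hence `|γ| ≥ 1`, and `γ^{±1/2}` and their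
gradients are controlled by sup bounds on `σ` and `∇σ`. Such bounds, also for second derivatives,
come from a Sobolev embedding on Lipschitz domains (`exists_norm_le_of_normH_lt_one`). It is proved
by duality: a bump function is a sum of derivatives of order at most three of its averages over
small boxes that stay in `Ω`. -/

theorem continuous_integral_mul_translate {F H : E3 → ℂ} (hF : MemLp F 2 volume)
    (hH : MemLp H 2 volume) : Continuous fun t : E3 => ∫ x, F x * H (x - t) := by
  have hF' : MemLp (fun x => star (F x)) 2 volume := hF.star
  have hmp : ∀ t : E3, MeasurePreserving (fun x : E3 => x - t) volume volume :=
    fun t => measurePreserving_sub_right volume t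
  let c : E3 → C(E3, E3) := fun t => ⟨fun x => x - t, by fun_prop⟩
  have hc : Continuous c := by
    refine ContinuousMap.continuous_of_continuous_uncurry _ ?_
    change Continuous fun p : E3 × E3 => p.2 - p.1
    fun_prop
  have h1 : Continuous fun t => Lp.compMeasurePreserving (c t) (hmp t) (hH.toLp H) :=
    Continuous.compMeasurePreservingLp continuous_const hc hmp (by simp)
  have h2 : Continuous fun t => inner ℂ (hF'.toLp _)
      (Lp.compMeasurePreserving (c t) (hmp t) (hH.toLp H)) := continuous_const.inner h1
  refine h2.congr fun t => ?_
  rw [L2.inner_def]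
  refine integral_congr_ae ?_
  have e1 := hF'.coeFn_toLp
  have e2 := Lp.coeFn_compMeasurePreserving (hH.toLp H) (hmp t)
  have e3 := (hmp t).quasiMeasurePreserving.ae_eq_comp hH.coeFn_toLp
  filter_upwards [e1, e2, e3] with x h1 h2 h3
  rw [h1]
  erw [h2, h3]
  simp [mul_comm]

/-- The mollification of `H` by a bump function. -/
noncomputable def mollify (ρ : ContDiffBump (0 : E3)) (H : E3 → ℂ) : E3 → ℂ :=
  ρ.normed volume ⋆[ContinuousLinearMap.lsmul ℝ ℝ, volume] H

theorem mollify_apply (ρ : ContDiffBump (0 : E3)) (H : E3 → ℂ) (x : E3) :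
    mollify ρ H x = ∫ t, ρ.normed volume t • H (x - t) := rfl

theorem integral_mul_mollify {F H : E3 → ℂ} (hF : MemLp F 2 volume) (hH : MemLp H 2 volume)
    (hH1 : Integrable H volume) (ρ : ContDiffBump (0 : E3)) :
    ∫ x, F x * mollify ρ H x =
      ∫ t, ρ.normed volume t • ∫ x, F x * H (x - t) := by
  have hρ : Integrable (ρ.normed volume) volume := ρ.integrable_normed
  have hm : AEStronglyMeasurable
      (fun p : E3 × E3 => F p.1 * (ρ.normed volume p.2 • H (p.1 - p.2)))
      ((volume : Measure E3).prod volume) :=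
    hF.aestronglyMeasurable.comp_fst.mul
      (hρ.convolution_integrand (ContinuousLinearMap.lsmul ℝ ℝ) hH1).aestronglyMeasurable
  have hFsq : Integrable (fun x => ‖F x‖ ^ 2) volume := hF.integrable_norm_pow (by simp)
  have hHsq : Integrable (fun x => ‖H x‖ ^ 2) volume := hH.integrable_norm_pow (by simp)
  -- Fubini needs joint integrability, which follows from `|F H| ≤ |F|² + |H|²`: weighted by the
  -- bump, each square is integrable on the product space.
  have hint : Integrable
      (fun p : E3 × E3 => F p.1 * (ρ.normed volume p.2 • H (p.1 - p.2)))
      ((volume : Measure E3).prod volume) := by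
    have b1 : Integrable (fun p : E3 × E3 => ‖F p.1‖ ^ 2 * ρ.normed volume p.2)
        ((volume : Measure E3).prod volume) := hFsq.mul_prod hρ
    have b2 := hρ.convolution_integrand (ContinuousLinearMap.lsmul ℝ ℝ) hHsq
    refine (b1.add b2).mono' hm (ae_of_all _ fun p => ?_)
    have hnn := ρ.nonneg_normed (μ := volume) p.2
    simp only [norm_mul, norm_smul, Real.norm_eq_abs, abs_of_nonneg hnn, Pi.add_apply,
      ContinuousLinearMap.lsmul_apply, smul_eq_mul]
    nlinarith [mul_nonneg hnn (sq_nonneg (‖F p.1‖ - ‖H (p.1 - p.2)‖)),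
      mul_nonneg hnn (sq_nonneg ‖F p.1‖), mul_nonneg hnn (sq_nonneg ‖H (p.1 - p.2)‖)]
  have e1 : ∀ x, F x * mollify ρ H x =
      ∫ t, F x * (ρ.normed volume t • H (x - t)) := fun x => by
    rw [mollify_apply, integral_const_mul]
  simp_rw [e1]
  rw [integral_integral_swap hint]
  refine integral_congr_ae (ae_of_all _ fun t => ?_)
  simp only
  rw [← integral_smul]
  refine integral_congr_ae (ae_of_all _ fun x => ?_)
  simp only [Complex.real_smul]
  ring

theorem tendsto_integral_mul_mollify {F H : E3 → ℂ} (hF : MemLp F 2 volume)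
    (hH : MemLp H 2 volume) (hH1 : Integrable H volume) {ρ : ℕ → ContDiffBump (0 : E3)}
    (hρ : Tendsto (fun n => (ρ n).rOut) atTop (𝓝 0)) :
    Tendsto (fun n => ∫ x, F x * mollify (ρ n) H x) atTop (𝓝 (∫ x, F x * H x)) := by
  have hc := continuous_integral_mul_translate hF hH
  -- The pairing with the mollification is the convolution of the bump, evaluated at `0`, with the
  -- reflected correlation `t ↦ ∫ F x * H (x + t)`. Continuity of that correlation at `0` therefore
  -- gives weak convergence, which is all that is needed later.
  have h := ContDiffBump.convolution_tendsto_right_of_continuous (μ := volume) hρ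
    (hc.comp continuous_neg) 0
  have e : ∀ n, ((ρ n).normed volume ⋆[ContinuousLinearMap.lsmul ℝ ℝ, volume]
      ((fun t : E3 => ∫ x, F x * H (x - t)) ∘ Neg.neg)) 0 =
      ∫ x, F x * mollify (ρ n) H x := by
    intro n
    rw [integral_mul_mollify hF hH hH1]
    simp [convolution_def]
  simp_rw [e] at h
  simpa using h

theorem contDiff_mollify {H : E3 → ℂ} (hH1 : Integrable H volume) (ρ : ContDiffBump (0 : E3)) :
    ContDiff ℝ ∞ (mollify ρ H) :=
  ρ.hasCompactSupport_normed.contDiff_convolution_left _ ρ.contDiff_normed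
    hH1.locallyIntegrable

theorem pd_mollify {H : E3 → ℂ} (hH1 : Integrable H volume) (ρ : ContDiffBump (0 : E3))
    (j : Fin 3) (x : E3) :
    pd j (mollify ρ H) x = ∫ y, pd j (ρ.normed volume) (x - y) • H y := by
  have h := ρ.hasCompactSupport_normed.hasFDerivAt_convolution_left
    (ContinuousLinearMap.lsmul ℝ ℝ) (ρ.contDiff_normed (n := 1) (μ := volume))
    hH1.locallyIntegrable x
  rw [pd, mollify, h.fderiv, convolution_def]
  rw [ContinuousLinearMap.integral_apply]
  · rw [← integral_sub_left_eq_self _ volume x]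
    simp [pd]
  · have := (ρ.hasCompactSupport_normed (μ := volume)).fderiv ℝ
    exact (this.convolutionExists_left _
      ((ρ.contDiff_normed (n := 1) (μ := volume)).continuous_fderiv one_ne_zero)
      hH1.locallyIntegrable x)

theorem support_mollify_subset {H : E3 → ℂ} {K : Set E3} (hK : ∀ x ∉ K, H x = 0)
    (ρ : ContDiffBump (0 : E3)) {δ : ℝ} (hδ : ρ.rOut ≤ δ) :
    support (mollify ρ H) ⊆ Metric.cthickening δ K := by
  intro x hx
  have := support_convolution_subset (L := ContinuousLinearMap.lsmul ℝ ℝ) (μ := volume) hx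
  obtain ⟨a, ha, b, hb, rfl⟩ := this
  rw [ρ.support_normed_eq] at ha
  have hbK : b ∈ K := by
    by_contra h
    exact hb (hK b h)
  refine Metric.mem_cthickening_of_dist_le _ b _ _ hbK ?_
  have hd : dist (a + b) b = ‖a‖ := by simp [dist_eq_norm]
  simp only [Metric.mem_ball, dist_zero_right] at ha
  change dist (a + b) b ≤ δ
  linarith

/-! ### Test functions and first order weak derivatives in `L²` -/

theorem multiPd_single {F : Type*} [NormedAddCommGroup F] [NormedSpace ℝ F] (j : Fin 3)
    (φ : E3 → F) : multiPd (Pi.single j 1) φ = pd j φ := by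
  fin_cases j <;> simp [multiPd]

/-- `f ∈ L²(Ω)` has the weak derivative `∂ⱼ f = g ∈ L²(Ω)`. -/
structure HasL2Deriv (Ω : Set E3) (j : Fin 3) (f g : E3 → ℂ) : Prop where
  memLp : MemLp f 2 (volume.restrict Ω)
  memLp_deriv : MemLp g 2 (volume.restrict Ω)
  integral_eq : ∀ φ : E3 → ℝ, IsTestFun Ω φ →
    ∫ x in Ω, f x * ((pd j φ x : ℝ) : ℂ) = -∫ x in Ω, g x * (φ x : ℂ)

theorem hasL2Deriv_iff {Ω : Set E3} {j : Fin 3} {f g : E3 → ℂ} :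
    HasL2Deriv Ω j f g ↔ HasWeakDeriv Ω (Pi.single j 1) f g ∧ MemLp f 2 (volume.restrict Ω) ∧
      MemLp g 2 (volume.restrict Ω) := by
  have hs : ∑ i, (Pi.single j 1 : Fin 3 → ℕ) i = 1 := by simp
  constructor
  · rintro ⟨h1, h2, h3⟩
    refine ⟨⟨?_, ?_, fun φ hφ => ?_⟩, h1, h2⟩
    · exact locallyIntegrableOn_of_locallyIntegrable_restrict (h1.locallyIntegrable (by norm_num))
    · exact locallyIntegrableOn_of_locallyIntegrable_restrict (h2.locallyIntegrable (by norm_num))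
    · rw [multiPd_single, h3 φ hφ, hs]
      ring
  · rintro ⟨⟨_, _, h3⟩, h1, h2⟩
    refine ⟨h1, h2, fun φ hφ => ?_⟩
    have := h3 φ hφ
    rw [multiPd_single, hs] at this
    rw [this]
    ring

section TestFun

variable {F : Type*} [NormedAddCommGroup F] [NormedSpace ℝ F] {Ω : Set E3} {φ : E3 → F}

theorem pd_eq_zero_of_notMem_tsupport (j : Fin 3) {x : E3} (hx : x ∉ tsupport φ) :
    pd j φ x = 0 := by
  have : x ∉ tsupport (fderiv ℝ φ) := fun h => hx (tsupport_fderiv_subset ℝ h)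
  rw [pd, image_eq_zero_of_notMem_tsupport this]
  rfl

theorem tsupport_pd_subset (j : Fin 3) : tsupport (pd j φ) ⊆ tsupport φ := by
  refine closure_minimal (fun x hx => ?_) (isClosed_tsupport φ)
  by_contra h
  exact hx (pd_eq_zero_of_notMem_tsupport j h)

theorem IsTestFun.pd (h : IsTestFun Ω φ) (j : Fin 3) : IsTestFun Ω (pd j φ) := by
  refine ⟨?_, ?_, (tsupport_pd_subset j).trans h.2.2⟩
  · exact (h.1.fderiv_right (m := ∞) (by simp)).clm_apply contDiff_const
  · exact h.2.1.mono' (subset_closure.trans (tsupport_pd_subset j))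

theorem IsTestFun.continuous (h : IsTestFun Ω φ) : Continuous φ := h.1.continuous

theorem IsTestFun.differentiable (h : IsTestFun Ω φ) : Differentiable ℝ φ :=
  h.1.differentiable (by simp)

theorem IsTestFun.memLp (h : IsTestFun Ω φ) (p : ℝ≥0∞) (s : Set E3) :
    MemLp φ p (volume.restrict s) :=
  (h.continuous.memLp_of_hasCompactSupport h.2.1).restrict s

theorem IsTestFun.clm_comp {G : Type*} [NormedAddCommGroup G] [NormedSpace ℝ G]
    (h : IsTestFun Ω φ) (L : F →L[ℝ] G) : IsTestFun Ω fun x => L (φ x) :=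
  ⟨L.contDiff.comp h.1, h.2.1.comp_left (map_zero L),
    (tsupport_comp_subset (map_zero L) φ).trans h.2.2⟩

theorem pd_clm_comp {G : Type*} [NormedAddCommGroup G] [NormedSpace ℝ G] (L : F →L[ℝ] G)
    (j : Fin 3) {x : E3} (h : DifferentiableAt ℝ φ x) :
    Maxwell.pd j (fun x => L (φ x)) x = L (Maxwell.pd j φ x) := by
  have := (L.hasFDerivAt.comp x h.hasFDerivAt).fderiv
  simp only [comp_def] at this
  rw [Maxwell.pd, this]
  rfl

end TestFun

theorem IsTestFun.ofReal {Ω : Set E3} {φ : E3 → ℝ} (h : IsTestFun Ω φ) :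
    IsTestFun Ω fun x => (φ x : ℂ) := h.clm_comp Complex.ofRealCLM

theorem integrable_mul_of_memLp_two {X : Type*} [MeasurableSpace X] {μ : Measure X} {f g : X → ℂ} (hf : MemLp f 2 μ)
    (hg : MemLp g 2 μ) : Integrable (fun x => f x * g x) μ :=
  hf.integrable_mul hg

theorem HasL2Deriv.integral_eq_complex {Ω : Set E3} {j : Fin 3} {f g : E3 → ℂ}
    (h : HasL2Deriv Ω j f g) {ψ : E3 → ℂ} (hψ : IsTestFun Ω ψ) :
    ∫ x in Ω, f x * pd j ψ x = -∫ x in Ω, g x * ψ x := by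
  have hr := hψ.clm_comp Complex.reCLM
  have hi := hψ.clm_comp Complex.imCLM
  have er := h.integral_eq _ hr
  have ei := h.integral_eq _ hi
  have pr : ∀ x, pd j (fun x => Complex.reCLM (ψ x)) x = (pd j ψ x).re := fun x =>
    pd_clm_comp _ j (hψ.differentiable x)
  have pi : ∀ x, pd j (fun x => Complex.imCLM (ψ x)) x = (pd j ψ x).im := fun x =>
    pd_clm_comp _ j (hψ.differentiable x)
  simp_rw [pr] at er
  simp_rw [pi] at ei
  simp only [Complex.reCLM_apply] at er
  simp only [Complex.imCLM_apply] at ei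
  have hr' : MemLp (fun x => ((ψ x).re : ℂ)) 2 (volume.restrict Ω) := (hr.ofReal).memLp _ _
  have hi' : MemLp (fun x => ((ψ x).im : ℂ)) 2 (volume.restrict Ω) := (hi.ofReal).memLp _ _
  have hpr : MemLp (fun x => ((pd j ψ x).re : ℂ)) 2 (volume.restrict Ω) :=
    (((hψ.pd j).clm_comp Complex.reCLM).ofReal).memLp _ _
  have hpi : MemLp (fun x => ((pd j ψ x).im : ℂ)) 2 (volume.restrict Ω) :=
    (((hψ.pd j).clm_comp Complex.imCLM).ofReal).memLp _ _
  have e1 : ∀ x, f x * pd j ψ x =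
      f x * ((pd j ψ x).re : ℂ) + Complex.I * (f x * ((pd j ψ x).im : ℂ)) := fun x => by
    conv_lhs => rw [← Complex.re_add_im (pd j ψ x)]
    ring
  have e2 : ∀ x, g x * ψ x =
      g x * ((ψ x).re : ℂ) + Complex.I * (g x * ((ψ x).im : ℂ)) := fun x => by
    conv_lhs => rw [← Complex.re_add_im (ψ x)]
    ring
  simp_rw [e1, e2]
  rw [integral_add (integrable_mul_of_memLp_two h.memLp hpr)
      ((integrable_mul_of_memLp_two h.memLp hpi).const_mul _),
    integral_add (integrable_mul_of_memLp_two h.memLp_deriv hr')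
      ((integrable_mul_of_memLp_two h.memLp_deriv hi').const_mul _),
    integral_const_mul, integral_const_mul, er, ei]
  ring

theorem setIntegral_of_eq_zero_off {Ω K : Set E3} (hΩ : MeasurableSet Ω)
    (hK : MeasurableSet K) (hKΩ : K ⊆ Ω) {u v : E3 → ℂ} (hu : ∀ x ∈ Ω \ K, u x = 0) :
    ∫ x in Ω, v x * u x = ∫ x, Ω.indicator v x * K.indicator u x := by
  have e : ∀ x, Ω.indicator v x * K.indicator u x = K.indicator (fun x => v x * u x) x := by
    intro x
    by_cases hx : x ∈ K
    · simp [hx, hKΩ hx]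
    · simp [hx]
  simp_rw [e]
  rw [integral_indicator hK]
  exact setIntegral_eq_of_subset_of_forall_sdiff_eq_zero hΩ hKΩ fun x hx => by simp [hu x hx]

/-- The derivative falls on the bump `y ↦ ρ (x - y)` and is moved to `h` by the definition of the
weak derivative. This needs the bump to be a test function in `Ω`; the condition `2 * ρ.rOut ≤ δ`
guarantees it whenever the bump meets `K`. -/
theorem pd_mollify_of_hasL2Deriv {Ω K : Set E3} (hΩ : MeasurableSet Ω) (hK : IsCompact K)
    {δ : ℝ}
    (hδΩ : Metric.cthickening δ K ⊆ Ω) {j : Fin 3} {h h' : E3 → ℂ} (hd : HasL2Deriv Ω j h h')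
    (h0 : ∀ x ∈ Ω \ K, h x = 0) (h0' : ∀ x ∈ Ω \ K, h' x = 0) (hi : Integrable (K.indicator h))
    (ρ : ContDiffBump (0 : E3)) (hρ : 2 * ρ.rOut ≤ δ) :
    pd j (mollify ρ (K.indicator h)) = mollify ρ (K.indicator h') := by
  have hKΩ : K ⊆ Ω := (Metric.self_subset_cthickening K).trans hδΩ
  have hind : ∀ (u : E3 → ℂ) (θ : E3 → ℝ), (∀ x ∈ Ω \ K, u x = 0) →
      ∫ y, θ y • K.indicator u y = ∫ y in Ω, u y * (θ y : ℂ) := by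
    intro u θ hu
    have e : ∀ y, θ y • K.indicator u y = K.indicator (fun y => u y * (θ y : ℂ)) y := by
      intro y
      by_cases hy : y ∈ K <;> simp [hy, mul_comm]
    simp_rw [e]
    rw [integral_indicator hK.measurableSet]
    exact (setIntegral_eq_of_subset_of_forall_sdiff_eq_zero hΩ hKΩ
      fun y hy => by simp [hu y hy]).symm
  ext x
  rw [pd_mollify hi, mollify_apply]
  conv_rhs => rw [← integral_sub_left_eq_self _ volume x]
  simp only [sub_sub_cancel]
  -- If `x` is within `ρ.rOut` of `K`, the bump around `x` lies within `2 * ρ.rOut ≤ δ` of `K`,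
  -- hence in `Ω`. Otherwise the bump misses `K` and both sides vanish.
  by_cases hx : ∃ y ∈ K, dist x y ≤ ρ.rOut
  · obtain ⟨y₀, hy₀, hxy₀⟩ := hx
    rw [hind h _ h0, hind h' _ h0']
    have htest : IsTestFun Ω fun y => ρ.normed volume (x - y) := by
      refine ⟨ρ.contDiff_normed.comp (contDiff_const.sub contDiff_id), ?_, ?_⟩
      · exact ρ.hasCompactSupport_normed.comp_homeomorph (Homeomorph.subLeft x)
      · have hsub : tsupport (fun y => ρ.normed volume (x - y)) ⊆ Metric.closedBall x ρ.rOut := by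
          refine closure_minimal (fun y hy => ?_) Metric.isClosed_closedBall
          have : x - y ∈ support (ρ.normed volume) := hy
          rw [ρ.support_normed_eq] at this
          simp only [Metric.mem_ball, dist_zero_right, Metric.mem_closedBall] at this ⊢
          rw [dist_comm, dist_eq_norm]
          exact this.le
        refine hsub.trans fun y hy => hδΩ ?_
        refine Metric.mem_cthickening_of_dist_le _ y₀ _ _ hy₀ ?_
        have := dist_triangle y x y₀
        simp only [Metric.mem_closedBall] at hy
        linarith
    have hI := hd.integral_eq _ htest
    have hpd : ∀ y, pd j (fun y => ρ.normed volume (x - y)) y = -pd j (ρ.normed volume) (x - y) := by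
      intro y
      have h1 : HasFDerivAt (ρ.normed volume) (fderiv ℝ (ρ.normed volume) (x - y)) (x - y) :=
        ((ρ.contDiff_normed (n := 1)).differentiable (by simp) _).hasFDerivAt
      have h2 : HasFDerivAt (fun y : E3 => x - y) (-ContinuousLinearMap.id ℝ E3) y := by
        simpa using (hasFDerivAt_id y).const_sub x
      have := (h1.comp y h2).fderiv
      rw [pd]
      simp only [comp_def] at this
      rw [this]
      simp [pd]
    simp_rw [hpd] at hI
    have hI' : ∫ y in Ω, h y * ((pd j (ρ.normed volume) (x - y) : ℝ) : ℂ) =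
        -∫ y in Ω, h y * ((-pd j (ρ.normed volume) (x - y) : ℝ) : ℂ) := by
      rw [← integral_neg]
      simp
    rw [hI', hI, neg_neg]
  · push Not at hx
    have hz : ∀ y ∈ K, x - y ∉ tsupport (ρ.normed volume) := by
      intro y hy h1
      rw [ρ.tsupport_normed_eq] at h1
      simp only [Metric.mem_closedBall, dist_zero_right] at h1
      have := hx y hy
      rw [dist_eq_norm] at this
      linarith
    rw [integral_eq_zero_of_ae, integral_eq_zero_of_ae]
    · refine ae_of_all _ fun y => ?_
      by_cases hy : y ∈ K
      · simp [image_eq_zero_of_notMem_tsupport (hz y hy)]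
      · simp [hy]
    · refine ae_of_all _ fun y => ?_
      by_cases hy : y ∈ K
      · simp [pd_eq_zero_of_notMem_tsupport j (hz y hy)]
      · simp [hy]

/-- A compactly supported function with weak derivatives in `L²` is a weak limit of test
functions, together with its derivatives. -/
theorem exists_isTestFun_tendsto {Ω K : Set E3} (hΩ : IsOpen Ω) (hK : IsCompact K) (hKΩ : K ⊆ Ω)
    {h : E3 → ℂ} {h' : Fin 3 → E3 → ℂ} (hd : ∀ j, HasL2Deriv Ω j h (h' j))
    (h0 : ∀ x ∈ Ω \ K, h x = 0) (h0' : ∀ j, ∀ x ∈ Ω \ K, h' j x = 0) :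
    ∃ φ : ℕ → E3 → ℂ, (∀ n, IsTestFun Ω (φ n)) ∧
      (∀ F, MemLp F 2 (volume.restrict Ω) →
        Tendsto (fun n => ∫ x in Ω, F x * φ n x) atTop (𝓝 (∫ x in Ω, F x * h x))) ∧
      ∀ j F, MemLp F 2 (volume.restrict Ω) →
        Tendsto (fun n => ∫ x in Ω, F x * pd j (φ n) x) atTop (𝓝 (∫ x in Ω, F x * h' j x)) := by
  obtain ⟨δ, hδ, hδΩ⟩ := hK.exists_cthickening_subset_open hΩ hKΩ
  have hmem : ∀ {u : E3 → ℂ}, MemLp u 2 (volume.restrict Ω) → MemLp (K.indicator u) 2 volume :=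
    fun hu => (memLp_indicator_iff_restrict hK.measurableSet).2
      (hu.mono_measure (Measure.restrict_mono hKΩ le_rfl))
  have hint : ∀ {u : E3 → ℂ}, MemLp u 2 (volume.restrict Ω) → Integrable (K.indicator u) := by
    intro u hu
    have : IsFiniteMeasure (volume.restrict K) := ⟨by simpa using hK.measure_lt_top⟩
    exact (integrable_indicator_iff hK.measurableSet).2
      ((hu.mono_measure (Measure.restrict_mono hKΩ le_rfl)).integrable (by norm_num))
  let ρ : ℕ → ContDiffBump (0 : E3) := fun n =>
    { rIn := δ / 4 / (n + 1)
      rOut := δ / 2 / (n + 1)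
      rIn_pos := by positivity
      rIn_lt_rOut := by gcongr; norm_num }
  have hρ0 : Tendsto (fun n => (ρ n).rOut) atTop (𝓝 0) :=
    tendsto_const_div_atTop_nhds_zero_nat (δ / 2) |>.comp (tendsto_add_atTop_nat 1) |>.congr
      fun n => by simp [ρ]
  have hρ : ∀ n, 2 * (ρ n).rOut ≤ δ := by
    intro n
    have : δ / 2 / ((n : ℝ) + 1) ≤ δ / 2 := div_le_self (by positivity) (by
      have : (0 : ℝ) ≤ n := by positivity
      linarith)
    change 2 * (δ / 2 / ((n : ℝ) + 1)) ≤ δ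
    linarith
  have hsupp : ∀ n u, support (mollify (ρ n) (K.indicator u)) ⊆ Metric.cthickening δ K := by
    intro n u
    refine support_mollify_subset (fun x hx => by simp [hx]) (ρ n) ?_
    have := hρ n
    have := (ρ n).rOut_pos
    linarith
  have hlim : ∀ F u, MemLp F 2 (volume.restrict Ω) → MemLp u 2 (volume.restrict Ω) →
      (∀ x ∈ Ω \ K, u x = 0) →
      Tendsto (fun n => ∫ x in Ω, F x * mollify (ρ n) (K.indicator u) x) atTop
        (𝓝 (∫ x in Ω, F x * u x)) := by
    intro F u hF hu hu0
    have := tendsto_integral_mul_mollify ((memLp_indicator_iff_restrict hΩ.measurableSet).2 hF)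
      (hmem hu) (hint hu) hρ0
    rw [setIntegral_of_eq_zero_off hΩ.measurableSet hK.measurableSet hKΩ hu0]
    refine this.congr fun n => ?_
    rw [← integral_indicator hΩ.measurableSet]
    refine integral_congr_ae (ae_of_all _ fun x => ?_)
    by_cases hx : x ∈ Ω <;> simp [hx]
  refine ⟨fun n => mollify (ρ n) (K.indicator h), fun n => ?_, fun F hF => ?_, fun j F hF => ?_⟩
  · refine ⟨contDiff_mollify (hint (hd 0).memLp) _, ?_, ?_⟩
    · exact HasCompactSupport.of_support_subset_isCompact (hK.cthickening) (hsupp n h)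
    · exact (closure_minimal (hsupp n h) Metric.isClosed_cthickening).trans hδΩ
  · exact hlim F h hF (hd 0).memLp h0
  · have := hlim F (h' j) hF (hd j).memLp_deriv (h0' j)
    refine this.congr fun n => ?_
    simp only
    rw [pd_mollify_of_hasL2Deriv hΩ.measurableSet hK hδΩ (hd j) h0 (h0' j)
      (hint (hd 0).memLp) _ (hρ n)]

/-- Integration by parts for a pair of functions with weak derivatives in `L²`, one of which has
compact support. -/
theorem HasL2Deriv.integral_mul_eq_neg {Ω K : Set E3} (hΩ : IsOpen Ω) (hK : IsCompact K)
    (hKΩ : K ⊆ Ω) {h : E3 → ℂ} {h' : Fin 3 → E3 → ℂ} (hd : ∀ j, HasL2Deriv Ω j h (h' j))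
    (h0 : ∀ x ∈ Ω \ K, h x = 0) (h0' : ∀ j, ∀ x ∈ Ω \ K, h' j x = 0) {j : Fin 3}
    {f f' : E3 → ℂ} (hf : HasL2Deriv Ω j f f') :
    ∫ x in Ω, f x * h' j x = -∫ x in Ω, f' x * h x := by
  obtain ⟨φ, hφ, hl, hl'⟩ := exists_isTestFun_tendsto hΩ hK hKΩ hd h0 h0'
  refine tendsto_nhds_unique (hl' j f hf.memLp) ?_
  refine ((hl f' hf.memLp_deriv).neg).congr fun n => ?_
  rw [hf.integral_eq_complex (hφ n)]

/-! ### Calculus of weak derivatives -/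

theorem IsTestFun.hasFDerivAt {F : Type*} [NormedAddCommGroup F] [NormedSpace ℝ F] {Ω : Set E3}
    {φ : E3 → F} (h : IsTestFun Ω φ) (x : E3) : HasFDerivAt φ (fderiv ℝ φ x) x :=
  (h.differentiable x).hasFDerivAt

theorem pd_mul {j : Fin 3} {u v : E3 → ℂ} {x : E3} (hu : DifferentiableAt ℝ u x)
    (hv : DifferentiableAt ℝ v x) :
    pd j (fun y => u y * v y) x = pd j u x * v x + u x * pd j v x := by
  have : fderiv ℝ (fun y => u y * v y) x = _ := (hu.hasFDerivAt.mul hv.hasFDerivAt).fderiv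
  rw [pd, this]
  simp [pd]
  ring

theorem contDiff_mul_of_isTestFun {Ω : Set E3} (hΩ : IsOpen Ω) {m φ : E3 → ℂ} {n : ℕ}
    (hm : ContDiffOn ℝ n m Ω) (hφ : IsTestFun Ω φ) : ContDiff ℝ n fun x => m x * φ x := by
  rw [contDiff_iff_contDiffAt]
  intro x
  by_cases hx : x ∈ tsupport φ
  · exact (hm.contDiffAt (hΩ.mem_nhds (hφ.2.2 hx))).mul
      ((hφ.1.of_le (by exact_mod_cast le_top)).contDiffAt)
  · have h0 : (fun x => m x * φ x) =ᶠ[𝓝 x] fun _ => 0 := by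
      filter_upwards [(isClosed_tsupport φ).isOpen_compl.mem_nhds hx] with y hy
      simp [image_eq_zero_of_notMem_tsupport hy]
    exact contDiffAt_const.congr_of_eventuallyEq h0

theorem contDiffOn_pd {F : Type*} [NormedAddCommGroup F] [NormedSpace ℝ F] {Ω : Set E3}
    (hΩ : IsOpen Ω) {m : E3 → F} {n : ℕ} (hm : ContDiffOn ℝ (n + 1 : ℕ) m Ω) (j : Fin 3) :
    ContDiffOn ℝ n (pd j m) Ω :=
  (hm.fderiv_of_isOpen (m := n) hΩ (by norm_cast)).clm_apply contDiffOn_const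

theorem pd_congr {F : Type*} [NormedAddCommGroup F] [NormedSpace ℝ F] {Ω : Set E3}
    (hΩ : IsOpen Ω) {u v : E3 → F} (h : ∀ x ∈ Ω, u x = v x) (j : Fin 3) {x : E3} (hx : x ∈ Ω) :
    pd j u x = pd j v x := by
  have : u =ᶠ[𝓝 x] v := by filter_upwards [hΩ.mem_nhds hx] with y hy using h y hy
  rw [pd, pd, this.fderiv_eq]

theorem differentiableAt_of_contDiffOn {F : Type*} [NormedAddCommGroup F] [NormedSpace ℝ F]
    {Ω : Set E3} (hΩ : IsOpen Ω) {m : E3 → F} (hm : ContDiffOn ℝ 1 m Ω) {x : E3} (hx : x ∈ Ω) :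
    DifferentiableAt ℝ m x :=
  (hm.contDiffAt (hΩ.mem_nhds hx)).differentiableAt (by simp)

theorem integral_pd_eq_zero {j : Fin 3} {ψ : E3 → ℂ} (hψ : ContDiff ℝ 1 ψ)
    (hc : HasCompactSupport ψ) : ∫ x, pd j ψ x = 0 := by
  have hp : Continuous (pd j ψ) := (hψ.continuous_fderiv (by simp)).clm_apply continuous_const
  have hpc : HasCompactSupport (pd j ψ) :=
    hc.mono' (subset_closure.trans (tsupport_pd_subset j))
  have := integral_mul_fderiv_eq_neg_fderiv_mul_of_integrable (μ := volume)
    (f := fun _ => (1 : ℂ)) (g := ψ) (v := EuclideanSpace.single j 1) (by simp)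
    (by simp only [one_mul]; exact hp.integrable_of_hasCompactSupport hpc)
    (by simp only [one_mul]; exact hψ.continuous.integrable_of_hasCompactSupport hc)
    (fun _ _ => differentiableAt_const _)
    (fun x _ => hψ.differentiable (by simp) x)
  simpa [pd] using this

/-- Classical integration by parts against a test function. -/
theorem integral_mul_pd_testFun {Ω : Set E3} (hΩ : IsOpen Ω) {j : Fin 3} {m φ : E3 → ℂ}
    (hm : ContDiffOn ℝ 1 m Ω) (hφ : IsTestFun Ω φ) :
    ∫ x in Ω, m x * pd j φ x = -∫ x in Ω, pd j m x * φ x := by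
  have hmφ := contDiff_mul_of_isTestFun (n := 1) hΩ hm hφ
  have hc : HasCompactSupport fun x => m x * φ x := hφ.2.1.mul_left
  have hpd0 : ContDiffOn ℝ 0 (pd j m) Ω := contDiffOn_pd (n := 0) hΩ hm j
  have c1 : Continuous fun x => m x * pd j φ x :=
    (contDiff_mul_of_isTestFun (n := 1) hΩ hm (hφ.pd j)).continuous
  have c2 : Continuous fun x => pd j m x * φ x :=
    (contDiff_mul_of_isTestFun (n := 0) hΩ hpd0 hφ).continuous
  have i1 : Integrable (fun x => m x * pd j φ x) :=
    c1.integrable_of_hasCompactSupport (hφ.pd j).2.1.mul_left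
  have i2 : Integrable (fun x => pd j m x * φ x) :=
    c2.integrable_of_hasCompactSupport hφ.2.1.mul_left
  have h0 := integral_pd_eq_zero (j := j) hmφ hc
  have e : ∀ x, pd j (fun x => m x * φ x) x = pd j m x * φ x + m x * pd j φ x := by
    intro x
    by_cases hx : x ∈ tsupport φ
    · exact pd_mul (differentiableAt_of_contDiffOn hΩ hm (hφ.2.2 hx)) (hφ.differentiable x)
    · rw [pd_eq_zero_of_notMem_tsupport j hx, image_eq_zero_of_notMem_tsupport hx,
        pd_eq_zero_of_notMem_tsupport]
      · simp
      · exact fun h => hx (tsupport_mul_subset_right h)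
  simp_rw [e] at h0
  rw [integral_add i2 i1] at h0
  have r1 : ∫ x in Ω, m x * pd j φ x = ∫ x, m x * pd j φ x := by
    refine setIntegral_eq_integral_of_forall_compl_eq_zero fun x hx => ?_
    rw [pd_eq_zero_of_notMem_tsupport j fun h => hx (hφ.2.2 h), mul_zero]
  have r2 : ∫ x in Ω, pd j m x * φ x = ∫ x, pd j m x * φ x := by
    refine setIntegral_eq_integral_of_forall_compl_eq_zero fun x hx => ?_
    rw [image_eq_zero_of_notMem_tsupport fun h => hx (hφ.2.2 h), mul_zero]
  rw [r1, r2]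
  linear_combination h0

/-- A function with bounded values and first derivatives in `Ω`, of class `C¹` in `Ω`. -/
structure IsC1Bounded (Ω : Set E3) (m : E3 → ℂ) : Prop where
  contDiffOn : ContDiffOn ℝ 1 m Ω
  bound : ∃ C, ∀ x ∈ Ω, ‖m x‖ ≤ C
  bound_pd : ∃ C, ∀ j, ∀ x ∈ Ω, ‖pd j m x‖ ≤ C

theorem memLp_mul_of_bound {Ω : Set E3} (hΩ : MeasurableSet Ω) {m f : E3 → ℂ}
    (hm : ContinuousOn m Ω) (hb : ∃ C, ∀ x ∈ Ω, ‖m x‖ ≤ C) (hf : MemLp f 2 (volume.restrict Ω)) :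
    MemLp (fun x => m x * f x) 2 (volume.restrict Ω) := by
  obtain ⟨C, hC⟩ := hb
  refine MemLp.mul (p := ∞) (q := 2) hf ?_
  refine memLp_top_of_bound (hm.aestronglyMeasurable hΩ) C ?_
  filter_upwards [ae_restrict_mem hΩ] with x hx using hC x hx

theorem IsC1Bounded.memLp_mul {Ω : Set E3} (hΩ : IsOpen Ω) {m f : E3 → ℂ}
    (hm : IsC1Bounded Ω m) (hf : MemLp f 2 (volume.restrict Ω)) :
    MemLp (fun x => m x * f x) 2 (volume.restrict Ω) :=
  memLp_mul_of_bound hΩ.measurableSet hm.contDiffOn.continuousOn hm.bound hf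

theorem IsC1Bounded.memLp_pd_mul {Ω : Set E3} (hΩ : IsOpen Ω) {m f : E3 → ℂ}
    (hm : IsC1Bounded Ω m) (j : Fin 3) (hf : MemLp f 2 (volume.restrict Ω)) :
    MemLp (fun x => pd j m x * f x) 2 (volume.restrict Ω) :=
  memLp_mul_of_bound hΩ.measurableSet
    (contDiffOn_pd (n := 0) hΩ hm.contDiffOn j).continuousOn
    (hm.bound_pd.imp fun _ h => h j) hf

/-- The product of a test function and a function of class `C¹` is admissible as a test
function. -/
theorem HasL2Deriv.integral_eq_of_contDiff {Ω : Set E3} (hΩ : IsOpen Ω) {j : Fin 3}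
    {f f' : E3 → ℂ} (hf : HasL2Deriv Ω j f f') {ψ : E3 → ℂ} (hψ : ContDiff ℝ 1 ψ)
    (hc : HasCompactSupport ψ) (hs : tsupport ψ ⊆ Ω) :
    ∫ x in Ω, f x * pd j ψ x = -∫ x in Ω, f' x * ψ x := by
  have hp : ∀ i, Continuous (Maxwell.pd i ψ) := fun i =>
    (hψ.continuous_fderiv (by simp)).clm_apply continuous_const
  have hpc : ∀ i, HasCompactSupport (Maxwell.pd i ψ) := fun i =>
    hc.mono' (subset_closure.trans (tsupport_pd_subset i))
  refine hf.integral_mul_eq_neg hΩ hc.isCompact hs (h := ψ) (h' := fun i => Maxwell.pd i ψ)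
    (fun i => ⟨hψ.continuous.memLp_of_hasCompactSupport hc,
      (hp i).memLp_of_hasCompactSupport (hpc i), fun φ hφ => ?_⟩)
    (fun x hx => image_eq_zero_of_notMem_tsupport hx.2)
    (fun i x hx => pd_eq_zero_of_notMem_tsupport i hx.2)
  have := integral_mul_pd_testFun (j := i) hΩ hψ.contDiffOn hφ.ofReal
  have e : ∀ x, Maxwell.pd i (fun y => (φ y : ℂ)) x = ((Maxwell.pd i φ x : ℝ) : ℂ) := fun x =>
    pd_clm_comp Complex.ofRealCLM i (hφ.differentiable x)
  simp_rw [e] at this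
  exact this

/-- The Leibniz rule. -/
theorem HasL2Deriv.mul_left {Ω : Set E3} (hΩ : IsOpen Ω) {j : Fin 3} {f f' m : E3 → ℂ}
    (hf : HasL2Deriv Ω j f f') (hm : IsC1Bounded Ω m) :
    HasL2Deriv Ω j (fun x => m x * f x) (fun x => pd j m x * f x + m x * f' x) := by
  have m1 := hm.memLp_mul hΩ hf.memLp
  have m2 := hm.memLp_pd_mul hΩ j hf.memLp
  have m3 := hm.memLp_mul hΩ hf.memLp_deriv
  refine ⟨m1, m2.add m3, fun φ hφ => ?_⟩
  have hψ := contDiff_mul_of_isTestFun (n := 1) hΩ hm.contDiffOn hφ.ofReal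
  have h := hf.integral_eq_of_contDiff hΩ hψ hφ.ofReal.2.1.mul_left
    ((tsupport_mul_subset_right).trans hφ.ofReal.2.2)
  have e : ∀ x ∈ Ω, pd j (fun x => m x * (φ x : ℂ)) x =
      pd j m x * φ x + m x * ((pd j φ x : ℝ) : ℂ) := by
    intro x hx
    rw [pd_mul (differentiableAt_of_contDiffOn hΩ hm.contDiffOn hx) (hφ.ofReal.differentiable x)]
    congr 2
    exact pd_clm_comp Complex.ofRealCLM j (hφ.differentiable x)
  have h1 : ∫ x in Ω, f x * pd j (fun x => m x * (φ x : ℂ)) x =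
      ∫ x in Ω, (pd j m x * f x * φ x + m x * f x * ((pd j φ x : ℝ) : ℂ)) := by
    refine setIntegral_congr_fun hΩ.measurableSet fun x hx => ?_
    simp only [e x hx]
    ring
  have t1 : MemLp (fun x => (φ x : ℂ)) 2 (volume.restrict Ω) := hφ.ofReal.memLp _ _
  have t2 : MemLp (fun x => ((pd j φ x : ℝ) : ℂ)) 2 (volume.restrict Ω) :=
    (hφ.pd j).ofReal.memLp _ _
  rw [h1, integral_add (integrable_mul_of_memLp_two m2 t1) (integrable_mul_of_memLp_two m1 t2)]
    at h
  have h2 : ∫ x in Ω, (pd j m x * f x + m x * f' x) * (φ x : ℂ) =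
      (∫ x in Ω, pd j m x * f x * φ x) + ∫ x in Ω, m x * f' x * (φ x : ℂ) := by
    simp_rw [add_mul]
    exact integral_add (integrable_mul_of_memLp_two m2 t1) (integrable_mul_of_memLp_two m3 t1)
  have h3 : ∫ x in Ω, f' x * (m x * (φ x : ℂ)) = ∫ x in Ω, m x * f' x * (φ x : ℂ) := by
    congr 1
    ext x
    ring
  rw [h2, ← h3]
  linear_combination h

theorem HasL2Deriv.add {Ω : Set E3} {j : Fin 3} {f f' g g' : E3 → ℂ} (hf : HasL2Deriv Ω j f f')
    (hg : HasL2Deriv Ω j g g') :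
    HasL2Deriv Ω j (fun x => f x + g x) (fun x => f' x + g' x) := by
  refine ⟨hf.memLp.add hg.memLp, hf.memLp_deriv.add hg.memLp_deriv, fun φ hφ => ?_⟩
  have t1 : MemLp (fun x => (φ x : ℂ)) 2 (volume.restrict Ω) := hφ.ofReal.memLp _ _
  have t2 : MemLp (fun x => ((Maxwell.pd j φ x : ℝ) : ℂ)) 2 (volume.restrict Ω) :=
    (hφ.pd j).ofReal.memLp _ _
  simp_rw [add_mul]
  rw [integral_add (integrable_mul_of_memLp_two hf.memLp t2)
    (integrable_mul_of_memLp_two hg.memLp t2),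
    integral_add (integrable_mul_of_memLp_two hf.memLp_deriv t1)
    (integrable_mul_of_memLp_two hg.memLp_deriv t1), hf.integral_eq φ hφ, hg.integral_eq φ hφ]
  ring

theorem HasL2Deriv.zero {Ω : Set E3} {j : Fin 3} :
    HasL2Deriv Ω j (fun _ => 0) (fun _ => 0) :=
  ⟨MemLp.zero', MemLp.zero', fun φ _ => by simp⟩

theorem HasL2Deriv.sum {Ω : Set E3} {j : Fin 3} {ι : Type*} (s : Finset ι)
    {f f' : ι → E3 → ℂ} (hf : ∀ i, HasL2Deriv Ω j (f i) (f' i)) :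
    HasL2Deriv Ω j (fun x => ∑ i ∈ s, f i x) (fun x => ∑ i ∈ s, f' i x) := by
  classical
  induction s using Finset.induction_on with
  | empty => simpa using HasL2Deriv.zero
  | insert a s ha ih =>
    simp_rw [Finset.sum_insert ha]
    exact (hf a).add ih

theorem HasL2Deriv.conj {Ω : Set E3} {j : Fin 3} {f f' : E3 → ℂ}
    (hf : HasL2Deriv Ω j f f') :
    HasL2Deriv Ω j (fun x => star (f x)) (fun x => star (f' x)) := by
  refine ⟨hf.memLp.star, hf.memLp_deriv.star, fun φ hφ => ?_⟩
  have := congrArg star (hf.integral_eq φ hφ)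
  rw [star_neg] at this
  have e1 : ∀ (u : E3 → ℂ) (θ : E3 → ℝ), star (∫ x in Ω, u x * (θ x : ℂ)) =
      ∫ x in Ω, star (u x) * (θ x : ℂ) := by
    intro u θ
    change (starRingEnd ℂ) _ = _
    rw [← integral_conj]
    simp
  rw [e1, e1] at this
  exact this

/-- A locally integrable function on an open set is determined by its integrals against test
functions. -/
theorem ae_eq_of_integral_testFun_eq {Ω : Set E3} (hΩ : IsOpen Ω) {f g : E3 → ℂ}
    (hf : LocallyIntegrableOn f Ω) (hg : LocallyIntegrableOn g Ω)
    (h : ∀ φ : E3 → ℝ, IsTestFun Ω φ → ∫ x in Ω, f x * (φ x : ℂ) = ∫ x in Ω, g x * (φ x : ℂ)) :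
    f =ᵐ[volume.restrict Ω] g := by
  have key := hΩ.ae_eq_zero_of_integral_contDiff_smul_eq_zero (μ := volume) (hf.sub hg)
    fun φ h1 h2 h3 => by
      have hφ : IsTestFun Ω φ := ⟨h1, h2, h3⟩
      have ii : ∀ u : E3 → ℂ, LocallyIntegrableOn u Ω →
          Integrable (fun x => u x * (φ x : ℂ)) (volume.restrict Ω) := by
        intro u hu
        have h4 : IntegrableOn (fun x => φ x • u x) (tsupport φ) := by
          exact (hu.integrableOn_compact_subset h3 h2).continuousOn_smul
            h1.continuous.continuousOn h2
        have h5 : Integrable (fun x => φ x • u x) :=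
          (integrableOn_iff_integrable_of_support_subset fun x hx =>
            subset_closure (support_smul_subset_left _ _ hx)).1 h4
        simpa [mul_comm] using h5.restrict (s := Ω)
      have e : ∀ (u : E3 → ℂ), ∫ x, φ x • u x = ∫ x in Ω, u x * (φ x : ℂ) := by
        intro u
        rw [setIntegral_eq_integral_of_forall_compl_eq_zero]
        · congr 1
          ext x
          simp [mul_comm]
        · intro x hx
          rw [image_eq_zero_of_notMem_tsupport fun h => hx (h3 h)]
          simp
      rw [e]
      simp only [Pi.sub_apply, sub_mul]
      rw [integral_sub (ii f hf) (ii g hg), h φ hφ, sub_self]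
  refine (ae_restrict_iff' hΩ.measurableSet).2 ?_
  filter_upwards [key] with x hx hxΩ
  exact sub_eq_zero.1 (hx hxΩ)

/-! ### Averages along segments -/

/-- The weighted average of `φ` along the segments `[x - h b, x]`. -/
noncomputable def segAvg {F : Type*} [NormedAddCommGroup F] [NormedSpace ℝ F] (k : ℝ → ℝ) (h : ℝ)
    (b : E3) (φ : E3 → F) (x : E3) : F :=
  ∫ s in (0 : ℝ)..h, k s • φ (x - s • b)

section SegAvg

variable {F : Type} [NormedAddCommGroup F] [NormedSpace ℝ F] {k : ℝ → ℝ} {h : ℝ} {b : E3}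
  {φ : E3 → F}

theorem continuous_segAvg (hk : Continuous k) (hφ : Continuous φ) :
    Continuous (segAvg k h b φ) := by
  unfold segAvg
  refine intervalIntegral.continuous_parametric_intervalIntegral_of_continuous' (X := E3)
    (f := fun x s => k s • φ (x - s • b)) ?_ 0 h
  change Continuous fun p : E3 × ℝ => k p.2 • φ (p.1 - p.2 • b)
  fun_prop

theorem hasFDerivAt_segAvg [CompleteSpace F] (hk : Continuous k) (hφ : ContDiff ℝ 1 φ)
    (hc : HasCompactSupport φ) (x : E3) :
    HasFDerivAt (segAvg k h b φ) (segAvg k h b (fderiv ℝ φ) x) x := by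
  have hf : Continuous (fderiv ℝ φ) := hφ.continuous_fderiv (by simp)
  obtain ⟨M, hM⟩ := (hc.fderiv ℝ).exists_bound_of_continuous hf
  refine (intervalIntegral.hasFDerivAt_integral_of_dominated_of_fderiv_le (s := Set.univ)
    (bound := fun s => |k s| * M)
    (F' := fun x s => k s • fderiv ℝ φ (x - s • b)) univ_mem ?_ ?_ ?_ ?_ ?_ ?_)
  · refine Eventually.of_forall fun y => Continuous.aestronglyMeasurable ?_
    have := hφ.continuous
    fun_prop
  · refine Continuous.intervalIntegrable ?_ _ _
    have := hφ.continuous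
    fun_prop
  · have : SecondCountableTopologyEither ℝ (E3 →L[ℝ] F) := secondCountableTopologyEither_of_left _ _
    refine Continuous.aestronglyMeasurable ?_
    fun_prop
  · refine ae_of_all _ fun s _ y _ => ?_
    rw [norm_smul, Real.norm_eq_abs]
    exact mul_le_mul_of_nonneg_left (hM _) (abs_nonneg _)
  · refine Continuous.intervalIntegrable ?_ _ _
    fun_prop
  · refine ae_of_all _ fun s _ y _ => ?_
    have h1 : HasFDerivAt φ (fderiv ℝ φ (y - s • b)) (y - s • b) :=
      (hφ.differentiable (by simp) _).hasFDerivAt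
    have h2 : HasFDerivAt (fun y : E3 => y - s • b) (ContinuousLinearMap.id ℝ E3) y :=
      (hasFDerivAt_id y).sub_const _
    have h3 := h1.comp y h2
    rw [ContinuousLinearMap.comp_id] at h3
    exact h3.const_smul (k s)

/-- The derivative of a segment average is the segment average of the derivative. As the latter
takes values in another space, the codomain has to vary in the induction. -/
theorem contDiff_segAvg_nat (hk : Continuous k) (n : ℕ) :
    ∀ {F : Type} [NormedAddCommGroup F] [NormedSpace ℝ F] [CompleteSpace F] {φ : E3 → F},
      ContDiff ℝ n φ → HasCompactSupport φ → ContDiff ℝ n (segAvg k h b φ) := by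
  induction n with
  | zero =>
    intro F _ _ _ φ hφ _
    exact contDiff_zero.2 (continuous_segAvg hk hφ.continuous)
  | succ n ih =>
    intro F _ _ _ φ hφ hc
    have h1 : ContDiff ℝ 1 φ := hφ.of_le (by norm_cast; omega)
    have hd := fun x => hasFDerivAt_segAvg (h := h) (b := b) hk h1 hc x
    push_cast
    rw [contDiff_succ_iff_fderiv]
    refine ⟨fun x => (hd x).differentiableAt, by simp, ?_⟩
    have e : fderiv ℝ (segAvg k h b φ) = segAvg k h b (fderiv ℝ φ) := funext fun x => (hd x).fderiv
    rw [e]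
    exact ih (hφ.fderiv_right (by norm_cast)) (hc.fderiv ℝ)

theorem contDiff_segAvg [CompleteSpace F] (hk : Continuous k) (hφ : ContDiff ℝ ∞ φ)
    (hc : HasCompactSupport φ) : ContDiff ℝ ∞ (segAvg k h b φ) :=
  contDiff_infty.2 fun n => contDiff_segAvg_nat hk n (hφ.of_le (by exact_mod_cast le_top)) hc

/-- The points `y + s b` with `y ∈ S` and `0 ≤ s ≤ h`. -/
def segSweep (h : ℝ) (b : E3) (S : Set E3) : Set E3 :=
  (fun p : E3 × ℝ => p.1 + p.2 • b) '' S ×ˢ Set.Icc 0 h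

theorem segSweep_mono {S S' : Set E3} (hS : S ⊆ S') : segSweep h b S ⊆ segSweep h b S' :=
  Set.image_mono (Set.prod_mono hS le_rfl)

theorem IsCompact.segSweep {S : Set E3} (hS : IsCompact S) : IsCompact (segSweep h b S) :=
  (hS.prod isCompact_Icc).image (by fun_prop)

theorem subset_segSweep (hh : 0 ≤ h) (S : Set E3) : S ⊆ segSweep h b S := fun x hx =>
  ⟨(x, 0), ⟨hx, by simp [hh]⟩, by simp⟩

theorem tsupport_segAvg_subset (hh : 0 ≤ h) (hc : HasCompactSupport φ) :
    tsupport (segAvg k h b φ) ⊆ segSweep h b (tsupport φ) := by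
  refine closure_minimal (fun x hx => ?_) (IsCompact.segSweep hc).isClosed
  by_contra hn
  refine hx ?_
  rw [segAvg, intervalIntegral.integral_congr (g := fun _ => 0), intervalIntegral.integral_zero]
  intro s hs
  rw [Set.uIcc_of_le hh] at hs
  have : x - s • b ∉ tsupport φ := fun h' => hn ⟨(x - s • b, s), ⟨h', hs⟩, by simp⟩
  simp [image_eq_zero_of_notMem_tsupport this]

theorem enorm_segAvg_le (hh : 0 ≤ h) (hk1 : ∀ s ∈ Set.Icc 0 h, |k s| ≤ 1) (x : E3) :
    ‖segAvg k h b φ x‖ₑ ≤ ∫⁻ s in Set.Icc 0 h, ‖φ (x - s • b)‖ₑ := by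
  rw [segAvg, intervalIntegral.integral_of_le hh]
  refine (enorm_integral_le_lintegral_enorm _).trans ?_
  calc _ ≤ ∫⁻ s in Set.Ioc 0 h, ‖φ (x - s • b)‖ₑ := by
        refine lintegral_mono_ae ?_
        filter_upwards [ae_restrict_mem measurableSet_Ioc] with s hs
        rw [enorm_smul]
        have : ‖k s‖ₑ ≤ 1 := by
          rw [← ofReal_norm, Real.norm_eq_abs]
          simpa using hk1 s ⟨hs.1.le, hs.2⟩
        exact mul_le_of_le_one_left' this
    _ ≤ _ := lintegral_mono_set Set.Ioc_subset_Icc_self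

/-- Integration by parts in `s`. The kernel `1 - s / h` equals `1` at `s = 0` and `0` at `s = h`, so
only the value `φ x` survives at the ends. Read backwards, `φ` is the derivative along `b` of one
average plus `1 / h` times another. -/
theorem fderiv_segAvg_apply (hh : 0 < h) {φ : E3 → ℝ} (hφ : ContDiff ℝ 1 φ)
    (hc : HasCompactSupport φ) (x : E3) :
    fderiv ℝ (segAvg (fun s => 1 - s / h) h b φ) x b =
      φ x - (1 / h) * segAvg (fun _ => 1) h b φ x := by
  have hf : Continuous (fderiv ℝ φ) := hφ.continuous_fderiv (by simp)
  have hφc := hφ.continuous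
  rw [(hasFDerivAt_segAvg (by fun_prop) hφ hc x).fderiv, segAvg,
    ContinuousLinearMap.intervalIntegral_apply
      (Continuous.intervalIntegrable (by fun_prop) _ _)]
  have hu : ∀ s ∈ Set.uIcc 0 h, HasDerivAt (fun s : ℝ => 1 - s / h) (-(1 / h)) s := fun s _ =>
    ((hasDerivAt_id s).div_const h).const_sub 1
  have hv : ∀ s ∈ Set.uIcc 0 h, HasDerivAt (fun s : ℝ => φ (x - s • b))
      (-(fderiv ℝ φ (x - s • b) b)) s := by
    intro s _
    have h1 : HasFDerivAt φ (fderiv ℝ φ (x - s • b)) (x - s • b) :=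
      (hφ.differentiable (by simp) _).hasFDerivAt
    have h2 : HasDerivAt (fun s : ℝ => x - s • b) (-b) s := by
      simpa using ((hasDerivAt_id s).smul_const b).const_sub x
    have h3 := h1.comp_hasDerivAt s h2
    rw [map_neg] at h3
    exact h3
  have := intervalIntegral.integral_mul_deriv_eq_deriv_mul hu hv
    (Continuous.intervalIntegrable (by fun_prop) _ _)
    (Continuous.intervalIntegrable (by fun_prop) _ _)
  simp only [mul_neg, intervalIntegral.integral_neg, neg_mul, intervalIntegral.integral_const_mul]
    at this
  simp only [_root_.smul_apply, smul_eq_mul, segAvg, one_mul]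
  simp only [zero_smul, sub_zero, zero_div, one_mul, div_self hh.ne', sub_self, zero_mul] at this
  linarith

theorem fderiv_apply_eq_sum_pd (φ : E3 → ℝ) (x b : E3) :
    fderiv ℝ φ x b = ∑ j, b j * pd j φ x := by
  have hb : b = ∑ j, b j • EuclideanSpace.single j (1 : ℝ) := by
    ext i
    simp [Pi.single_apply]
  conv_lhs => rw [hb]
  simp [pd]

end SegAvg

/-! ### Functionals bounded by finitely many derivatives -/

/-- The iterated partial derivative along a list of coordinates. -/
noncomputable def pdList (l : List (Fin 3)) (φ : E3 → ℝ) : E3 → ℝ := l.foldr pd φ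

theorem pdList_append_singleton (l : List (Fin 3)) (j : Fin 3) (φ : E3 → ℝ) :
    pdList (l ++ [j]) φ = pdList l (pd j φ) := by simp [pdList]

theorem pdList_cons (l : List (Fin 3)) (j : Fin 3) (φ : E3 → ℝ) :
    pdList (j :: l) φ = pd j (pdList l φ) := rfl

theorem IsTestFun.pdList {Ω : Set E3} {φ : E3 → ℝ} (h : IsTestFun Ω φ) (l : List (Fin 3)) :
    IsTestFun Ω (pdList l φ) := by
  induction l with
  | nil => exact h
  | cons j l ih => exact ih.pd j

theorem IsTestFun.add {Ω : Set E3} {φ ψ : E3 → ℝ} (h : IsTestFun Ω φ) (h' : IsTestFun Ω ψ) :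
    IsTestFun Ω (fun x => φ x + ψ x) :=
  ⟨h.1.add h'.1, h.2.1.add h'.2.1,
    (tsupport_add φ ψ).trans (Set.union_subset h.2.2 h'.2.2)⟩

theorem IsTestFun.const_mul {Ω : Set E3} {φ : E3 → ℝ} (h : IsTestFun Ω φ) (c : ℝ) :
    IsTestFun Ω (fun x => c * φ x) :=
  ⟨contDiff_const.mul h.1, h.2.1.mul_left, tsupport_mul_subset_right.trans h.2.2⟩

theorem pdList_add {Ω : Set E3} {φ ψ : E3 → ℝ} (h : IsTestFun Ω φ) (h' : IsTestFun Ω ψ)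
    (l : List (Fin 3)) :
    pdList l (fun x => φ x + ψ x) = fun x => pdList l φ x + pdList l ψ x := by
  induction l with
  | nil => rfl
  | cons j l ih =>
    rw [pdList_cons, ih]
    ext x
    have : fderiv ℝ (fun x => pdList l φ x + pdList l ψ x) x = _ :=
      (((h.pdList l).hasFDerivAt x).add ((h'.pdList l).hasFDerivAt x)).fderiv
    rw [pd, this]
    rfl

theorem pdList_const_mul {Ω : Set E3} {φ : E3 → ℝ} (h : IsTestFun Ω φ) (c : ℝ)
    (l : List (Fin 3)) :
    pdList l (fun x => c * φ x) = fun x => c * pdList l φ x := by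
  induction l with
  | nil => rfl
  | cons j l ih =>
    rw [pdList_cons, ih]
    ext x
    have : fderiv ℝ (fun x => c * pdList l φ x) x = _ :=
      (((h.pdList l).hasFDerivAt x).const_mul c).fderiv
    rw [pd, this]
    rfl

/-- `u` pairs with derivatives of order at most `n` of test functions, with bound `N` times the
supremum. -/
def DualBound (Ω : Set E3) (N : ℝ) (n : ℕ) (u : E3 → ℂ) : Prop :=
  ∀ l : List (Fin 3), l.length ≤ n → ∀ φ : E3 → ℝ, IsTestFun Ω φ → ∀ c : ℝ≥0,
    (∀ x, ‖φ x‖ₑ ≤ c) → ‖∫ x in Ω, u x * (pdList l φ x : ℂ)‖ ≤ N * c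

/-- Iterated `segSweep`. -/
def boxSweep (h : ℝ) : List E3 → Set E3 → Set E3
  | [], S => S
  | b :: bs, S => boxSweep h bs (segSweep h b S)

theorem boxSweep_mono {h : ℝ} (bs : List E3) : ∀ {S S' : Set E3}, S ⊆ S' →
    boxSweep h bs S ⊆ boxSweep h bs S' := by
  induction bs with
  | nil => exact fun h => h
  | cons b bs ih => exact fun h => ih (segSweep_mono h)

theorem subset_boxSweep {h : ℝ} (hh : 0 ≤ h) (bs : List E3) : ∀ (S : Set E3),
    S ⊆ boxSweep h bs S := by
  induction bs with
  | nil => exact fun _ => le_rfl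
  | cons b bs ih => exact fun S => (subset_segSweep hh S).trans (ih _)

/-- Iterated integrals along segments. -/
noncomputable def boxIntegral (h : ℝ) : List E3 → (E3 → ℝ≥0∞) → E3 → ℝ≥0∞
  | [], ψ => ψ
  | b :: bs, ψ => boxIntegral h bs fun x => ∫⁻ s in Set.Icc 0 h, ψ (x - s • b)

theorem boxIntegral_mono {h : ℝ} (bs : List E3) : ∀ {ψ ψ' : E3 → ℝ≥0∞}, (∀ x, ψ x ≤ ψ' x) →
    ∀ x, boxIntegral h bs ψ x ≤ boxIntegral h bs ψ' x := by
  induction bs with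
  | nil => exact fun h => h
  | cons b bs ih => exact fun h => ih fun x => lintegral_mono fun s => h _

/-- The constant in `DualBound.norm_integral_le`. -/
noncomputable def boxConst (h : ℝ) : List E3 → ℝ
  | [] => 1
  | b :: bs => (∑ j, |b j| + 1 / h) * boxConst h bs

theorem boxConst_nonneg {h : ℝ} (hh : 0 < h) (bs : List E3) : 0 ≤ boxConst h bs := by
  induction bs with
  | nil => simp [boxConst]
  | cons b bs ih =>
    have : 0 ≤ ∑ j, |b j| := Finset.sum_nonneg fun _ _ => abs_nonneg _
    unfold boxConst
    positivity

/-- Each direction in `bs` trades one order of differentiation for one integration of the test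
function along a segment. When the list is used up, the supremum in `DualBound` has become a
supremum of iterated integrals of `φ`, which for three independent directions is controlled by `∫
|φ|`. -/
theorem DualBound.norm_integral_le {Ω : Set E3} {N : ℝ} {n : ℕ} {u : E3 → ℂ}
    (hu : DualBound Ω N n u) (huc : ContinuousOn u Ω) (hΩ : IsOpen Ω) {h : ℝ} (hh : 0 < h)
    (bs : List E3) :
    ∀ (l : List (Fin 3)) (φ : E3 → ℝ), l.length + bs.length ≤ n → ContDiff ℝ ∞ φ →
      HasCompactSupport φ → boxSweep h bs (tsupport φ) ⊆ Ω → ∀ c : ℝ≥0,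
      (∀ x, boxIntegral h bs (fun x => ‖φ x‖ₑ) x ≤ c) →
      ‖∫ x in Ω, u x * (pdList l φ x : ℂ)‖ ≤ N * boxConst h bs * c := by
  induction bs with
  | nil =>
    intro l φ hl h1 h2 h3 c hc
    simpa [boxConst] using hu l (by simpa using hl) φ ⟨h1, h2, h3⟩ c hc
  | cons b bs ih =>
    intro l φ hl h1 h2 h3 c hc
    simp only [List.length_cons] at hl
    set A := segAvg (fun s => 1 - s / h) h b φ with hA
    set B := segAvg (fun _ => (1 : ℝ)) h b φ with hB
    have hkA : ∀ s ∈ Set.Icc 0 h, |1 - s / h| ≤ 1 := by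
      intro s hs
      have h0 : 0 ≤ s / h := div_nonneg hs.1 hh.le
      have h1 : s / h ≤ 1 := (div_le_one hh).2 hs.2
      rw [abs_le]
      constructor <;> linarith
    have A1 : ContDiff ℝ ∞ A := contDiff_segAvg (by fun_prop) h1 h2
    have B1 : ContDiff ℝ ∞ B := contDiff_segAvg (by fun_prop) h1 h2
    have A3 : tsupport A ⊆ segSweep h b (tsupport φ) := tsupport_segAvg_subset hh.le h2
    have B3 : tsupport B ⊆ segSweep h b (tsupport φ) := tsupport_segAvg_subset hh.le h2
    have hcS := IsCompact.segSweep (h := h) (b := b) h2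
    have A2 : HasCompactSupport A := hcS.of_isClosed_subset (isClosed_tsupport _) A3
    have B2 : HasCompactSupport B := hcS.of_isClosed_subset (isClosed_tsupport _) B3
    have A4 : boxSweep h bs (tsupport A) ⊆ Ω := (boxSweep_mono bs A3).trans h3
    have B4 : boxSweep h bs (tsupport B) ⊆ Ω := (boxSweep_mono bs B3).trans h3
    have At : IsTestFun Ω A := ⟨A1, A2, (subset_boxSweep hh.le bs _).trans A4⟩
    have Bt : IsTestFun Ω B := ⟨B1, B2, (subset_boxSweep hh.le bs _).trans B4⟩
    have A5 : ∀ x, boxIntegral h bs (fun x => ‖A x‖ₑ) x ≤ c := fun x =>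
      (boxIntegral_mono bs (fun y => enorm_segAvg_le hh.le hkA y) x).trans (hc x)
    have B5 : ∀ x, boxIntegral h bs (fun x => ‖B x‖ₑ) x ≤ c := fun x =>
      (boxIntegral_mono bs (fun y => enorm_segAvg_le hh.le (by simp) y) x).trans (hc x)
    -- The identity `φ = b · ∇A + B / h` produces the factor `∑ |b j| + 1 / h` of `boxConst`. Both
    -- `A` and `B` are supported in the sweep of the support of `φ`, which stays in `Ω`.
    have hdec : φ = fun x => (b 0 * pd 0 A x + (b 1 * pd 1 A x + b 2 * pd 2 A x)) +
        (1 / h) * B x := by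
      ext x
      have := fderiv_segAvg_apply (b := b) hh (h1.of_le (by simp)) h2 x
      rw [fderiv_apply_eq_sum_pd, Fin.sum_univ_three] at this
      linarith
    have IA : ∀ j, ‖∫ x in Ω, u x * (pdList l (pd j A) x : ℂ)‖ ≤ N * boxConst h bs * c := by
      intro j
      rw [← pdList_append_singleton]
      exact ih (l ++ [j]) A (by simp; omega) A1 A2 A4 c A5
    have IB := ih l B (by omega) B1 B2 B4 c B5
    have ii : ∀ {θ : E3 → ℝ}, IsTestFun Ω θ →
        Integrable (fun x => u x * (pdList l θ x : ℂ)) (volume.restrict Ω) := by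
      intro θ hθ
      have ht := (hθ.pdList l).ofReal
      have : Continuous fun x => u x * (pdList l θ x : ℂ) :=
        (contDiff_mul_of_isTestFun (n := 0) hΩ (contDiffOn_zero.2 huc) ht).continuous
      exact (this.integrable_of_hasCompactSupport ht.2.1.mul_left).restrict
    have Pt : ∀ j, IsTestFun Ω (pd j A) := fun j => At.pd j
    have ct : ∀ j, IsTestFun Ω (fun x => b j * pd j A x) := fun j => (Pt j).const_mul _
    have e : ∫ x in Ω, u x * (pdList l φ x : ℂ) =
        (b 0 * (∫ x in Ω, u x * (pdList l (pd 0 A) x : ℂ)) +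
        (b 1 * (∫ x in Ω, u x * (pdList l (pd 1 A) x : ℂ)) +
        b 2 * (∫ x in Ω, u x * (pdList l (pd 2 A) x : ℂ)))) +
        (1 / h : ℝ) * ∫ x in Ω, u x * (pdList l B x : ℂ) := by
      rw [hdec, pdList_add ((ct 0).add ((ct 1).add (ct 2))) (Bt.const_mul _),
        pdList_add (ct 0) ((ct 1).add (ct 2)), pdList_add (ct 1) (ct 2),
        pdList_const_mul (Pt 0), pdList_const_mul (Pt 1), pdList_const_mul (Pt 2),
        pdList_const_mul Bt]
      have i0 := (ii (Pt 0)).const_mul (b 0 : ℂ)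
      have i1 := (ii (Pt 1)).const_mul (b 1 : ℂ)
      have i2 := (ii (Pt 2)).const_mul (b 2 : ℂ)
      have i3 := (ii Bt).const_mul ((1 / h : ℝ) : ℂ)
      have e12 := integral_add i1 i2
      have e012 := integral_add i0 (i1.add i2)
      have e0123 := integral_add (i0.add (i1.add i2)) i3
      simp only [Pi.add_apply] at e12 e012 e0123
      simp_rw [← integral_const_mul]
      rw [← e12, ← e012, ← e0123]
      congr 1
      ext x
      push_cast
      ring
    rw [e]
    have nb : ∀ (t : ℝ) (z : ℂ), ‖(t : ℂ) * z‖ = |t| * ‖z‖ := fun t z => by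
      rw [norm_mul, Complex.norm_real, Real.norm_eq_abs]
    calc _ ≤ (|b 0| * (N * boxConst h bs * c) + (|b 1| * (N * boxConst h bs * c) +
          |b 2| * (N * boxConst h bs * c))) + |1 / h| * (N * boxConst h bs * c) := by
          refine (norm_add_le _ _).trans (add_le_add ((norm_add_le _ _).trans
            (add_le_add ?_ ((norm_add_le _ _).trans (add_le_add ?_ ?_)))) ?_) <;>
          rw [nb] <;> refine mul_le_mul_of_nonneg_left ?_ (abs_nonneg _)
          exacts [IA 0, IA 1, IA 2, IB]
      _ = _ := by
          rw [abs_of_pos (by positivity : 0 < 1 / h), boxConst, Fin.sum_univ_three]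
          ring

/-! ### A Sobolev bound on Lipschitz domains -/

/-- Near `p`, small boxes attached to points of `Ω` stay in `Ω`. -/
def HasLocalBox (Ω : Set E3) (p : E3) : Prop :=
  ∃ (T : (ℝ × ℝ × ℝ) ≃L[ℝ] E3) (h δ : ℝ), 0 < h ∧ 0 < δ ∧
    ∀ x ∈ Ω ∩ Metric.ball p δ, ∀ s₁ ∈ Set.Icc 0 h, ∀ s₂ ∈ Set.Icc 0 h, ∀ s₃ ∈ Set.Icc 0 h,
      x + T (s₁, s₂, s₃) ∈ Ω

/-- The shear `(s₁, s₂, s₃) ↦ (s₁, s₂, L s₁ + L s₂ + s₃)`. -/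
noncomputable def shearEquiv (L : ℝ) : (ℝ × ℝ × ℝ) ≃L[ℝ] E3 :=
  LinearEquiv.toContinuousLinearEquiv
    { toFun := fun s => !₂[s.1, s.2.1, L * s.1 + L * s.2.1 + s.2.2]
      invFun := fun y => (y 0, y 1, y 2 - L * y 0 - L * y 1)
      map_add' := fun s t => by ext i; fin_cases i <;> simp; ring
      map_smul' := fun c s => by ext i; fin_cases i <;> simp; ring
      left_inv := fun s => Prod.ext rfl (Prod.ext rfl (by simp; ring))
      right_inv := fun y => by ext i; fin_cases i <;> simp }

theorem shearEquiv_apply (L : ℝ) (s : ℝ × ℝ × ℝ) :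
    shearEquiv L s = !₂[s.1, s.2.1, L * s.1 + L * s.2.1 + s.2.2] := rfl

theorem exists_small_box {T : (ℝ × ℝ × ℝ) ≃L[ℝ] E3} {r : ℝ} (hr : 0 < r) :
    ∃ h > 0, ∀ s₁ ∈ Set.Icc 0 h, ∀ s₂ ∈ Set.Icc 0 h, ∀ s₃ ∈ Set.Icc 0 h,
      ‖T (s₁, s₂, s₃)‖ < r := by
  have hc : ContinuousAt T 0 := T.continuous.continuousAt
  have := Metric.continuousAt_iff.1 hc r hr
  obtain ⟨d, hd, h⟩ := this
  refine ⟨d / 2, by positivity, fun s₁ h₁ s₂ h₂ s₃ h₃ => ?_⟩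
  have := @h (s₁, s₂, s₃) (by
    simp only [dist_zero_right, Prod.norm_def, Real.norm_eq_abs, sup_lt_iff]
    rw [abs_of_nonneg h₁.1, abs_of_nonneg h₂.1, abs_of_nonneg h₃.1]
    exact ⟨by linarith [h₁.2], by linarith [h₂.2], by linarith [h₃.2]⟩)
  simpa using this

theorem hasLocalBox_of_mem {Ω : Set E3} (hΩ : IsOpen Ω) {p : E3} (hp : p ∈ Ω) :
    HasLocalBox Ω p := by
  obtain ⟨r, hr, hrΩ⟩ := Metric.isOpen_iff.1 hΩ p hp
  obtain ⟨h, hh, hT⟩ := exists_small_box (T := shearEquiv 0) (half_pos hr)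
  refine ⟨shearEquiv 0, h, r / 2, hh, by positivity, fun x hx s₁ h₁ s₂ h₂ s₃ h₃ => hrΩ ?_⟩
  have h1 := hT s₁ h₁ s₂ h₂ s₃ h₃
  have h2 : dist x p < r / 2 := hx.2
  rw [Metric.mem_ball]
  have := dist_triangle (x + shearEquiv 0 (s₁, s₂, s₃)) x p
  have h3 : dist (x + shearEquiv 0 (s₁, s₂, s₃)) x = ‖shearEquiv 0 (s₁, s₂, s₃)‖ := by
    simp [dist_eq_norm]
  linarith

/-- In the coordinates of the graph, moving horizontally by `(s₁, s₂)` raises the graph by at most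
`L (s₁ + s₂)`. The shear lifts the point by at least this amount, so it stays strictly above the
graph. -/
theorem hasLocalBox_of_mem_frontier {Ω : Set E3} (hL : HasLipschitzBoundary Ω) {p : E3}
    (hp : p ∈ frontier Ω) : HasLocalBox Ω p := by
  obtain ⟨e, g, L, U, hg, hU, hpU, hiff⟩ := hL p hp
  obtain ⟨r, hr, hrU⟩ := Metric.isOpen_iff.1 hU p hpU
  let T : (ℝ × ℝ × ℝ) ≃L[ℝ] E3 :=
    (shearEquiv L).trans e.linearIsometryEquiv.symm.toContinuousLinearEquiv
  obtain ⟨h, hh, hT⟩ := exists_small_box (T := T) (half_pos hr)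
  refine ⟨T, h, r / 2, hh, by positivity, fun x hx s₁ h₁ s₂ h₂ s₃ h₃ => ?_⟩
  have h1 := hT s₁ h₁ s₂ h₂ s₃ h₃
  have h2 : dist x p < r / 2 := hx.2
  have h3 : dist (x + T (s₁, s₂, s₃)) x = ‖T (s₁, s₂, s₃)‖ := by
    simp [dist_eq_norm]
  have hxU : x ∈ U := hrU (by rw [Metric.mem_ball]; linarith)
  have hyU : x + T (s₁, s₂, s₃) ∈ U := hrU (by
    rw [Metric.mem_ball]
    have := dist_triangle (x + T (s₁, s₂, s₃)) x p
    linarith)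
  have hx' := (hiff x hxU).1 hx.1
  rw [hiff _ hyU]
  have hey : e (x + T (s₁, s₂, s₃)) = e x + shearEquiv L (s₁, s₂, s₃) := by
    have := e.map_vadd x (T (s₁, s₂, s₃))
    simp only [vadd_eq_add] at this
    rw [add_comm x, this, add_comm]
    simp [T]
  rw [hey, shearEquiv_apply]
  simp only [PiLp.add_apply]
  -- The Euclidean length of `(s₁, s₂)` is at most `s₁ + s₂`, which is why the shear has slope `L`
  -- in each of the two directions.
  have hd := hg.dist_le_mul !₂[e x 0 + s₁, e x 1 + s₂] !₂[e x 0, e x 1]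
  have hd2 : dist (!₂[e x 0 + s₁, e x 1 + s₂] : EuclideanSpace ℝ (Fin 2)) !₂[e x 0, e x 1]
      ≤ s₁ + s₂ := by
    rw [EuclideanSpace.dist_eq]
    simp only [Fin.sum_univ_two, Fin.isValue, Matrix.cons_val_zero,
      Matrix.cons_val_one, Real.dist_eq, add_sub_cancel_left, sq_abs]
    rw [Real.sqrt_le_left (by linarith [h₁.1, h₂.1])]
    nlinarith [mul_nonneg h₁.1 h₂.1]
  have hL0 : (0 : ℝ) ≤ L := L.2
  have hd3 := mul_le_mul_of_nonneg_left hd2 hL0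
  rw [Real.dist_eq] at hd
  have hd4 := (abs_le.1 (hd.trans hd3)).2
  simp only [Fin.isValue, Matrix.cons_val_zero, Matrix.cons_val_one, Matrix.cons_val] at hd4 ⊢
  linarith [h₃.1]

/-- The iterated segment integrals are an integral of `ψ (x - T s)` over a cube of parameters `s`.
Enlarged to all `s`, it is an integral against the image of Lebesgue measure under `T`, which is a
Haar measure and hence a multiple of Lebesgue measure. The constant does not see `h`. -/
theorem exists_lintegral_box_le (T : (ℝ × ℝ × ℝ) ≃L[ℝ] E3) :
    ∃ C : ℝ≥0, ∀ (h : ℝ) (ψ : E3 → ℝ≥0∞), Measurable ψ → ∀ x,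
      boxIntegral h [T (1, 0, 0), T (0, 1, 0), T (0, 0, 1)] ψ x ≤ C * ∫⁻ y, ψ y := by
  let μ : Measure (ℝ × ℝ × ℝ) := volume
  have hμ0 : μ.IsAddHaarMeasure := 
    Measure.prod.instIsAddHaarMeasure (volume : Measure ℝ) ((volume : Measure ℝ).prod volume)
  have hμ : (μ.map T).IsAddHaarMeasure := T.isAddHaarMeasure_map μ
  refine ⟨(μ.map T).addHaarScalarFactor volume, fun h ψ hψ x => ?_⟩
  have e1 : boxIntegral h [T (1, 0, 0), T (0, 1, 0), T (0, 0, 1)] ψ x ≤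
      ∫⁻ s₃ : ℝ, ∫⁻ s₂ : ℝ, ∫⁻ s₁ : ℝ, ψ (x - s₃ • T (0, 0, 1) - s₂ • T (0, 1, 0) - s₁ • T (1, 0, 0)) := by
    simp only [boxIntegral]
    refine (setLIntegral_le_lintegral _ _).trans (lintegral_mono fun s₃ => ?_)
    refine (setLIntegral_le_lintegral _ _).trans (lintegral_mono fun s₂ => ?_)
    exact setLIntegral_le_lintegral _ _
  refine e1.trans (le_of_eq ?_)
  have e2 : ∀ s₃ s₂ s₁ : ℝ, x - s₃ • T (0, 0, 1) - s₂ • T (0, 1, 0) - s₁ • T (1, 0, 0) =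
      x - T (s₁, s₂, s₃) := by
    intro s₃ s₂ s₁
    have : (s₁, s₂, s₃) = s₃ • ((0 : ℝ), (0 : ℝ), (1 : ℝ)) + s₂ • ((0 : ℝ), (1 : ℝ), (0 : ℝ)) +
        s₁ • ((1 : ℝ), (0 : ℝ), (0 : ℝ)) := by simp
    rw [this, map_add, map_add, map_smul, map_smul, map_smul]
    abel
  simp_rw [e2]
  have hm : Measurable fun s : ℝ × ℝ × ℝ => ψ (x - T s) :=
    hψ.comp (measurable_const.sub T.continuous.measurable)
  have e3 : ∫⁻ s₃, ∫⁻ s₂, ∫⁻ s₁, ψ (x - T (s₁, s₂, s₃)) = ∫⁻ s, ψ (x - T s) ∂μ := by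
    change _ = ∫⁻ s, ψ (x - T s) ∂(volume.prod (volume.prod volume))
    rw [lintegral_prod_symm _ hm.aemeasurable, lintegral_prod_symm _ hm.lintegral_prod_left'.aemeasurable]
  rw [e3]
  have e4 : ∫⁻ s, ψ (x - T s) ∂μ = ∫⁻ y, ψ (x - y) ∂(μ.map T) := by
    have hm' : Measurable fun y : E3 => ψ (x - y) :=
      hψ.comp (measurable_const.sub measurable_id)
    exact (lintegral_map hm' T.continuous.measurable).symm
  have e5 := Measure.isAddLeftInvariant_eq_smul (μ.map T) (volume : Measure E3)
  calc _ = ∫⁻ y, ψ (x - y) ∂(μ.map T) := e4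
    _ = ∫⁻ y, ψ (x - y) ∂((μ.map T).addHaarScalarFactor volume • volume) := by
      conv_lhs => rw [e5]
    _ = _ := by
      rw [lintegral_smul_measure, lintegral_sub_left_eq_self]
      rfl

/-- Tested against a bump of mass one concentrated near `x`, the box bound gives a number
independent of the width of the bump, while the integral tends to `u x` by continuity. The constant
depends on the box at `p` only. -/
theorem norm_le_of_dualBound_of_hasLocalBox {Ω : Set E3} (hΩ : IsOpen Ω) {p : E3}
    (hp : HasLocalBox Ω p) :
    ∃ C : ℝ, 0 ≤ C ∧ ∃ δ > 0, ∀ (N : ℝ) (u : E3 → ℂ), ContinuousOn u Ω → DualBound Ω N 3 u →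
      ∀ x ∈ Ω ∩ Metric.ball p δ, ‖u x‖ ≤ N * C := by
  obtain ⟨T, h, δ, hh, hδ, hbox⟩ := hp
  obtain ⟨C, hC⟩ := exists_lintegral_box_le T
  set bs := [T (1, 0, 0), T (0, 1, 0), T (0, 0, 1)] with hbs
  refine ⟨boxConst h bs * C, mul_nonneg (boxConst_nonneg hh bs) C.2, δ, hδ,
    fun N u huc hu x hx => ?_⟩
  refine le_of_forall_pos_le_add fun ε hε => ?_
  obtain ⟨r₁, hr₁, hr₁'⟩ := Metric.isOpen_iff.1 (hΩ.inter Metric.isOpen_ball) x hx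
  obtain ⟨r₂, hr₂, hr₂'⟩ := Metric.continuousOn_iff.1 huc x hx.1 ε hε
  have hr : 0 < min r₁ r₂ / 2 := by positivity
  let ρ : ContDiffBump x := ⟨min r₁ r₂ / 4, min r₁ r₂ / 2, by positivity, by linarith⟩
  have hts : tsupport (ρ.normed volume) = Metric.closedBall x (min r₁ r₂ / 2) :=
    ρ.tsupport_normed_eq
  have hsub : tsupport (ρ.normed volume) ⊆ Ω ∩ Metric.ball p δ := by
    rw [hts]
    refine (Metric.closedBall_subset_ball ?_).trans hr₁'
    have := min_le_left r₁ r₂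
    linarith [min_le_left r₁ r₂]
  have hsw : boxSweep h bs (tsupport (ρ.normed volume)) ⊆ Ω := by
    simp only [hbs, boxSweep, segSweep]
    rintro _ ⟨⟨_, s₃⟩, ⟨⟨⟨_, s₂⟩, ⟨⟨⟨y, s₁⟩, ⟨hy, h₁⟩, rfl⟩, h₂⟩, rfl⟩, h₃⟩, rfl⟩
    have := hbox y (hsub hy) s₁ h₁ s₂ h₂ s₃ h₃
    have e : (s₁, s₂, s₃) = s₁ • ((1 : ℝ), (0 : ℝ), (0 : ℝ)) + s₂ • ((0 : ℝ), (1 : ℝ), (0 : ℝ)) +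
        s₃ • ((0 : ℝ), (0 : ℝ), (1 : ℝ)) := by simp
    rw [e, map_add, map_add, map_smul, map_smul, map_smul] at this
    simpa only [add_assoc] using this
  have hint : ∫⁻ y, ‖ρ.normed volume y‖ₑ = 1 := by
    have e : ∀ y, ‖ρ.normed volume y‖ₑ = ENNReal.ofReal (ρ.normed volume y) := fun y =>
      Real.enorm_of_nonneg (ρ.nonneg_normed y)
    simp_rw [e]
    rw [← ofReal_integral_eq_lintegral_ofReal ρ.integrable_normed
      (ae_of_all _ ρ.nonneg_normed), ρ.integral_normed, ENNReal.ofReal_one]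
  -- No derivative is present initially; the three edges of the box use up all three available
  -- orders.
  have h1 := hu.norm_integral_le huc hΩ hh bs [] (ρ.normed volume) (by simp [hbs])
    ρ.contDiff_normed ρ.hasCompactSupport_normed hsw C (fun y => by
      have := hC h (fun y => ‖ρ.normed volume y‖ₑ) (by
        have := (ρ.continuous_normed (μ := volume)).measurable
        fun_prop) y
      rwa [hint, mul_one] at this)
  simp only [pdList, List.foldr_nil] at h1
  have hui : Integrable (fun y => u y * (ρ.normed volume y : ℂ)) (volume.restrict Ω) := by
    have ht : IsTestFun Ω (ρ.normed volume) := ⟨ρ.contDiff_normed, ρ.hasCompactSupport_normed,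
      hsub.trans Set.inter_subset_left⟩
    have : Continuous fun x => u x * (ρ.normed volume x : ℂ) :=
      (contDiff_mul_of_isTestFun (n := 0) hΩ (contDiffOn_zero.2 huc) ht.ofReal).continuous
    exact (this.integrable_of_hasCompactSupport ht.ofReal.2.1.mul_left).restrict
  have hone : ∫ y in Ω, ρ.normed volume y = 1 := by
    rw [setIntegral_eq_integral_of_forall_compl_eq_zero, ρ.integral_normed]
    exact fun y hy => image_eq_zero_of_notMem_tsupport fun h => hy (hsub h).1
  have hci : Integrable (fun y => u x * (ρ.normed volume y : ℂ)) (volume.restrict Ω) :=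
    (ρ.integrable_normed.ofReal.const_mul _).restrict
  have hux : u x = ∫ y in Ω, u x * (ρ.normed volume y : ℂ) := by
    rw [integral_const_mul, integral_complex_ofReal, hone]
    simp
  have h2 : ‖u x - ∫ y in Ω, u y * (ρ.normed volume y : ℂ)‖ ≤ ε := by
    conv_lhs => rw [hux]
    rw [← integral_sub hci hui]
    calc _ ≤ ∫ y in Ω, ε * ρ.normed volume y := by
          refine norm_integral_le_of_norm_le (ρ.integrable_normed.const_mul _).restrict ?_
          filter_upwards [ae_restrict_mem hΩ.measurableSet] with y hy
          rw [← sub_mul, norm_mul, Complex.norm_real, Real.norm_eq_abs,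
            abs_of_nonneg (ρ.nonneg_normed y)]
          by_cases hy' : y ∈ tsupport (ρ.normed volume)
          · refine mul_le_mul_of_nonneg_right ?_ (ρ.nonneg_normed y)
            rw [← dist_eq_norm, dist_comm]
            refine (hr₂' y hy ?_).le
            rw [hts, Metric.mem_closedBall] at hy'
            linarith [min_le_right r₁ r₂]
          · simp [image_eq_zero_of_notMem_tsupport hy']
      _ = ε := by rw [integral_const_mul, hone, mul_one]
  calc ‖u x‖ = ‖(∫ y in Ω, u y * (ρ.normed volume y : ℂ)) +
        (u x - ∫ y in Ω, u y * (ρ.normed volume y : ℂ))‖ := by congr 1; ring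
    _ ≤ _ := norm_add_le _ _
    _ ≤ _ := by
      rw [← mul_assoc]
      exact add_le_add h1 h2

/-- On a bounded Lipschitz domain, a continuous function is bounded if its derivatives of order at
most three are controlled. -/
theorem exists_norm_le_of_dualBound {Ω : Set E3} (hΩ : IsOpen Ω) (hb : Bornology.IsBounded Ω)
    (hL : HasLipschitzBoundary Ω) :
    ∃ C : ℝ, 0 ≤ C ∧ ∀ (N : ℝ) (u : E3 → ℂ), 0 ≤ N → ContinuousOn u Ω → DualBound Ω N 3 u →
      ∀ x ∈ Ω, ‖u x‖ ≤ N * C := by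
  have hbox : ∀ p ∈ closure Ω, HasLocalBox Ω p := by
    intro p hp
    by_cases h : p ∈ Ω
    · exact hasLocalBox_of_mem hΩ h
    · exact hasLocalBox_of_mem_frontier hL ⟨hp, fun h' => h (interior_subset h')⟩
  choose! C hC0 δ hδ hC using fun p (hp : p ∈ closure Ω) =>
    norm_le_of_dualBound_of_hasLocalBox hΩ (hbox p hp)
  obtain ⟨t, ht, hcov⟩ := hb.isCompact_closure.elim_nhds_subcover (fun p => Metric.ball p (δ p))
    fun p hp => Metric.ball_mem_nhds p (hδ p hp)
  refine ⟨∑ p ∈ t, C p, Finset.sum_nonneg fun p hp => hC0 p (ht p hp),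
    fun N u hN huc hu x hx => ?_⟩
  obtain ⟨p, hp, hxp⟩ := Set.mem_iUnion₂.1 (hcov (subset_closure hx))
  refine (hC p (ht p hp) N u huc hu x ⟨hx, hxp⟩).trans (mul_le_mul_of_nonneg_left ?_ hN)
  exact Finset.single_le_sum (f := C) (fun q hq => hC0 q (ht q hq)) hp

/-! ### Sobolev spaces of integer order -/

theorem pd_comm {F : Type*} [NormedAddCommGroup F] [NormedSpace ℝ F] {φ : E3 → F} {x : E3}
    (hφ : ContDiffAt ℝ 2 φ x) (i j : Fin 3) : pd i (pd j φ) x = pd j (pd i φ) x := by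
  have hd : DifferentiableAt ℝ (fderiv ℝ φ) x :=
    (hφ.fderiv_right (m := 1) (by norm_num)).differentiableAt (by simp)
  have e : ∀ i j : Fin 3, pd i (pd j φ) x =
      fderiv ℝ (fderiv ℝ φ) x (EuclideanSpace.single i 1) (EuclideanSpace.single j 1) := by
    intro i j
    have : fderiv ℝ (pd j φ) x = _ :=
      (hd.hasFDerivAt.clm_apply (hasFDerivAt_const (EuclideanSpace.single j (1 : ℝ)) x)).fderiv
    rw [pd, this]
    simp
  rw [e, e]
  exact (hφ.isSymmSndFDerivAt (by simp)).eq _ _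

theorem pd_pd_iterate {Ω : Set E3} {φ : E3 → ℝ} (h : IsTestFun Ω φ) (i j : Fin 3) (n : ℕ) :
    pd i ((pd j)^[n] φ) = (pd j)^[n] (pd i φ) := by
  induction n generalizing φ with
  | zero => rfl
  | succ n ih =>
    rw [iterate_succ_apply, iterate_succ_apply, ih (h.pd j)]
    congr 1
    ext x
    exact pd_comm (contDiff_infty.1 h.1 2).contDiffAt i j

theorem IsTestFun.pd_iterate {Ω : Set E3} {φ : E3 → ℝ} (h : IsTestFun Ω φ) (j : Fin 3) (n : ℕ) :
    IsTestFun Ω ((Maxwell.pd j)^[n] φ) := by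
  induction n generalizing φ with
  | zero => exact h
  | succ n ih => exact ih (h.pd j)

theorem pd_multiPd {Ω : Set E3} {φ : E3 → ℝ} (h : IsTestFun Ω φ) (j : Fin 3) (β : Fin 3 → ℕ) :
    pd j (multiPd β φ) = multiPd (β + Pi.single j 1) φ := by
  have h2 := h.pd_iterate 2 (β 2)
  have h1 := h2.pd_iterate 1 (β 1)
  fin_cases j
  · simp [multiPd, iterate_succ_apply']
  · simp [multiPd, iterate_succ_apply', pd_pd_iterate h1]
  · simp [multiPd, iterate_succ_apply', pd_pd_iterate h1, pd_pd_iterate h2]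

/-- The averaging argument moves one derivative at a time, while Sobolev norms are indexed by
multi-indices. For smooth functions the order of differentiation is irrelevant, so only the
multiplicities in the list count. -/
theorem pdList_eq_multiPd {Ω : Set E3} {φ : E3 → ℝ} (h : IsTestFun Ω φ) (l : List (Fin 3)) :
    pdList l φ = multiPd (fun i => l.count i) φ := by
  induction l with
  | nil => simp [pdList, multiPd]
  | cons j l ih =>
    rw [pdList_cons, ih, pd_multiPd h]
    congr 1
    ext i
    simp only [Pi.add_apply, List.count_cons, Pi.single_apply, beq_iff_eq]
    simp only [eq_comm]

theorem weakDerivNorm_le_normH {Ω : Set E3} {k : ℕ} {β : Fin 3 → ℕ} (hβ : ∑ i, β i ≤ k)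
    (f : E3 → ℂ) : weakDerivNorm Ω β f ≤ normH Ω k f := by
  have h1 : weakDerivNorm Ω β f ^ 2 ≤ ∑ j ∈ Finset.range (k + 1),
      ∑ β ∈ Finset.piAntidiag (Finset.univ : Finset (Fin 3)) j, weakDerivNorm Ω β f ^ 2 := by
    have a1 : ∑ i, β i ∈ Finset.range (k + 1) := Finset.mem_range.2 (by omega)
    have a2 : β ∈ Finset.piAntidiag (Finset.univ : Finset (Fin 3)) (∑ i, β i) := by simp
    refine le_trans ?_ (Finset.single_le_sum (f := fun j => ∑ β ∈ Finset.piAntidiag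
      (Finset.univ : Finset (Fin 3)) j, weakDerivNorm Ω β f ^ 2) (fun _ _ => by positivity) a1)
    exact Finset.single_le_sum (f := fun β => weakDerivNorm Ω β f ^ 2) (fun _ _ => by positivity) a2
  calc weakDerivNorm Ω β f = (weakDerivNorm Ω β f ^ 2) ^ (1 / 2 : ℝ) := by
        rw [← ENNReal.rpow_natCast, ← ENNReal.rpow_mul]
        norm_num
    _ ≤ _ := ENNReal.rpow_le_rpow h1 (by norm_num)

/-- All derivatives move onto `u`, whose weak derivatives have `L²` norm below `1`. The
Cauchy–Schwarz inequality on `Ω` then yields the constant `|Ω|^{1/2}`. -/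
theorem dualBound_of_normH_lt_one {Ω : Set E3} (hf : volume Ω ≠ ⊤)
    {k n : ℕ} (hn : n ≤ k) {u : E3 → ℂ} (hu : normH Ω k u < 1) :
    DualBound Ω ((volume Ω) ^ (1 / 2 : ℝ)).toReal n u := by
  intro l hl φ hφ c hc
  have hsum : ∑ i, l.count i = l.length := by
    rw [← Multiset.coe_card, ← Multiset.sum_count_eq_card (s := Finset.univ) (by simp)]
    simp
  have h1 := (weakDerivNorm_le_normH (Ω := Ω) (k := k) (β := fun i => l.count i)
    (by omega) u).trans_lt hu
  simp only [weakDerivNorm, iInf_lt_iff] at h1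
  obtain ⟨g, hg, hg1⟩ := h1
  rw [pdList_eq_multiPd hφ, hg.2.2 φ hφ, norm_mul, norm_pow, norm_neg, norm_one, one_pow, one_mul]
  have hgm : AEStronglyMeasurable g (volume.restrict Ω) := hg.2.1.aestronglyMeasurable
  have hfin : IsFiniteMeasure (volume.restrict Ω) := ⟨by simpa using hf.lt_top⟩
  have h2 : ‖∫ x in Ω, g x * (φ x : ℂ)‖ₑ ≤ (volume Ω) ^ (1 / 2 : ℝ) * c := by
    calc _ ≤ ∫⁻ x in Ω, ‖g x * (φ x : ℂ)‖ₑ := enorm_integral_le_lintegral_enorm _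
      _ ≤ ∫⁻ x in Ω, ‖g x‖ₑ * c := by
        refine lintegral_mono fun x => ?_
        rw [enorm_mul]
        have : ‖(φ x : ℂ)‖ₑ = ‖φ x‖ₑ := by
          rw [← ofReal_norm, ← ofReal_norm, Complex.norm_real]
        rw [this]
        exact mul_le_mul_right (hc x) _
      _ = eLpNorm g 1 (volume.restrict Ω) * c := by
        rw [lintegral_mul_const' _ _ (by simp), eLpNorm_one_eq_lintegral_enorm]
      _ ≤ _ := by
        refine mul_le_mul_left ?_ _
        have := eLpNorm_le_eLpNorm_mul_rpow_measure_univ (p := 1) (q := 2) (by norm_num) hgm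
        refine this.trans ?_
        rw [Measure.restrict_apply_univ]
        have e : (1 / (1 : ℝ≥0∞).toReal - 1 / (2 : ℝ≥0∞).toReal) = 1 / 2 := by norm_num
        rw [e]
        exact mul_le_of_le_one_left' hg1.le
  have h3 : (volume Ω) ^ (1 / 2 : ℝ) ≠ ⊤ := ENNReal.rpow_ne_top_of_nonneg (by norm_num) hf
  have h4 := ENNReal.toReal_mono (ENNReal.mul_ne_top h3 (by simp)) h2
  simpa using h4

theorem DualBound.pd {Ω : Set E3} (hΩ : IsOpen Ω) {N : ℝ} {n : ℕ} {u : E3 → ℂ}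
    (h : DualBound Ω N (n + 1) u) (hu : ContDiffOn ℝ 1 u Ω) (j : Fin 3) :
    DualBound Ω N n (pd j u) := by
  intro l hl φ hφ c hc
  have h1 := h (j :: l) (by simpa using hl) φ hφ c hc
  have h2 := integral_mul_pd_testFun (j := j) hΩ hu (hφ.pdList l).ofReal
  have e : ∀ x, Maxwell.pd j (fun y => (pdList l φ y : ℂ)) x = (pdList (j :: l) φ x : ℂ) :=
    fun x => pd_clm_comp Complex.ofRealCLM j ((hφ.pdList l).differentiable x)
  simp_rw [e] at h2
  rwa [h2, norm_neg] at h1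

theorem DualBound.mono {Ω : Set E3} {N : ℝ} {n m : ℕ} {u : E3 → ℂ} (h : DualBound Ω N n u)
    (hm : m ≤ n) : DualBound Ω N m u := fun l hl => h l (hl.trans hm)

/-- The Sobolev bound of `H⁵(Ω)` in `W^{2,∞}(Ω)`. -/
theorem exists_norm_le_of_normH_lt_one {Ω : Set E3} (hΩ : IsOpen Ω)
    (hb : Bornology.IsBounded Ω) (hL : HasLipschitzBoundary Ω) :
    ∃ M : ℝ, 0 ≤ M ∧ ∀ (k : ℕ) (u : E3 → ℂ), 5 ≤ k → ContDiffOn ℝ 2 u Ω → normH Ω k u < 1 →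
      ∀ x ∈ Ω, ‖u x‖ ≤ M ∧ (∀ i, ‖pd i u x‖ ≤ M) ∧ ∀ i j, ‖pd i (pd j u) x‖ ≤ M := by
  obtain ⟨C, hC0, hC⟩ := exists_norm_le_of_dualBound hΩ hb hL
  have hvol : volume Ω ≠ ⊤ := hb.measure_lt_top.ne
  set N := ((volume Ω) ^ (1 / 2 : ℝ)).toReal with hN
  have hN0 : 0 ≤ N := ENNReal.toReal_nonneg
  refine ⟨N * C, mul_nonneg hN0 hC0, fun k u hk hu hlt x hx => ?_⟩
  -- The box argument spends three orders and up to two are spent on classical derivatives of `u`,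
  -- which explains the order five.
  have d0 : DualBound Ω N 5 u := dualBound_of_normH_lt_one hvol hk hlt
  have d1 : ∀ i, DualBound Ω N 4 (pd i u) := fun i => d0.pd hΩ (hu.of_le (by norm_num)) i
  have c1 : ∀ i, ContDiffOn ℝ 1 (pd i u) Ω := fun i => contDiffOn_pd (n := 1) hΩ hu i
  have d2 : ∀ i j, DualBound Ω N 3 (pd i (pd j u)) := fun i j => (d1 j).pd hΩ (c1 j) i
  have c2 : ∀ i j, ContDiffOn ℝ 0 (pd i (pd j u)) Ω := fun i j =>
    contDiffOn_pd (n := 0) hΩ (c1 j) i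
  exact ⟨hC N u hN0 hu.continuousOn (d0.mono (by norm_num)) x hx,
    fun i => hC N _ hN0 (c1 i).continuousOn ((d1 i).mono (by norm_num)) x hx,
    fun i j => hC N _ hN0 (c2 i j).continuousOn (d2 i j) x hx⟩

theorem HasWeakDeriv.ae_eq {Ω : Set E3} (hΩ : IsOpen Ω) {β : Fin 3 → ℕ} {f g g' : E3 → ℂ}
    (h : HasWeakDeriv Ω β f g) (h' : HasWeakDeriv Ω β f g') : g =ᵐ[volume.restrict Ω] g' := by
  refine ae_eq_of_integral_testFun_eq hΩ h.2.1 h'.2.1 fun φ hφ => ?_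
  have := (h.2.2 φ hφ).symm.trans (h'.2.2 φ hφ)
  exact mul_left_cancel₀ (by simp) this

theorem weakDerivNorm_eq {Ω : Set E3} (hΩ : IsOpen Ω) {β : Fin 3 → ℕ} {f g : E3 → ℂ}
    (h : HasWeakDeriv Ω β f g) : weakDerivNorm Ω β f = eLpNorm g 2 (volume.restrict Ω) := by
  refine le_antisymm (iInf₂_le g h) (le_iInf₂ fun g' h' => ?_)
  exact (eLpNorm_congr_ae (h.ae_eq hΩ h')).le

theorem weakDeriv_spec {Ω : Set E3} {β : Fin 3 → ℕ} {f g : E3 → ℂ}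
    (h : HasWeakDeriv Ω β f g) : HasWeakDeriv Ω β f (weakDeriv Ω β f) := by
  have hex : ∃ g, HasWeakDeriv Ω β f g := ⟨g, h⟩
  rw [weakDeriv, dif_pos hex]
  exact hex.choose_spec

theorem HasWeakDeriv.zero_of_locallyIntegrableOn {Ω : Set E3} {f : E3 → ℂ}
    (h : LocallyIntegrableOn f Ω) : HasWeakDeriv Ω 0 f f :=
  ⟨h, h, fun φ _ => by simp [multiPd]⟩

theorem MemH.memLp {Ω : Set E3} (hΩ : IsOpen Ω) {k : ℕ} {f : E3 → ℂ} (h : MemH Ω k f) :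
    MemLp f 2 (volume.restrict Ω) := by
  obtain ⟨g, hg, hgL⟩ := h 0 (by simp)
  exact hgL.ae_eq (hg.ae_eq hΩ (HasWeakDeriv.zero_of_locallyIntegrableOn hg.1))

theorem MemH.hasL2Deriv {Ω : Set E3} (hΩ : IsOpen Ω) {k : ℕ} {f : E3 → ℂ} (h : MemH Ω k f)
    (hk : 1 ≤ k) (j : Fin 3) : HasL2Deriv Ω j f (weakPd Ω j f) := by
  obtain ⟨g, hg, hgL⟩ := h (Pi.single j 1) (by simpa using hk)
  have hw := weakDeriv_spec hg
  exact hasL2Deriv_iff.2 ⟨hw, h.memLp hΩ, hgL.ae_eq (hg.ae_eq hΩ hw)⟩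

theorem MemH.exists_hasL2Deriv_weakPd {Ω : Set E3} (hΩ : IsOpen Ω) {k : ℕ} {f : E3 → ℂ}
    (h : MemH Ω k f) (hk : 2 ≤ k) (i j : Fin 3) : ∃ g, HasL2Deriv Ω i (weakPd Ω j f) g := by
  obtain ⟨g, hg, hgL⟩ := h (Pi.single i 1 + Pi.single j 1)
    (by simpa [Finset.sum_add_distrib] using hk)
  have hj := h.hasL2Deriv hΩ (by omega) j
  refine ⟨g, hj.memLp_deriv, hgL, fun φ hφ => ?_⟩
  have h1 := hg.2.2 φ hφ
  have h2 := hj.integral_eq _ (hφ.pd i)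
  have e : multiPd (Pi.single i 1 + Pi.single j 1) φ = pd j (pd i φ) := by
    rw [← pd_multiPd hφ, multiPd_single]
  rw [e, h2] at h1
  have hs : ∑ l, (Pi.single i 1 + Pi.single j 1 : Fin 3 → ℕ) l = 2 := by
    simp [Finset.sum_add_distrib]
  rw [hs] at h1
  linear_combination -h1

theorem memH_one_of_hasL2Deriv {Ω : Set E3} {f : E3 → ℂ}
    (h : ∀ j, ∃ g, HasL2Deriv Ω j f g) : MemH Ω 1 f := by
  obtain ⟨g₀, hg₀⟩ := h 0
  intro β hβ
  by_cases h0 : β = 0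
  · subst h0
    refine ⟨f, HasWeakDeriv.zero_of_locallyIntegrableOn ?_, hg₀.memLp⟩
    exact (hasL2Deriv_iff.1 hg₀).1.1
  · obtain ⟨j, hj⟩ : ∃ j, β = Pi.single j 1 := by
      rw [Fin.sum_univ_three] at hβ
      have : ∃ j, β j ≠ 0 := by
        by_contra hn
        push Not at hn
        exact h0 (funext hn)
      obtain ⟨j, hj⟩ := this
      refine ⟨j, ?_⟩
      ext i
      fin_cases j <;> fin_cases i <;> simp at hj ⊢ <;> omega
    subst hj
    obtain ⟨g, hg⟩ := h j
    exact ⟨g, (hasL2Deriv_iff.1 hg).1, hg.memLp_deriv⟩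

theorem eLpNorm_le_normH {Ω : Set E3} (hΩ : IsOpen Ω) {k : ℕ} {f : E3 → ℂ} :
    eLpNorm f 2 (volume.restrict Ω) ≤ normH Ω k f := by
  refine le_trans ?_ (weakDerivNorm_le_normH (β := 0) (by simp) f)
  refine le_iInf₂ fun g hg => ?_
  exact (eLpNorm_congr_ae
    ((HasWeakDeriv.zero_of_locallyIntegrableOn hg.1).ae_eq hΩ hg)).le

theorem HasL2Deriv.eLpNorm_le_normH {Ω : Set E3} (hΩ : IsOpen Ω) {j : Fin 3} {f f' : E3 → ℂ}
    (h : HasL2Deriv Ω j f f') : eLpNorm f' 2 (volume.restrict Ω) ≤ normH Ω 1 f := by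
  rw [← weakDerivNorm_eq hΩ (hasL2Deriv_iff.1 h).1]
  exact weakDerivNorm_le_normH (by simp) f

theorem normH_le_normHVec {ι : Type*} [Fintype ι] {Ω : Set E3} {k : ℕ} {Y : E3 → ι → ℂ} (i : ι) :
    normH Ω k (fun x => Y x i) ≤ normHVec Ω k Y := by
  calc normH Ω k (fun x => Y x i) = (normH Ω k (fun x => Y x i) ^ 2) ^ (1 / 2 : ℝ) := by
        rw [← ENNReal.rpow_natCast, ← ENNReal.rpow_mul]
        norm_num
    _ ≤ _ := ENNReal.rpow_le_rpow (Finset.single_le_sum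
        (f := fun i => normH Ω k (fun x => Y x i) ^ 2) (fun _ _ => by positivity)
        (Finset.mem_univ i)) (by norm_num)

/-- The norm is infinite when a weak derivative is missing, so finiteness alone gives regularity.
This serves `Y₁`, which enters the estimate only through its norm. -/
theorem exists_hasL2Deriv_of_normH_ne_top {Ω : Set E3} (hΩ : IsOpen Ω) {f : E3 → ℂ}
    (h : normH Ω 1 f ≠ ⊤) (j : Fin 3) : ∃ g, HasL2Deriv Ω j f g := by
  have h1 := (weakDerivNorm_le_normH (Ω := Ω) (k := 1) (β := Pi.single j 1) (by simp)
    f).trans_lt h.lt_top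
  simp only [weakDerivNorm, iInf_lt_iff] at h1
  obtain ⟨g, hg, hg1⟩ := h1
  have h0 := (Maxwell.eLpNorm_le_normH hΩ (k := 1) (f := f)).trans_lt h.lt_top
  exact ⟨g, hasL2Deriv_iff.2 ⟨hg, ⟨hg.1.aestronglyMeasurable, h0⟩,
    ⟨hg.2.1.aestronglyMeasurable, hg1⟩⟩⟩

end Maxwell

namespace Maxwell

open Filter Topology Function

/-! ### Functions of class `C¹` with bounded derivatives -/

theorem pd_add {j : Fin 3} {u v : E3 → ℂ} {x : E3} (hu : DifferentiableAt ℝ u x)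
    (hv : DifferentiableAt ℝ v x) : pd j (fun y => u y + v y) x = pd j u x + pd j v x := by
  have : fderiv ℝ (fun y => u y + v y) x = _ := (hu.hasFDerivAt.add hv.hasFDerivAt).fderiv
  rw [pd, this]
  rfl

theorem pd_const_mul {j : Fin 3} {u : E3 → ℂ} {x : E3} (hu : DifferentiableAt ℝ u x) (c : ℂ) :
    pd j (fun y => c * u y) x = c * pd j u x := by
  have : fderiv ℝ (fun y => c * u y) x = _ := (hu.hasFDerivAt.const_mul c).fderiv
  rw [pd, this]
  rfl

theorem pd_const {j : Fin 3} {x : E3} (c : ℂ) : pd j (fun _ => c) x = 0 := by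
  simp [pd]

theorem pd_star {j : Fin 3} {u : E3 → ℂ} {x : E3} (hu : DifferentiableAt ℝ u x) :
    pd j (fun y => star (u y)) x = star (pd j u x) :=
  pd_clm_comp Complex.conjCLE.toContinuousLinearMap j hu

theorem pd_cexp {j : Fin 3} {u : E3 → ℂ} {x : E3} (hu : DifferentiableAt ℝ u x) :
    pd j (fun y => Complex.exp (u y)) x = Complex.exp (u x) * pd j u x := by
  have : fderiv ℝ (fun y => Complex.exp (u y)) x = _ := hu.hasFDerivAt.cexp.fderiv
  rw [pd, this]
  rfl

section IsC1Bounded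

variable {Ω : Set E3} {m m' : E3 → ℂ}

theorem IsC1Bounded.differentiableAt (hΩ : IsOpen Ω) (h : IsC1Bounded Ω m) {x : E3}
    (hx : x ∈ Ω) : DifferentiableAt ℝ m x := differentiableAt_of_contDiffOn hΩ h.contDiffOn hx

theorem IsC1Bounded.congr (hΩ : IsOpen Ω) (h : IsC1Bounded Ω m) (he : ∀ x ∈ Ω, m' x = m x) :
    IsC1Bounded Ω m' := by
  refine ⟨h.contDiffOn.congr he, h.bound.imp fun C hC x hx => ?_,
    h.bound_pd.imp fun C hC j x hx => ?_⟩
  · rw [he x hx]; exact hC x hx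
  · rw [pd_congr hΩ he j hx]; exact hC j x hx

theorem isC1Bounded_const (c : ℂ) : IsC1Bounded Ω fun _ => c :=
  ⟨contDiffOn_const, ⟨‖c‖, fun _ _ => le_rfl⟩, ⟨0, fun j x _ => by simp [pd_const]⟩⟩

theorem IsC1Bounded.add (hΩ : IsOpen Ω) (h : IsC1Bounded Ω m) (h' : IsC1Bounded Ω m') :
    IsC1Bounded Ω fun x => m x + m' x := by
  obtain ⟨C, hC⟩ := h.bound
  obtain ⟨C', hC'⟩ := h'.bound
  obtain ⟨D, hD⟩ := h.bound_pd
  obtain ⟨D', hD'⟩ := h'.bound_pd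
  refine ⟨h.contDiffOn.add h'.contDiffOn, ⟨C + C', fun x hx => ?_⟩, ⟨D + D', fun j x hx => ?_⟩⟩
  · exact (norm_add_le _ _).trans (add_le_add (hC x hx) (hC' x hx))
  · rw [pd_add (h.differentiableAt hΩ hx) (h'.differentiableAt hΩ hx)]
    exact (norm_add_le _ _).trans (add_le_add (hD j x hx) (hD' j x hx))

theorem IsC1Bounded.mul (hΩ : IsOpen Ω) (h : IsC1Bounded Ω m) (h' : IsC1Bounded Ω m') :
    IsC1Bounded Ω fun x => m x * m' x := by
  obtain ⟨C, hC⟩ := h.bound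
  obtain ⟨C', hC'⟩ := h'.bound
  obtain ⟨D, hD⟩ := h.bound_pd
  obtain ⟨D', hD'⟩ := h'.bound_pd
  have nn : ∀ {a : ℂ} {b : ℝ}, ‖a‖ ≤ b → 0 ≤ b := fun h => (norm_nonneg _).trans h
  refine ⟨h.contDiffOn.mul h'.contDiffOn, ⟨C * C', fun x hx => ?_⟩,
    ⟨D * C' + C * D', fun j x hx => ?_⟩⟩
  · rw [norm_mul]
    exact mul_le_mul (hC x hx) (hC' x hx) (norm_nonneg _) (nn (hC x hx))
  · rw [pd_mul (h.differentiableAt hΩ hx) (h'.differentiableAt hΩ hx)]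
    refine (norm_add_le _ _).trans (add_le_add ?_ ?_) <;> rw [norm_mul]
    · exact mul_le_mul (hD j x hx) (hC' x hx) (norm_nonneg _) (nn (hD j x hx))
    · exact mul_le_mul (hC x hx) (hD' j x hx) (norm_nonneg _) (nn (hC x hx))

theorem IsC1Bounded.const_mul (hΩ : IsOpen Ω) (h : IsC1Bounded Ω m) (c : ℂ) :
    IsC1Bounded Ω fun x => c * m x := (isC1Bounded_const c).mul hΩ h

theorem IsC1Bounded.neg (hΩ : IsOpen Ω) (h : IsC1Bounded Ω m) :
    IsC1Bounded Ω fun x => -m x := (h.const_mul hΩ (-1)).congr hΩ fun x _ => by ring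

theorem IsC1Bounded.sub (hΩ : IsOpen Ω) (h : IsC1Bounded Ω m) (h' : IsC1Bounded Ω m') :
    IsC1Bounded Ω fun x => m x - m' x :=
  (h.add hΩ (h'.neg hΩ)).congr hΩ fun x _ => by ring

theorem IsC1Bounded.conj (hΩ : IsOpen Ω) (h : IsC1Bounded Ω m) :
    IsC1Bounded Ω fun x => star (m x) := by
  refine ⟨Complex.conjCLE.contDiff.comp_contDiffOn h.contDiffOn,
    h.bound.imp fun C hC x hx => ?_, h.bound_pd.imp fun C hC j x hx => ?_⟩
  · rw [norm_star]; exact hC x hx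
  · rw [pd_star (h.differentiableAt hΩ hx), norm_star]; exact hC j x hx

end IsC1Bounded

/-! ### The coefficients -/

/-- `σ` is of class `C²` in `Ω`, and `σ` and its derivatives of order at most two are bounded by
`M`. -/
structure IsC2Bounded (Ω : Set E3) (M : ℝ) (σ : E3 → ℝ) : Prop where
  contDiffOn : ContDiffOn ℝ 2 (fun x => (σ x : ℂ)) Ω
  bound : ∀ x ∈ Ω, ‖(σ x : ℂ)‖ ≤ M
  bound_pd : ∀ i, ∀ x ∈ Ω, ‖pd i (fun x => (σ x : ℂ)) x‖ ≤ M
  bound_pd_pd : ∀ i j, ∀ x ∈ Ω, ‖pd i (pd j fun x => (σ x : ℂ)) x‖ ≤ M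

/-- As `σ` is real, `γ` lies on the line `Re z = 1`. There the principal branches are smooth and
`|γ| ≥ 1`, so no lower bound on `γ` depends on `ω` or `σ`. -/
theorem gam_re {ω : ℝ} {σ : E3 → ℝ} (x : E3) : (gam ω σ x).re = 1 := by
  have : Complex.I * (σ x : ℂ) / (ω : ℂ) = ((σ x / ω : ℝ) : ℂ) * Complex.I := by
    push_cast
    ring
  rw [gam, this]
  simp

theorem gam_mem_slitPlane {ω : ℝ} {σ : E3 → ℝ} (x : E3) : gam ω σ x ∈ Complex.slitPlane := by
  left
  rw [gam_re]
  norm_num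

theorem gam_ne_zero {ω : ℝ} {σ : E3 → ℝ} (x : E3) : gam ω σ x ≠ 0 :=
  Complex.slitPlane_ne_zero (gam_mem_slitPlane x)

theorem one_le_norm_gam {ω : ℝ} {σ : E3 → ℝ} (x : E3) : 1 ≤ ‖gam ω σ x‖ := by
  have := Complex.abs_re_le_norm (gam ω σ x)
  rwa [gam_re, abs_one] at this

theorem exp_alp {ω : ℝ} {σ : E3 → ℝ} (x : E3) : Complex.exp (alp ω σ x) = gam ω σ x :=
  Complex.exp_log (gam_ne_zero x)

/-- Through the exponential, all derivatives of `γ^{±1/2}` reduce to those of `α`. -/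
theorem sqrtGam_eq_exp {ω : ℝ} {σ : E3 → ℝ} (x : E3) :
    sqrtGam ω σ x = Complex.exp ((1 / 2) * alp ω σ x) := by
  rw [sqrtGam, Complex.cpow_def_of_ne_zero (gam_ne_zero x), mul_comm]
  rfl

theorem inv_sqrtGam_eq_exp {ω : ℝ} {σ : E3 → ℝ} (x : E3) :
    (sqrtGam ω σ x)⁻¹ = Complex.exp ((-1 / 2) * alp ω σ x) := by
  rw [sqrtGam_eq_exp, ← Complex.exp_neg]
  congr 1
  ring

theorem sqrtGam_ne_zero {ω : ℝ} {σ : E3 → ℝ} (x : E3) : sqrtGam ω σ x ≠ 0 := by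
  rw [sqrtGam_eq_exp]
  exact Complex.exp_ne_zero _

theorem sqrtGam_sq {ω : ℝ} {σ : E3 → ℝ} (x : E3) : sqrtGam ω σ x ^ 2 = gam ω σ x := by
  rw [sqrtGam_eq_exp, ← Complex.exp_nat_mul, ← exp_alp]
  congr 1
  push_cast
  ring

theorem one_le_norm_sqrtGam {ω : ℝ} {σ : E3 → ℝ} (x : E3) : 1 ≤ ‖sqrtGam ω σ x‖ := by
  have h := one_le_norm_gam (ω := ω) (σ := σ) x
  rw [← sqrtGam_sq, norm_pow] at h
  exact (one_le_sq_iff₀ (norm_nonneg _)).1 h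

theorem norm_inv_sqrtGam_le {ω : ℝ} {σ : E3 → ℝ} (x : E3) : ‖(sqrtGam ω σ x)⁻¹‖ ≤ 1 := by
  rw [norm_inv]
  exact inv_le_one_of_one_le₀ (one_le_norm_sqrtGam x)

section Coefficients

variable {Ω : Set E3} {M ω : ℝ} {σ : E3 → ℝ}

theorem IsC2Bounded.contDiffOn_gam (h : IsC2Bounded Ω M σ) : ContDiffOn ℝ 2 (gam ω σ) Ω := by
  have : gam ω σ = fun x => 1 + Complex.I / ω * (σ x : ℂ) := by
    ext x
    rw [gam]
    ring
  rw [this]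
  exact contDiffOn_const.add (contDiffOn_const.mul h.contDiffOn)

theorem IsC2Bounded.contDiffOn_alp (h : IsC2Bounded Ω M σ) : ContDiffOn ℝ 2 (alp ω σ) Ω :=
  fun x hx => ((Complex.contDiffAt_log (n := 2) (gam_mem_slitPlane x)).restrict_scalars
    ℝ).comp_contDiffWithinAt x (h.contDiffOn_gam x hx)

theorem IsC2Bounded.differentiableAt (hΩ : IsOpen Ω) (h : IsC2Bounded Ω M σ) {x : E3}
    (hx : x ∈ Ω) : DifferentiableAt ℝ (fun x => (σ x : ℂ)) x :=
  differentiableAt_of_contDiffOn hΩ (h.contDiffOn.of_le (by norm_num)) hx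

theorem IsC2Bounded.differentiableAt_alp (hΩ : IsOpen Ω) (h : IsC2Bounded Ω M σ) {x : E3}
    (hx : x ∈ Ω) : DifferentiableAt ℝ (alp ω σ) x :=
  differentiableAt_of_contDiffOn hΩ (h.contDiffOn_alp.of_le (by norm_num)) hx

theorem IsC2Bounded.pd_gam (hΩ : IsOpen Ω) (h : IsC2Bounded Ω M σ) (j : Fin 3) {x : E3}
    (hx : x ∈ Ω) : pd j (gam ω σ) x = Complex.I / ω * pd j (fun x => (σ x : ℂ)) x := by
  have : gam ω σ = fun x => 1 + Complex.I / ω * (σ x : ℂ) := by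
    ext x
    rw [gam]
    ring
  have hd := h.differentiableAt hΩ hx
  rw [this, pd_add (differentiableAt_const _) (hd.const_mul _), pd_const, pd_const_mul hd, zero_add]

/-- Differentiate `exp α = γ`. The factor `γ` is kept on the left: it has modulus at least `1` and
can be dropped in estimates without any division. -/
theorem IsC2Bounded.gam_mul_pd_alp (hΩ : IsOpen Ω) (h : IsC2Bounded Ω M σ) (j : Fin 3) {x : E3}
    (hx : x ∈ Ω) :
    gam ω σ x * pd j (alp ω σ) x = Complex.I / ω * pd j (fun x => (σ x : ℂ)) x := by
  rw [← h.pd_gam hΩ j hx, ← exp_alp, ← pd_cexp (h.differentiableAt_alp hΩ hx)]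
  simp_rw [exp_alp]

theorem norm_I_div_le (hω : 1 ≤ ω) : ‖Complex.I / (ω : ℂ)‖ ≤ 1 := by
  rw [norm_div, Complex.norm_I, Complex.norm_real, Real.norm_eq_abs, abs_of_pos (by linarith)]
  exact (div_le_one (by linarith)).2 hω

theorem IsC2Bounded.norm_pd_alp_le (hΩ : IsOpen Ω) (h : IsC2Bounded Ω M σ) (hω : 1 ≤ ω)
    (j : Fin 3) {x : E3} (hx : x ∈ Ω) : ‖pd j (alp ω σ) x‖ ≤ M := by
  have h1 := congrArg norm (h.gam_mul_pd_alp (ω := ω) hΩ j hx)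
  rw [norm_mul, norm_mul] at h1
  have h2 := one_le_norm_gam (ω := ω) (σ := σ) x
  have h3 := h.bound_pd j x hx
  have h4 := norm_I_div_le hω
  calc ‖pd j (alp ω σ) x‖ ≤ ‖gam ω σ x‖ * ‖pd j (alp ω σ) x‖ :=
        le_mul_of_one_le_left (norm_nonneg _) h2
    _ ≤ 1 * M := by
        rw [h1]
        exact mul_le_mul h4 h3 (norm_nonneg _) zero_le_one
    _ = M := one_mul M

theorem IsC2Bounded.isC1Bounded_pd_alp (hΩ : IsOpen Ω) (h : IsC2Bounded Ω M σ) (hω : 1 ≤ ω)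
    (j : Fin 3) : IsC1Bounded Ω (pd j (alp ω σ)) := by
  have hc : ContDiffOn ℝ 1 (pd j (alp ω σ)) Ω := contDiffOn_pd (n := 1) hΩ h.contDiffOn_alp j
  refine ⟨hc, ⟨M, fun x hx => h.norm_pd_alp_le hΩ hω j hx⟩, ⟨M + M * M, fun i x hx => ?_⟩⟩
  have hM : 0 ≤ M := (norm_nonneg _).trans (h.bound x hx)
  have hcσ : ContDiffOn ℝ 1 (pd j fun x => (σ x : ℂ)) Ω := contDiffOn_pd (n := 1) hΩ h.contDiffOn j
  -- Second derivatives of `α` are found by differentiating `γ ∂ⱼα = (i/ω) ∂ⱼσ` once more and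
  -- discarding the factor `γ`.
  have e := pd_congr hΩ (fun y hy => h.gam_mul_pd_alp (ω := ω) hΩ j hy) i hx
  rw [pd_mul (differentiableAt_of_contDiffOn hΩ (h.contDiffOn_gam.of_le (by norm_num)) hx)
    (differentiableAt_of_contDiffOn hΩ hc hx),
    pd_const_mul (differentiableAt_of_contDiffOn hΩ hcσ hx), h.pd_gam hΩ i hx] at e
  have e' : gam ω σ x * pd i (pd j (alp ω σ)) x =
      Complex.I / ω * (pd i (pd j fun x => (σ x : ℂ)) x -
        pd i (fun x => (σ x : ℂ)) x * pd j (alp ω σ) x) := by linear_combination e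
  have h2 := one_le_norm_gam (ω := ω) (σ := σ) x
  calc ‖pd i (pd j (alp ω σ)) x‖ ≤ ‖gam ω σ x‖ * ‖pd i (pd j (alp ω σ)) x‖ :=
        le_mul_of_one_le_left (norm_nonneg _) h2
    _ ≤ 1 * (M + M * M) := by
        rw [← norm_mul, e', norm_mul]
        refine mul_le_mul (norm_I_div_le hω) ?_ (norm_nonneg _) zero_le_one
        refine (norm_sub_le _ _).trans (add_le_add (h.bound_pd_pd i j x hx) ?_)
        rw [norm_mul]
        exact mul_le_mul (h.bound_pd i x hx) (h.norm_pd_alp_le hΩ hω j hx) (norm_nonneg _) hM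
    _ = _ := one_mul _

theorem IsC2Bounded.norm_gam_le (h : IsC2Bounded Ω M σ) (hω : 1 ≤ ω) {x : E3}
    (hx : x ∈ Ω) : ‖gam ω σ x‖ ≤ 1 + M := by
  have : gam ω σ x = 1 + Complex.I / ω * (σ x : ℂ) := by
    rw [gam]
    ring
  rw [this]
  refine (norm_add_le _ _).trans (add_le_add (by simp) ?_)
  rw [norm_mul]
  calc _ ≤ 1 * M := mul_le_mul (norm_I_div_le hω) (h.bound x hx) (norm_nonneg _) zero_le_one
    _ = M := one_mul M

theorem IsC2Bounded.norm_sqrtGam_le (h : IsC2Bounded Ω M σ) (hω : 1 ≤ ω) {x : E3}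
    (hx : x ∈ Ω) : ‖sqrtGam ω σ x‖ ≤ 1 + M := by
  have h1 := h.norm_gam_le hω hx
  rw [← sqrtGam_sq, norm_pow] at h1
  have h2 := one_le_norm_sqrtGam (ω := ω) (σ := σ) x
  nlinarith

theorem IsC2Bounded.pd_sqrtGam (hΩ : IsOpen Ω) (h : IsC2Bounded Ω M σ) (j : Fin 3) {x : E3}
    (hx : x ∈ Ω) : pd j (sqrtGam ω σ) x = 1 / 2 * pd j (alp ω σ) x * sqrtGam ω σ x := by
  have hd := h.differentiableAt_alp (ω := ω) hΩ hx
  rw [pd_congr hΩ (fun y _ => sqrtGam_eq_exp y) j hx, pd_cexp (hd.const_mul _), pd_const_mul hd,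
    sqrtGam_eq_exp]
  ring

theorem IsC2Bounded.pd_inv_sqrtGam (hΩ : IsOpen Ω) (h : IsC2Bounded Ω M σ) (j : Fin 3) {x : E3}
    (hx : x ∈ Ω) : pd j (fun x => (sqrtGam ω σ x)⁻¹) x =
      -1 / 2 * pd j (alp ω σ) x * (sqrtGam ω σ x)⁻¹ := by
  have hd := h.differentiableAt_alp (ω := ω) hΩ hx
  rw [pd_congr hΩ (fun y _ => inv_sqrtGam_eq_exp y) j hx, pd_cexp (hd.const_mul _),
    pd_const_mul hd, inv_sqrtGam_eq_exp]
  ring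

theorem IsC2Bounded.isC1Bounded_sqrtGam (hΩ : IsOpen Ω) (h : IsC2Bounded Ω M σ) (hω : 1 ≤ ω) :
    IsC1Bounded Ω (sqrtGam ω σ) := by
  refine ⟨?_, ⟨1 + M, fun x hx => h.norm_sqrtGam_le hω hx⟩, ⟨1 / 2 * M * (1 + M), fun j x hx => ?_⟩⟩
  · refine ContDiffOn.congr ?_ fun x _ => sqrtGam_eq_exp x
    exact (contDiffOn_const.mul (h.contDiffOn_alp.of_le (by norm_num))).cexp
  · have hM : 0 ≤ M := (norm_nonneg _).trans (h.bound x hx)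
    rw [h.pd_sqrtGam hΩ j hx, norm_mul, norm_mul]
    have := h.norm_pd_alp_le hΩ hω j hx
    have := h.norm_sqrtGam_le hω hx
    have e : ‖(1 / 2 : ℂ)‖ = 1 / 2 := by norm_num
    rw [e]
    gcongr

theorem IsC2Bounded.norm_pd_inv_sqrtGam_le (hΩ : IsOpen Ω) (h : IsC2Bounded Ω M σ) (hω : 1 ≤ ω)
    (j : Fin 3) {x : E3} (hx : x ∈ Ω) : ‖pd j (fun x => (sqrtGam ω σ x)⁻¹) x‖ ≤ M := by
  have hM : 0 ≤ M := (norm_nonneg _).trans (h.bound x hx)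
  rw [h.pd_inv_sqrtGam hΩ j hx, norm_mul, norm_mul]
  have h1 := h.norm_pd_alp_le hΩ hω j hx
  have h2 := norm_inv_sqrtGam_le (ω := ω) (σ := σ) x
  have e : ‖(-1 / 2 : ℂ)‖ = 1 / 2 := by norm_num
  rw [e]
  calc _ ≤ 1 / 2 * M * 1 := by gcongr
    _ ≤ M := by linarith

theorem IsC2Bounded.norm_pd_sqrtGam_le (hΩ : IsOpen Ω) (h : IsC2Bounded Ω M σ) (hω : 1 ≤ ω)
    (j : Fin 3) {x : E3} (hx : x ∈ Ω) : ‖pd j (sqrtGam ω σ) x‖ ≤ M * (1 + M) := by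
  have hM : 0 ≤ M := (norm_nonneg _).trans (h.bound x hx)
  rw [h.pd_sqrtGam hΩ j hx, norm_mul, norm_mul]
  have h1 := h.norm_pd_alp_le hΩ hω j hx
  have h2 := h.norm_sqrtGam_le hω hx
  have e : ‖(1 / 2 : ℂ)‖ = 1 / 2 := by norm_num
  rw [e]
  calc _ ≤ 1 / 2 * M * (1 + M) := by gcongr
    _ ≤ M * (1 + M) := by nlinarith [mul_nonneg hM (by linarith : 0 ≤ 1 + M)]

theorem IsC2Bounded.isC1Bounded_inv_sqrtGam (hΩ : IsOpen Ω) (h : IsC2Bounded Ω M σ)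
    (hω : 1 ≤ ω) : IsC1Bounded Ω fun x => (sqrtGam ω σ x)⁻¹ := by
  refine ⟨?_, ⟨1, fun x _ => norm_inv_sqrtGam_le x⟩,
    ⟨M, fun j x hx => h.norm_pd_inv_sqrtGam_le hΩ hω j hx⟩⟩
  refine ContDiffOn.congr ?_ fun x _ => inv_sqrtGam_eq_exp x
  exact (contDiffOn_const.mul (h.contDiffOn_alp.of_le (by norm_num))).cexp

theorem IsC2Bounded.isC1Bounded_pd_inv_sqrtGam (hΩ : IsOpen Ω) (h : IsC2Bounded Ω M σ)
    (hω : 1 ≤ ω) (j : Fin 3) : IsC1Bounded Ω (pd j fun x => (sqrtGam ω σ x)⁻¹) :=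
  (((h.isC1Bounded_pd_alp hΩ hω j).const_mul hΩ (-1 / 2)).mul hΩ
    (h.isC1Bounded_inv_sqrtGam hΩ hω)).congr hΩ fun _ hx => h.pd_inv_sqrtGam hΩ j hx

theorem IsC2Bounded.isC1Bounded_kap (hΩ : IsOpen Ω) (h : IsC2Bounded Ω M σ) (hω : 1 ≤ ω) :
    IsC1Bounded Ω (kap ω σ) := (h.isC1Bounded_sqrtGam hΩ hω).const_mul hΩ _

theorem IsC2Bounded.pd_kap (hΩ : IsOpen Ω) (h : IsC2Bounded Ω M σ) (hω : 1 ≤ ω) (j : Fin 3)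
    {x : E3} (hx : x ∈ Ω) : pd j (kap ω σ) x = 1 / 2 * pd j (alp ω σ) x * kap ω σ x := by
  have hd := (h.isC1Bounded_sqrtGam hΩ hω).differentiableAt hΩ hx
  change pd j (fun y => (ω : ℂ) * sqrtGam ω σ y) x = _
  rw [pd_const_mul hd, h.pd_sqrtGam hΩ j hx, kap]
  ring

end Coefficients

/-! ### Algebra of the matrix potentials -/

/-- This is `N(α) P₊(ζ) = P₋(ζ) N(α)ᵗ`, the reason why `(P + W)(P - Wᵗ)` has no first order terms.
-/
theorem bordered_mul_bordered (α ζ : Fin 3 → ℂ) :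
    bordered α (crossMat α) * bordered ζ (crossMat ζ) =
      bordered ζ (-crossMat ζ) * (bordered α (crossMat α))ᵀ := by
  ext i j
  rcases i with i | i <;> rcases j with j | j <;> fin_cases i <;> fin_cases j <;>
    simp [bordered, crossMat, Matrix.mul_apply, Fin.sum_univ_three] <;> ring

theorem bordered_mul_transpose (α : Fin 3 → ℂ) :
    bordered α (crossMat α) * (bordered α (crossMat α))ᵀ = (α ⬝ᵥ α) • 1 := by
  ext i j
  rcases i with i | i <;> rcases j with j | j <;> fin_cases i <;> fin_cases j <;>
    simp [bordered, crossMat, Matrix.mul_apply, Fin.sum_univ_three, dotProduct] <;> ring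

/-- The left side is what `P` produces when it differentiates `Nᵗ`; it is the block `S` of `Q`. The
symmetry of second derivatives removes the off-diagonal blocks. -/
theorem sum_bordered_mul_bordered {H : Matrix (Fin 3) (Fin 3) ℂ} (hH : ∀ i j, H i j = H j i) :
    ∑ j, bordered (Pi.single j 1) (-crossMat (Pi.single j 1)) *
      (bordered (H j) (crossMat (H j)))ᵀ =
    Matrix.fromBlocks (H.trace • (1 : Matrix Unit Unit ℂ)) 0 0
      ((2 : ℂ) • H - H.trace • (1 : Matrix (Fin 3) (Fin 3) ℂ)) := by
  have h01 := hH 1 0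
  have h02 := hH 2 0
  have h12 := hH 2 1
  ext i j
  rcases i with i | i <;> rcases j with j | j <;> fin_cases i <;> fin_cases j <;>
    simp [bordered, crossMat, Matrix.mul_apply, Fin.sum_univ_three, Matrix.trace, h01, h02, h12] <;>
    ring

/-- The matrix `[0, N; 0, 0]` with `N = [0, ζ·; ζ, ζ×]`. -/
def upperN (ζ : Fin 3 → ℂ) : Matrix I8 I8 ℂ :=
  Matrix.fromBlocks 0 (bordered ζ (crossMat ζ)) 0 0

theorem upperN_apply (ζ : Fin 3 → ℂ) (k l : I8) :
    upperN ζ k l = ∑ i, ζ i * upperN (Pi.single i 1) k l := by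
  rw [Fin.sum_univ_three]
  rcases k with (k | k) | k <;> rcases l with l | (l | l)
  all_goals try simp [upperN]
  · simp [bordered]
  · simp [bordered, Pi.single_apply]
    fin_cases l <;> simp
  · simp [bordered, Pi.single_apply]
    fin_cases k <;> simp
  · fin_cases k <;> fin_cases l <;> simp [bordered, crossMat]

theorem upperN_smul (c : ℂ) (ζ : Fin 3 → ℂ) : upperN (c • ζ) = c • upperN ζ := by
  ext k l
  rw [Matrix.smul_apply, upperN_apply, upperN_apply ζ, Finset.smul_sum]
  simp [mul_assoc]

theorem symbolP_apply (ζ : Fin 3 → ℂ) (k l : I8) :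
    symbolP ζ k l = ∑ i, ζ i * symbolP (Pi.single i 1) k l := by
  rw [Fin.sum_univ_three]
  rcases k with (k | k) | (k | k) <;> rcases l with (l | l) | (l | l)
  all_goals try simp [symbolP, bordered]
  · fin_cases l <;> simp
  · fin_cases k <;> simp
  · fin_cases k <;> fin_cases l <;> simp [crossMat]
  · fin_cases l <;> simp
  · fin_cases k <;> simp
  · fin_cases k <;> fin_cases l <;> simp [crossMat]

/-- The coefficient matrices of `P` are symmetric and, by `star_symbolP_single`, real. Since `D =
-i∇`, the operator `P` is formally self-adjoint. -/
theorem symbolP_single_transpose (j : Fin 3) :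
    (symbolP (Pi.single j 1))ᵀ = symbolP (Pi.single j 1) := by
  ext k l
  rcases k with (k | k) | (k | k) <;> rcases l with (l | l) | (l | l)
  all_goals try simp [symbolP, bordered]
  all_goals fin_cases j <;> fin_cases k <;> fin_cases l <;> simp [crossMat]

theorem star_symbolP_single (j : Fin 3) (k l : I8) :
    star (symbolP (Pi.single j 1) k l) = symbolP (Pi.single j 1) k l := by
  rcases k with (k | k) | (k | k) <;> rcases l with (l | l) | (l | l)
  all_goals try simp [symbolP, bordered, Pi.single_apply]
  all_goals first
    | done
    | (fin_cases j <;> fin_cases k <;> fin_cases l <;> simp [crossMat])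

theorem potW_eq (ω : ℝ) (σ : E3 → ℝ) (x : E3) :
    potW ω σ x = kap ω σ x • 1 + (1 / 2 : ℂ) • upperN (gradD (alp ω σ) x) := rfl

/-- The scalar part `κ` commutes with everything, and the nilpotent part is handled by
`bordered_mul_bordered`. As a consequence `W P Z - P (Wᵗ Z)` contains no derivative of `Z`. -/
theorem potW_mul_symbolP (ω : ℝ) (σ : E3 → ℝ) (x : E3) (ζ : Fin 3 → ℂ) :
    potW ω σ x * symbolP ζ = symbolP ζ * (potW ω σ x)ᵀ := by
  rw [potW_eq]
  simp only [Matrix.transpose_add, Matrix.transpose_smul, Matrix.transpose_one, add_mul, mul_add,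
    Matrix.smul_mul, Matrix.mul_smul, one_mul, mul_one]
  congr 2
  simp only [upperN, symbolP, Matrix.fromBlocks_multiply, Matrix.fromBlocks_transpose,
    bordered_mul_bordered]
  simp

/-- The entrywise derivative of `Wᵗ`. -/
noncomputable def pdPotWt (ω : ℝ) (σ : E3 → ℝ) (j : Fin 3) (x : E3) : Matrix I8 I8 ℂ :=
  Matrix.of fun k l => pd j (fun y => (potW ω σ y)ᵀ k l) x

theorem potW_transpose_apply (ω : ℝ) (σ : E3 → ℝ) (k l : I8) (x : E3) :
    (potW ω σ x)ᵀ k l = (1 : Matrix I8 I8 ℂ) l k * kap ω σ x +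
      (upperN (Pi.single 0 1) l k / 2 * -Complex.I * pd 0 (alp ω σ) x +
        (upperN (Pi.single 1 1) l k / 2 * -Complex.I * pd 1 (alp ω σ) x +
          upperN (Pi.single 2 1) l k / 2 * -Complex.I * pd 2 (alp ω σ) x)) := by
  rw [Matrix.transpose_apply, potW_eq]
  simp only [Matrix.add_apply, Matrix.smul_apply, smul_eq_mul]
  rw [upperN_apply, Fin.sum_univ_three]
  simp only [gradD]
  ring

section

variable {Ω : Set E3} {M ω : ℝ} {σ : E3 → ℝ}

theorem IsC2Bounded.isC1Bounded_potW (hΩ : IsOpen Ω) (h : IsC2Bounded Ω M σ) (hω : 1 ≤ ω)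
    (k l : I8) : IsC1Bounded Ω fun x => (potW ω σ x)ᵀ k l := by
  have ha := fun j => h.isC1Bounded_pd_alp hΩ hω j
  refine IsC1Bounded.congr hΩ ?_ fun x _ => potW_transpose_apply ω σ k l x
  exact ((h.isC1Bounded_kap hΩ hω).const_mul hΩ _).add hΩ (((ha 0).const_mul hΩ _).add hΩ
    (((ha 1).const_mul hΩ _).add hΩ ((ha 2).const_mul hΩ _)))

theorem pd_linear_combination {j : Fin 3} {u v w z : E3 → ℂ} {x : E3}
    (hu : DifferentiableAt ℝ u x) (hv : DifferentiableAt ℝ v x) (hw : DifferentiableAt ℝ w x)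
    (hz : DifferentiableAt ℝ z x) (a b c d : ℂ) :
    pd j (fun y => a * u y + (b * v y + (c * w y + d * z y))) x =
      a * pd j u x + (b * pd j v x + (c * pd j w x + d * pd j z x)) := by
  have h : fderiv ℝ (fun y => a * u y + (b * v y + (c * w y + d * z y))) x = _ :=
    ((hu.hasFDerivAt.const_mul a).add ((hv.hasFDerivAt.const_mul b).add
      ((hw.hasFDerivAt.const_mul c).add (hz.hasFDerivAt.const_mul d)))).fderiv
  rw [pd, h]
  rfl

theorem IsC2Bounded.pdPotWt_eq (hΩ : IsOpen Ω) (h : IsC2Bounded Ω M σ) (hω : 1 ≤ ω)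
    (j : Fin 3) {x : E3} (hx : x ∈ Ω) :
    pdPotWt ω σ j x = pd j (kap ω σ) x • 1 +
      (1 / 2 : ℂ) • -Complex.I • (upperN (hess (alp ω σ) x j))ᵀ := by
  ext k l
  have ha := fun i => (h.isC1Bounded_pd_alp hΩ hω i).differentiableAt hΩ hx
  have hk := (h.isC1Bounded_kap hΩ hω).differentiableAt hΩ hx
  rw [pdPotWt, Matrix.of_apply, pd_congr hΩ (fun y _ => potW_transpose_apply ω σ k l y) j hx,
    pd_linear_combination hk (ha 0) (ha 1) (ha 2)]
  simp only [Matrix.add_apply, Matrix.smul_apply, Matrix.transpose_apply, smul_eq_mul]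
  rw [upperN_apply (hess (alp ω σ) x j), Fin.sum_univ_three]
  have e : (1 : Matrix I8 I8 ℂ) l k = (1 : Matrix I8 I8 ℂ) k l := by
    simp [Matrix.one_apply, eq_comm]
  rw [e]
  simp only [hess, Matrix.of_apply]
  ring

theorem sum_symbolP_mul_smul_one (c : Fin 3 → ℂ) :
    ∑ j, symbolP (Pi.single j 1) * (c j • (1 : Matrix I8 I8 ℂ)) = symbolP c := by
  ext k l
  rw [symbolP_apply c]
  simp [Matrix.sum_apply]

/-- The matrix potential is the zero order part of `(P + W)(P - Wᵗ) + Δ`. -/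
theorem IsC2Bounded.potQ_eq (hΩ : IsOpen Ω) (h : IsC2Bounded Ω M σ) (hω : 1 ≤ ω)
    {x : E3} (hx : x ∈ Ω) :
    potQ ω σ x = -(∑ j, symbolP (Pi.single j 1) * (-Complex.I • pdPotWt ω σ j x)) -
      potW ω σ x * (potW ω σ x)ᵀ := by
  set H := hess (alp ω σ) x with hH
  set α := gradD (alp ω σ) x with hα
  set κ := kap ω σ x with hκ
  have hsym : ∀ i j, H i j = H j i := by
    intro i j
    exact pd_comm (h.contDiffOn_alp.contDiffAt (hΩ.mem_nhds hx)) i j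
  have hdk : gradD (kap ω σ) x = (1 / 2 * κ) • α := by
    ext i
    simp only [gradD, h.pd_kap hΩ hω i hx, Pi.smul_apply, smul_eq_mul, hα, hκ]
    ring
  have e1 : ∑ j, symbolP (Pi.single j 1) * (-Complex.I • pdPotWt ω σ j x) =
      symbolP (gradD (kap ω σ) x) - (1 / 2 : ℂ) • ∑ j, symbolP (Pi.single j 1) * (upperN (H j))ᵀ := by
    rw [← sum_symbolP_mul_smul_one, Finset.smul_sum, ← Finset.sum_sub_distrib]
    refine Finset.sum_congr rfl fun j _ => ?_
    rw [h.pdPotWt_eq hΩ hω j hx, ← hH, smul_add, smul_smul, mul_add]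
    rw [sub_eq_add_neg]
    congr 1
    rw [smul_smul, smul_smul, Matrix.mul_smul, ← neg_smul]
    congr 1
    have := Complex.I_sq
    linear_combination (1 / 2 : ℂ) * this
  have e2 : ∑ j, symbolP (Pi.single j 1) * (upperN (H j))ᵀ =
      Matrix.fromBlocks (Matrix.fromBlocks (H.trace • (1 : Matrix Unit Unit ℂ)) 0 0
        ((2 : ℂ) • H - H.trace • (1 : Matrix (Fin 3) (Fin 3) ℂ))) 0 0 0 := by
    rw [← sum_bordered_mul_bordered hsym, Fin.sum_univ_three, Fin.sum_univ_three]
    simp [symbolP, upperN, Matrix.fromBlocks_transpose, Matrix.fromBlocks_multiply,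
      Matrix.fromBlocks_add]
  have e3 : potW ω σ x * (potW ω σ x)ᵀ = κ ^ 2 • 1 +
      ((1 / 2 * κ) • (upperN α + (upperN α)ᵀ) +
        Matrix.fromBlocks ((1 / 4 : ℂ) • (α ⬝ᵥ α) • (1 : Matrix I4 I4 ℂ)) 0 0 0) := by
    have e4 : upperN α * (upperN α)ᵀ =
        Matrix.fromBlocks ((α ⬝ᵥ α) • (1 : Matrix I4 I4 ℂ)) 0 0 0 := by
      simp [upperN, Matrix.fromBlocks_transpose, Matrix.fromBlocks_multiply,
        bordered_mul_transpose]
    have e5 : Matrix.fromBlocks ((1 / 4 : ℂ) • (α ⬝ᵥ α) • (1 : Matrix I4 I4 ℂ)) 0 0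
        (0 : Matrix I4 I4 ℂ) = (1 / 4 : ℂ) • (upperN α * (upperN α)ᵀ) := by
      rw [e4, Matrix.fromBlocks_smul]
      simp
    rw [e5, potW_eq, ← hα, ← hκ]
    simp only [Matrix.transpose_add, Matrix.transpose_smul, Matrix.transpose_one, add_mul, mul_add,
      Matrix.smul_mul, Matrix.mul_smul, one_mul, mul_one]
    module
  -- The blocks `2Dκ` have two sources: `P(Dκ)`, from differentiating the scalar part of `Wᵗ`, and
  -- `(κ/2)(N + Nᵗ)`, from `W Wᵗ`. Because `Dκ = ½ κ Dα` they carry the same coefficient, and their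
  -- cross product parts cancel.
  have e6 : Matrix.fromBlocks ((1 / 4 : ℂ) • (α ⬝ᵥ α) • (1 : Matrix I4 I4 ℂ))
      (bordered ((2 : ℂ) • gradD (kap ω σ) x) 0) (bordered ((2 : ℂ) • gradD (kap ω σ) x) 0) 0 =
      symbolP (gradD (kap ω σ) x) + ((1 / 2 * κ) • (upperN α + (upperN α)ᵀ) +
        Matrix.fromBlocks ((1 / 4 : ℂ) • (α ⬝ᵥ α) • (1 : Matrix I4 I4 ℂ)) 0 0 0) := by
    rw [smul_add, ← Matrix.transpose_smul, ← upperN_smul, ← hdk]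
    set z := gradD (kap ω σ) x
    simp only [symbolP, upperN, Matrix.fromBlocks_transpose, Matrix.fromBlocks_add]
    have b1 : bordered ((2 : ℂ) • z) 0 = bordered z (-crossMat z) + bordered z (crossMat z) := by
      ext k l
      rcases k with k | k <;> rcases l with l | l <;> simp [bordered, two_mul]
    have b2 : bordered ((2 : ℂ) • z) 0 = bordered z (crossMat z) + (bordered z (crossMat z))ᵀ := by
      ext k l
      rcases k with k | k <;> rcases l with l | l <;> simp [bordered, two_mul]
      fin_cases k <;> fin_cases l <;> simp [crossMat]
    congr 1
    · simp
    · rw [b1]; simp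
    · rw [b2]; simp
    · simp
  rw [potQ, ← hα, ← hκ, e6, e3, e1, e2, lap, ← hH]
  abel

end

/-! ### From `Q₁ - Q₂` to `W₁ - W₂` by integration by parts -/

theorem integral_eq_of_ae_eq_add {X : Type*} [MeasurableSpace X] {μ : Measure X} {A B G : X → ℂ}
    (hG : Integrable G μ) (h0 : ∫ x, G x ∂μ = 0) (h : ∀ᵐ x ∂μ, A x = B x + G x) :
    ∫ x, A x ∂μ = ∫ x, B x ∂μ := by
  rw [integral_congr_ae h]
  -- Integrability of `A` and `B` need not be known: if one fails to be integrable so does the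
  -- other, and both integrals are `0` by convention. This avoids bounds on `Q`.
  by_cases hB : Integrable B μ
  · rw [integral_add hB hG, h0, add_zero]
  · rw [integral_undef hB, integral_undef]
    intro hi
    exact hB ((hi.sub hG).congr (by filter_upwards with x; simp))

theorem integral_eq_of_ae_eq_add_sum {X ι : Type*} [MeasurableSpace X] {μ : Measure X}
    {A B : X → ℂ} {s : Finset ι} {G : ι → X → ℂ} (hG : ∀ i, Integrable (G i) μ)
    (h0 : ∀ i, ∫ x, G i x ∂μ = 0) (c : ι → ℂ)
    (h : ∀ᵐ x ∂μ, A x = B x + ∑ i ∈ s, c i * G i x) :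
    ∫ x, A x ∂μ = ∫ x, B x ∂μ := by
  refine integral_eq_of_ae_eq_add (G := fun x => ∑ i ∈ s, c i * G i x)
    (integrable_finsetSum _ fun i _ => (hG i).const_mul _) ?_ h
  rw [integral_finsetSum _ fun i _ => (hG i).const_mul _]
  simp [integral_const_mul, h0]

section

variable {Ω : Set E3} {M ω : ℝ} {σ₁ σ₂ : E3 → ℝ}

theorem gam_congr {x : E3} (h : σ₁ x = σ₂ x) : gam ω σ₁ x = gam ω σ₂ x := by
  rw [gam, gam, h]

theorem sqrtGam_congr {x : E3} (h : σ₁ x = σ₂ x) : sqrtGam ω σ₁ x = sqrtGam ω σ₂ x := by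
  rw [sqrtGam, sqrtGam, gam_congr h]

theorem potW_congr {U : Set E3} (hU : IsOpen U) (h : ∀ x ∈ U, σ₁ x = σ₂ x) {x : E3}
    (hx : x ∈ U) : potW ω σ₁ x = potW ω σ₂ x := by
  have ha : gradD (alp ω σ₁) x = gradD (alp ω σ₂) x := by
    ext j
    rw [gradD, gradD, pd_congr hU (v := alp ω σ₂) (fun y hy => ?_) j hx]
    rw [alp, alp, gam_congr (h y hy)]
  rw [potW_eq, potW_eq, ha, kap, kap, sqrtGam_congr (h x hx)]

theorem pdPotWt_sub (hΩ : IsOpen Ω) (h₁ : IsC2Bounded Ω M σ₁) (h₂ : IsC2Bounded Ω M σ₂)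
    (hω : 1 ≤ ω) (j : Fin 3) {x : E3} (hx : x ∈ Ω) (k l : I8) :
    pd j (fun y => (potW ω σ₁ y)ᵀ k l - (potW ω σ₂ y)ᵀ k l) x =
      (pdPotWt ω σ₁ j x - pdPotWt ω σ₂ j x) k l := by
  have d1 := (h₁.isC1Bounded_potW hΩ hω k l).differentiableAt hΩ hx
  have d2 := (h₂.isC1Bounded_potW hΩ hω k l).differentiableAt hΩ hx
  have : fderiv ℝ (fun y => (potW ω σ₁ y)ᵀ k l - (potW ω σ₂ y)ᵀ k l) x = _ :=
    (d1.hasFDerivAt.sub d2.hasFDerivAt).fderiv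
  rw [pd, this]
  rfl

/-- The pointwise identity behind `(Q₁ - Q₂) Z = (W₁ - W₂)(P - W₁ᵗ) Z - (P + W₂)(W₁ - W₂)ᵗ Z`. -/
theorem dotProduct_potQ_sub (hΩ : IsOpen Ω) (h₁ : IsC2Bounded Ω M σ₁)
    (h₂ : IsC2Bounded Ω M σ₂) (hω : 1 ≤ ω) {x : E3} (hx : x ∈ Ω) (z : I8 → ℂ)
    (z' : Fin 3 → I8 → ℂ) (y : I8 → ℂ) (y' : Fin 3 → I8 → ℂ)
    (hy : ∑ j, Complex.I • (symbolP (Pi.single j 1) *ᵥ y' j) + (potW ω σ₂ x)ᵀ *ᵥ y = 0) :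
    ((potQ ω σ₁ x - potQ ω σ₂ x) *ᵥ z) ⬝ᵥ y =
      ((potW ω σ₁ x - potW ω σ₂ x) *ᵥ (∑ j, symbolP (Pi.single j 1) *ᵥ (-Complex.I • z' j) -
        (potW ω σ₁ x)ᵀ *ᵥ z)) ⬝ᵥ y +
      ∑ j, Complex.I * ((symbolP (Pi.single j 1) *ᵥ ((pdPotWt ω σ₁ j x - pdPotWt ω σ₂ j x) *ᵥ z +
        ((potW ω σ₁ x)ᵀ - (potW ω σ₂ x)ᵀ) *ᵥ z' j)) ⬝ᵥ y +
        (symbolP (Pi.single j 1) *ᵥ (((potW ω σ₁ x)ᵀ - (potW ω σ₂ x)ᵀ) *ᵥ z)) ⬝ᵥ y' j) := by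
  set W₁ := potW ω σ₁ x
  set W₂ := potW ω σ₂ x
  set h := (W₁ᵀ - W₂ᵀ) *ᵥ z with hh
  -- The conjugated adjoint equation is used pointwise: transposing `W₂` onto `y` replaces it by the
  -- derivatives `y'`, so that together with the derivatives of `h` a total derivative of a product
  -- appears.
  have e1 : (W₂ *ᵥ h) ⬝ᵥ y = -∑ j, Complex.I * ((symbolP (Pi.single j 1) *ᵥ h) ⬝ᵥ y' j) := by
    have a1 : ∀ (A : Matrix I8 I8 ℂ) (u v : I8 → ℂ), (A *ᵥ u) ⬝ᵥ v = u ⬝ᵥ (Aᵀ *ᵥ v) := by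
      intro A u v
      rw [Matrix.mulVec_transpose, dotProduct_comm u, ← Matrix.dotProduct_mulVec, dotProduct_comm]
    have a2 := congrArg (fun v => h ⬝ᵥ v) hy
    simp only [dotProduct_add, dotProduct_zero, dotProduct_sum, dotProduct_smul, smul_eq_mul] at a2
    rw [a1, eq_neg_iff_add_eq_zero, add_comm, ← a2]
    congr 1
    refine Finset.sum_congr rfl fun j _ => ?_
    rw [a1, symbolP_single_transpose]
  have e2 : (potQ ω σ₁ x - potQ ω σ₂ x) *ᵥ z = (W₁ - W₂) *ᵥ (∑ j, symbolP (Pi.single j 1) *ᵥ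
      (-Complex.I • z' j) - W₁ᵀ *ᵥ z) + ∑ j, Complex.I • (symbolP (Pi.single j 1) *ᵥ
      ((pdPotWt ω σ₁ j x - pdPotWt ω σ₂ j x) *ᵥ z + (W₁ᵀ - W₂ᵀ) *ᵥ z' j)) - W₂ *ᵥ h := by
    rw [h₁.potQ_eq hΩ hω hx, h₂.potQ_eq hΩ hω hx, hh, show potW ω σ₁ x = W₁ from rfl,
      show potW ω σ₂ x = W₂ from rfl]
    -- Commuting `W₁ - W₂` past the symbol turns the derivatives of `z` in `(W₁ - W₂) P z` into
    -- those of `P (W₁ - W₂)ᵗ z`; the two cancel.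
    have c : ∀ j, (W₁ - W₂) *ᵥ (symbolP (Pi.single j 1) *ᵥ (-Complex.I • z' j)) =
        -(Complex.I • (symbolP (Pi.single j 1) *ᵥ ((W₁ᵀ - W₂ᵀ) *ᵥ z' j))) := by
      intro j
      rw [Matrix.mulVec_mulVec, sub_mul, potW_mul_symbolP, potW_mul_symbolP, ← mul_sub,
        ← Matrix.mulVec_mulVec, Matrix.mulVec_smul, Matrix.mulVec_smul, neg_smul]
    rw [Matrix.mulVec_sub (W₁ - W₂), Matrix.mulVec_sum, Finset.sum_congr rfl fun j _ => c j]
    simp only [Matrix.mulVec_add, smul_add, Finset.sum_add_distrib, Matrix.sub_mulVec,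
      Matrix.mulVec_sub, Matrix.mulVec_mulVec, Matrix.neg_mulVec, Finset.sum_neg_distrib,
      Matrix.sum_mulVec, Matrix.mul_smul, Matrix.smul_mulVec, smul_sub, Finset.sum_sub_distrib,
      neg_smul, mul_neg, sub_mul]
    abel
  rw [e2, sub_dotProduct, add_dotProduct, e1, sum_dotProduct]
  simp only [smul_dotProduct, smul_eq_mul, mul_add, Finset.sum_add_distrib]
  ring

/-- The complex conjugate of the equation `(P + W*) Y = 0`. -/
theorem adjoint_eq_of_opPaddWstar_eq_zero {σ : E3 → ℝ} {Y : E3 → I8 → ℂ} {x : E3}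
    (hx : opPaddWstar Ω ω σ Y x = 0) :
    ∑ j, Complex.I • (symbolP (Pi.single j 1) *ᵥ fun m => star (weakPd Ω j (fun x => Y x m) x)) +
      (potW ω σ x)ᵀ *ᵥ (fun m => star (Y x m)) = 0 := by
  ext l
  have := congrArg star (congrFun hx l)
  simp only [opPaddWstar, opP, Pi.add_apply, Finset.sum_apply, Matrix.mulVec, dotProduct,
    star_add, star_sum, star_mul', star_symbolP_single, Matrix.conjTranspose_apply, Complex.conj_conj,
    Pi.zero_apply, star_zero, star_neg, Complex.star_def, Complex.conj_I, neg_neg] at this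
  simp only [Pi.add_apply, Finset.sum_apply, Pi.smul_apply, Matrix.mulVec, dotProduct,
    smul_eq_mul, Matrix.transpose_apply, Pi.zero_apply, Complex.star_def]
  rw [← this]
  congr 1
  refine Finset.sum_congr rfl fun j _ => ?_
  rw [Finset.mul_sum]
  refine Finset.sum_congr rfl fun m _ => ?_
  ring

/-- `(Q₁ - Q₂) Z` may be replaced by `(W₁ - W₂)(P - W₁ᵗ) Z` against solutions of the adjoint
equation. -/
theorem innerΩ_potQ_sub {K : Set E3} (hΩ : IsOpen Ω) (hK : IsCompact K) (hKΩ : K ⊆ Ω)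
    (h₁ : IsC2Bounded Ω M σ₁) (h₂ : IsC2Bounded Ω M σ₂) (hω : 1 ≤ ω)
    (he : ∀ x ∈ Ω \ K, σ₁ x = σ₂ x) {k : ℕ} (hk : 1 ≤ k) {Z Y : E3 → I8 → ℂ}
    (hZ : MemHVec Ω k Z) (hY : MemHVec Ω k Y)
    (hPY : ∀ᵐ x ∂(volume.restrict Ω), opPaddWstar Ω ω σ₂ Y x = 0) :
    innerΩ Ω (fun x => (potQ ω σ₁ x - potQ ω σ₂ x) *ᵥ Z x) Y =
      innerΩ Ω (fun x => (potW ω σ₁ x - potW ω σ₂ x) *ᵥ opPsubWt Ω ω σ₁ Z x) Y := by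
  have hU : IsOpen (Ω \ K) := hΩ.sdiff hK.isClosed
  have hA : ∀ l m, IsC1Bounded Ω fun x => (potW ω σ₁ x)ᵀ l m - (potW ω σ₂ x)ᵀ l m := fun l m =>
    (h₁.isC1Bounded_potW hΩ hω l m).sub hΩ (h₂.isC1Bounded_potW hΩ hω l m)
  have hA0 : ∀ l m, ∀ x ∈ Ω \ K, (potW ω σ₁ x)ᵀ l m - (potW ω σ₂ x)ᵀ l m = 0 := fun l m x hx => by
    rw [potW_congr hU he hx, sub_self]
  have hA0' : ∀ l m j, ∀ x ∈ Ω \ K,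
      pd j (fun x => (potW ω σ₁ x)ᵀ l m - (potW ω σ₂ x)ᵀ l m) x = 0 := fun l m j x hx => by
    rw [pd_congr hU (v := fun _ => 0) (fun y hy => hA0 l m y hy) j hx, pd_const]
  have hz := fun m j => (hZ m).hasL2Deriv hΩ hk j
  have hy := fun m j => ((hY m).hasL2Deriv hΩ hk j).conj
  set h : I8 → E3 → ℂ := fun l x =>
    ∑ m, ((potW ω σ₁ x)ᵀ l m - (potW ω σ₂ x)ᵀ l m) * Z x m with hh
  set h' : Fin 3 → I8 → E3 → ℂ := fun j l x =>
    ∑ m, (pd j (fun x => (potW ω σ₁ x)ᵀ l m - (potW ω σ₂ x)ᵀ l m) x * Z x m +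
      ((potW ω σ₁ x)ᵀ l m - (potW ω σ₂ x)ᵀ l m) * weakPd Ω j (fun x => Z x m) x) with hh'
  have hd : ∀ l j, HasL2Deriv Ω j (h l) (h' j l) := fun l j =>
    HasL2Deriv.sum _ fun m => (hz m j).mul_left hΩ (hA l m)
  have h0 : ∀ l, ∀ x ∈ Ω \ K, h l x = 0 := fun l x hx => Finset.sum_eq_zero fun m _ => by
    rw [hA0 l m x hx, zero_mul]
  have h0' : ∀ l j, ∀ x ∈ Ω \ K, h' j l x = 0 := fun l j x hx => by
    simp only [hh', hA0' l _ j x hx, hA0 l _ x hx]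
    simp
  have ibp := fun j k l => (hy k j).integral_mul_eq_neg hΩ hK hKΩ (hd l) (h0 l) (h0' l)
  rw [innerΩ, innerΩ]
  -- The two integrands differ by a combination of the total derivatives `∂ⱼ(Ȳₖ hₗ)`. Each
  -- integrates to zero since `h = (W₁ - W₂)ᵗ Z` vanishes off `K`, so no boundary term arises.
  refine integral_eq_of_ae_eq_add_sum (s := Finset.univ)
    (G := fun (i : Fin 3 × I8 × I8) x => star (Y x i.2.1) * h' i.1 i.2.2 x +
      star (weakPd Ω i.1 (fun x => Y x i.2.1) x) * h i.2.2 x)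
    (fun i => (integrable_mul_of_memLp_two (hy _ 0).memLp (hd _ _).memLp_deriv).add
      (integrable_mul_of_memLp_two (hy _ _).memLp_deriv (hd _ 0).memLp))
    (fun i => ?_)
    (fun i => Complex.I * symbolP (Pi.single i.1 1) i.2.1 i.2.2) ?_
  · rw [integral_add (integrable_mul_of_memLp_two (hy _ 0).memLp (hd _ _).memLp_deriv)
      (integrable_mul_of_memLp_two (hy _ _).memLp_deriv (hd _ 0).memLp), ibp, neg_add_cancel]
  · filter_upwards [hPY, ae_restrict_mem hΩ.measurableSet] with x hx hxΩ
    have hst := adjoint_eq_of_opPaddWstar_eq_zero hx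
    have key := dotProduct_potQ_sub hΩ h₁ h₂ hω hxΩ (Z x) (fun j m => weakPd Ω j (fun x => Z x m) x)
      (fun m => star (Y x m)) _ hst
    have e1 : ∀ l, h l x = (((potW ω σ₁ x)ᵀ - (potW ω σ₂ x)ᵀ) *ᵥ Z x) l := fun l => rfl
    have e2 : ∀ j l, h' j l x = ((pdPotWt ω σ₁ j x - pdPotWt ω σ₂ j x) *ᵥ Z x +
        ((potW ω σ₁ x)ᵀ - (potW ω σ₂ x)ᵀ) *ᵥ fun m => weakPd Ω j (fun x => Z x m) x) l := by
      intro j l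
      simp only [hh', Finset.sum_add_distrib, pdPotWt_sub hΩ h₁ h₂ hω j hxΩ]
      rfl
    refine key.trans ?_
    congr 1
    rw [Fintype.sum_prod_type]
    refine Finset.sum_congr rfl fun j _ => ?_
    rw [Fintype.sum_prod_type]
    simp only [e1, e2]
    generalize (pdPotWt ω σ₁ j x - pdPotWt ω σ₂ j x) *ᵥ Z x + _ = a
    generalize ((potW ω σ₁ x)ᵀ - (potW ω σ₂ x)ᵀ) *ᵥ Z x = b
    simp only [Matrix.mulVec, dotProduct, mul_add, Finset.mul_sum, Finset.sum_mul,
      Finset.sum_add_distrib]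
    congr 1
    · refine Finset.sum_congr rfl fun k _ => Finset.sum_congr rfl fun l _ => ?_
      ring
    · refine Finset.sum_congr rfl fun k _ => Finset.sum_congr rfl fun l _ => ?_
      ring

end

/-! ### Weak curls -/

/-- The curl of a vector field with first derivatives `∂ⱼ uₖ = d j k`. -/
noncomputable def curlOf (d : Fin 3 → Fin 3 → ℂ) (i : Fin 3) : ℂ :=
  ∑ j, ∑ k, crossMat (Pi.single j 1) i k * d j k

theorem curlOf_apply (d : Fin 3 → Fin 3 → ℂ) :
    curlOf d = ![d 1 2 - d 2 1, d 2 0 - d 0 2, d 0 1 - d 1 0] := by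
  ext i
  fin_cases i <;> simp [curlOf, crossMat, Fin.sum_univ_three] <;> ring

theorem star_curlOf (d : Fin 3 → Fin 3 → ℂ) (i : Fin 3) :
    star (curlOf d i) = curlOf (fun j k => star (d j k)) i := by
  rw [curlOf_apply, curlOf_apply]
  fin_cases i <;> simp

/-- `c ∈ L²(Ω)` is the weak curl of `v ∈ L²(Ω)`, tested against one component at a time. -/
structure HasL2Curl (Ω : Set E3) (v c : E3 → Fin 3 → ℂ) : Prop where
  memLp : ∀ i, MemLp (fun x => v x i) 2 (volume.restrict Ω)
  memLp_curl : ∀ i, MemLp (fun x => c x i) 2 (volume.restrict Ω)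
  integral_eq : ∀ (k : Fin 3) (φ : E3 → ℝ), IsTestFun Ω φ →
    ∑ i, ∑ j, crossMat (Pi.single j 1) i k * ∫ x in Ω, v x i * ((pd j φ x : ℝ) : ℂ) =
      ∫ x in Ω, c x k * (φ x : ℂ)

theorem locallyIntegrableOn_of_memLp_apply {Ω : Set E3} {v : E3 → Fin 3 → ℂ}
    (h : ∀ i, MemLp (fun x => v x i) 2 (volume.restrict Ω)) : LocallyIntegrableOn v Ω :=
  locallyIntegrableOn_of_locallyIntegrable_restrict
    ((MemLp.of_eval h).locallyIntegrable (by norm_num))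

theorem IsTestFun.apply {Ω : Set E3} {φ : E3 → Fin 3 → ℝ} (h : IsTestFun Ω φ) (i : Fin 3) :
    IsTestFun Ω fun x => φ x i :=
  h.clm_comp (ContinuousLinearMap.proj (R := ℝ) (φ := fun _ : Fin 3 => ℝ) i)

theorem IsTestFun.single {Ω : Set E3} {φ : E3 → ℝ} (h : IsTestFun Ω φ) (k : Fin 3) :
    IsTestFun Ω fun x => (Pi.single k (φ x) : Fin 3 → ℝ) :=
  h.clm_comp (ContinuousLinearMap.single ℝ (fun _ : Fin 3 => ℝ) k)

theorem ofReal_curl (φ : E3 → Fin 3 → ℝ) (x : E3) (i : Fin 3) :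
    ((curl φ x i : ℝ) : ℂ) = curlOf (fun j k => ((pd j (fun y => φ y k) x : ℝ) : ℂ)) i := by
  rw [curlOf_apply, curl]
  fin_cases i <;> simp

theorem HasL2Curl.hasWeakCurl {Ω : Set E3} {v c : E3 → Fin 3 → ℂ} (h : HasL2Curl Ω v c) :
    HasWeakCurl Ω v c := by
  refine ⟨locallyIntegrableOn_of_memLp_apply h.memLp,
    locallyIntegrableOn_of_memLp_apply h.memLp_curl, fun φ hφ => ?_⟩
  have hp : ∀ j k, MemLp (fun x => ((pd j (fun y => φ y k) x : ℝ) : ℂ)) 2 (volume.restrict Ω) :=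
    fun j k => ((hφ.apply k).pd j).ofReal.memLp _ _
  have i1 : ∀ i j k, Integrable (fun x => v x i * ((pd j (fun y => φ y k) x : ℝ) : ℂ))
    (volume.restrict Ω) := fun i j k => integrable_mul_of_memLp_two (h.memLp i) (hp j k)
  have i2 : ∀ i, Integrable (fun x => c x i * (φ x i : ℂ)) (volume.restrict Ω) := fun i =>
    integrable_mul_of_memLp_two (h.memLp_curl i) ((hφ.apply i).ofReal.memLp _ _)
  simp only [ofReal_curl, curlOf, Finset.mul_sum]
  simp only [mul_left_comm (v _ _)]
  rw [integral_finsetSum _ fun i _ => i2 i, integral_finsetSum _ fun i _ =>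
    integrable_finsetSum _ fun j _ => integrable_finsetSum _ fun k _ => (i1 i j k).const_mul _]
  simp_rw [← h.integral_eq _ _ (hφ.apply _)]
  rw [Finset.sum_comm (s := Finset.univ (α := Fin 3))]
  refine Finset.sum_congr rfl fun i _ => ?_
  rw [integral_finsetSum _ fun j _ => integrable_finsetSum _ fun k _ => (i1 i j k).const_mul _,
    Finset.sum_comm (s := Finset.univ (α := Fin 3))]
  refine Finset.sum_congr rfl fun j _ => ?_
  rw [integral_finsetSum _ fun k _ => (i1 i j k).const_mul _]
  simp_rw [integral_const_mul]

theorem HasWeakCurl.integral_eq_single {Ω : Set E3} {v c : E3 → Fin 3 → ℂ}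
    (h : HasWeakCurl Ω v c) {φ : E3 → ℝ} (hφ : IsTestFun Ω φ) (k : Fin 3) :
    ∫ x in Ω, ∑ i, v x i * ∑ j, crossMat (Pi.single j 1) i k * ((pd j φ x : ℝ) : ℂ) =
      ∫ x in Ω, c x k * (φ x : ℂ) := by
  have := h.2.2 _ (hφ.single k)
  simp only [ofReal_curl, curlOf] at this
  have e : ∀ j l x, pd j (fun y => (Pi.single k (φ y) : Fin 3 → ℝ) l) x =
      (Pi.single k (pd j φ x) : Fin 3 → ℝ) l := by
    intro j l x
    by_cases hl : l = k
    · subst hl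
      simp
    · simp [hl, pd]
  simp only [e] at this
  convert this using 3 with x x
  · refine Finset.sum_congr rfl fun i _ => ?_
    congr 1
    refine Finset.sum_congr rfl fun j _ => ?_
    rw [Finset.sum_eq_single k]
    · simp
    · intro b _ hb
      simp [hb]
    · simp
  · rw [Finset.sum_eq_single k]
    · simp
    · intro b _ hb
      simp [hb]
    · simp

theorem HasWeakCurl.hasL2Curl {Ω : Set E3} {v c : E3 → Fin 3 → ℂ} (h : HasWeakCurl Ω v c)
    (hv : ∀ i, MemLp (fun x => v x i) 2 (volume.restrict Ω))
    (hc : ∀ i, MemLp (fun x => c x i) 2 (volume.restrict Ω)) : HasL2Curl Ω v c := by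
  refine ⟨hv, hc, fun k φ hφ => ?_⟩
  have i1 : ∀ i j, Integrable (fun x => v x i * ((pd j φ x : ℝ) : ℂ)) (volume.restrict Ω) :=
    fun i j => integrable_mul_of_memLp_two (hv i) ((hφ.pd j).ofReal.memLp _ _)
  rw [← h.integral_eq_single hφ k]
  simp only [Finset.mul_sum, mul_left_comm (v _ _)]
  rw [integral_finsetSum _ fun i _ => integrable_finsetSum _ fun j _ => (i1 i j).const_mul _]
  refine Finset.sum_congr rfl fun i _ => ?_
  rw [integral_finsetSum _ fun j _ => (i1 i j).const_mul _]
  simp_rw [integral_const_mul]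

theorem locallyIntegrableOn_apply {Ω : Set E3} {c : E3 → Fin 3 → ℂ}
    (h : LocallyIntegrableOn c Ω) (i : Fin 3) : LocallyIntegrableOn (fun x => c x i) Ω := by
  intro x hx
  obtain ⟨s, hs, hi⟩ := h x hx
  exact ⟨s, hs, Integrable.eval hi i⟩

theorem HasWeakCurl.ae_eq {Ω : Set E3} (hΩ : IsOpen Ω) {v c c' : E3 → Fin 3 → ℂ}
    (h : HasWeakCurl Ω v c) (h' : HasWeakCurl Ω v c') : c =ᵐ[volume.restrict Ω] c' := by
  have key : ∀ k, (fun x => c x k) =ᵐ[volume.restrict Ω] fun x => c' x k := fun k =>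
    ae_eq_of_integral_testFun_eq hΩ (locallyIntegrableOn_apply h.2.1 k)
      (locallyIntegrableOn_apply h'.2.1 k) fun φ hφ =>
        (h.integral_eq_single hφ k).symm.trans (h'.integral_eq_single hφ k)
  filter_upwards [ae_all_iff.2 key] with x hx
  ext k
  exact hx k

theorem HasL2Curl.weakCurl_ae_eq {Ω : Set E3} (hΩ : IsOpen Ω) {v c : E3 → Fin 3 → ℂ}
    (h : HasL2Curl Ω v c) : weakCurl Ω v =ᵐ[volume.restrict Ω] c := by
  have hex : ∃ c, HasWeakCurl Ω v c := ⟨c, h.hasWeakCurl⟩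
  rw [weakCurl, dif_pos hex]
  exact hex.choose_spec.ae_eq hΩ h.hasWeakCurl

theorem HasL2Curl.congr {Ω : Set E3} {v c v' c' : E3 → Fin 3 → ℂ} (h : HasL2Curl Ω v c)
    (hv : v =ᵐ[volume.restrict Ω] v') (hc : c =ᵐ[volume.restrict Ω] c') :
    HasL2Curl Ω v' c' := by
  have hv' : ∀ i, (fun x => v x i) =ᵐ[volume.restrict Ω] fun x => v' x i := fun i => by
    filter_upwards [hv] with x hx
    rw [hx]
  have hc' : ∀ i, (fun x => c x i) =ᵐ[volume.restrict Ω] fun x => c' x i := fun i => by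
    filter_upwards [hc] with x hx
    rw [hx]
  refine ⟨fun i => (h.memLp i).ae_eq (hv' i), fun i => (h.memLp_curl i).ae_eq (hc' i),
    fun k φ hφ => ?_⟩
  have e1 : ∀ i j, ∫ x in Ω, v' x i * ((pd j φ x : ℝ) : ℂ) =
      ∫ x in Ω, v x i * ((pd j φ x : ℝ) : ℂ) := fun i j => integral_congr_ae (by
    filter_upwards [hv' i] with x hx
    rw [hx])
  have e2 : ∫ x in Ω, c' x k * (φ x : ℂ) = ∫ x in Ω, c x k * (φ x : ℂ) := integral_congr_ae (by
    filter_upwards [hc' k] with x hx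
    rw [hx])
  simp_rw [e1, e2]
  exact h.integral_eq k φ hφ

theorem MemHcurl.hasL2Curl {Ω : Set E3} (hΩ : IsOpen Ω) {v : E3 → Fin 3 → ℂ}
    (h : MemHcurl Ω v) : HasL2Curl Ω v (weakCurl Ω v) := by
  obtain ⟨hv, c, hc, hcL⟩ := h
  have h1 := hc.hasL2Curl hv hcL
  exact h1.congr (ae_eq_refl v) (h1.weakCurl_ae_eq hΩ).symm

theorem HasL2Curl.memHcurl {Ω : Set E3} {v c : E3 → Fin 3 → ℂ} (h : HasL2Curl Ω v c) :
    MemHcurl Ω v := ⟨h.memLp, c, h.hasWeakCurl, h.memLp_curl⟩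

theorem HasL2Curl.sub {Ω : Set E3} {v c v' c' : E3 → Fin 3 → ℂ} (h : HasL2Curl Ω v c)
    (h' : HasL2Curl Ω v' c') : HasL2Curl Ω (fun x => v x - v' x) (fun x => c x - c' x) := by
  refine ⟨fun i => (h.memLp i).sub (h'.memLp i), fun i => (h.memLp_curl i).sub (h'.memLp_curl i),
    fun k φ hφ => ?_⟩
  have i1 : ∀ {u : E3 → ℂ}, MemLp u 2 (volume.restrict Ω) → ∀ j,
      Integrable (fun x => u x * ((pd j φ x : ℝ) : ℂ)) (volume.restrict Ω) :=
    fun hu j => integrable_mul_of_memLp_two hu ((hφ.pd j).ofReal.memLp _ _)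
  have i2 : ∀ {u : E3 → ℂ}, MemLp u 2 (volume.restrict Ω) →
      Integrable (fun x => u x * (φ x : ℂ)) (volume.restrict Ω) :=
    fun hu => integrable_mul_of_memLp_two hu (hφ.ofReal.memLp _ _)
  simp only [Pi.sub_apply, sub_mul]
  rw [integral_sub (i2 (h.memLp_curl k)) (i2 (h'.memLp_curl k)), ← h.integral_eq k φ hφ,
    ← h'.integral_eq k φ hφ]
  simp_rw [integral_sub (i1 (h.memLp _) _) (i1 (h'.memLp _) _), mul_sub, Finset.sum_sub_distrib]

theorem hasL2Curl_of_hasL2Deriv {Ω : Set E3} {u : E3 → Fin 3 → ℂ}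
    {d : Fin 3 → Fin 3 → E3 → ℂ} (h : ∀ j k, HasL2Deriv Ω j (fun x => u x k) (d j k)) :
    HasL2Curl Ω u fun x => curlOf fun j k => d j k x := by
  have hc : ∀ i, MemLp (fun x => curlOf (fun j k => d j k x) i) 2 (volume.restrict Ω) := fun i =>
    memLp_finsetSum _ fun j _ => memLp_finsetSum _ fun k _ => (h j k).memLp_deriv.const_mul _
  refine ⟨fun i => (h 0 i).memLp, hc, fun k φ hφ => ?_⟩
  have i2 : ∀ j i, Integrable (fun x => d j i x * (φ x : ℂ)) (volume.restrict Ω) := fun j i =>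
    integrable_mul_of_memLp_two (h j i).memLp_deriv (hφ.ofReal.memLp _ _)
  simp only [curlOf, Finset.sum_mul, mul_assoc]
  rw [integral_finsetSum _ fun j _ => integrable_finsetSum _ fun i _ => (i2 j i).const_mul _,
    Finset.sum_comm]
  refine Finset.sum_congr rfl fun j _ => ?_
  rw [integral_finsetSum _ fun i _ => (i2 j i).const_mul _]
  refine Finset.sum_congr rfl fun i _ => ?_
  rw [integral_const_mul, (h j i).integral_eq φ hφ]
  have : crossMat (Pi.single j 1) i k = -crossMat (Pi.single j 1) k i := by
    fin_cases j <;> fin_cases i <;> fin_cases k <;> simp [crossMat]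
  rw [this]
  ring

theorem sum_crossMat_mul_symm {c : Fin 3 → Fin 3 → ℂ} (hc : ∀ i j, c i j = c j i) (k : Fin 3) :
    ∑ i, ∑ j, crossMat (Pi.single j 1) i k * c i j = 0 := by
  have h01 := hc 1 0
  have h02 := hc 2 0
  have h12 := hc 2 1
  fin_cases k <;> simp [crossMat, Fin.sum_univ_three, h01, h02, h12]

theorem IsTestFun.pd_comm {Ω : Set E3} {F : Type*} [NormedAddCommGroup F] [NormedSpace ℝ F]
    {φ : E3 → F} (h : IsTestFun Ω φ) (i j : Fin 3) :
    Maxwell.pd i (Maxwell.pd j φ) = Maxwell.pd j (Maxwell.pd i φ) := by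
  ext x
  exact Maxwell.pd_comm ((h.1.of_le (WithTop.coe_le_coe.2 le_top)).contDiffAt) i j

/-- The curl of a gradient vanishes. -/
theorem hasL2Curl_grad {Ω : Set E3} {f : E3 → ℂ} {f' : Fin 3 → E3 → ℂ}
    (h : ∀ j, HasL2Deriv Ω j f (f' j)) : HasL2Curl Ω (fun x j => f' j x) 0 := by
  refine ⟨fun i => (h i).memLp_deriv, fun i => MemLp.zero', fun k φ hφ => ?_⟩
  rw [sum_crossMat_mul_symm (c := fun i j => ∫ x in Ω, f' i x * ((pd j φ x : ℝ) : ℂ))]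
  · simp
  · intro i j
    have h1 := (h i).integral_eq _ (hφ.pd j)
    have h2 := (h j).integral_eq _ (hφ.pd i)
    rw [hφ.pd_comm] at h1
    rw [h1] at h2
    exact neg_injective h2

theorem integral_mul_eq_re_add_im {Ω : Set E3} {F : E3 → ℂ} (hF : MemLp F 2 (volume.restrict Ω))
    {ψ : E3 → ℂ} (hψ : IsTestFun Ω ψ) :
    ∫ x in Ω, F x * ψ x = (∫ x in Ω, F x * ((Complex.reCLM (ψ x) : ℝ) : ℂ)) +
      Complex.I * ∫ x in Ω, F x * ((Complex.imCLM (ψ x) : ℝ) : ℂ) := by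
  have hr := integrable_mul_of_memLp_two hF ((hψ.clm_comp Complex.reCLM).ofReal.memLp 2 Ω)
  have hi := integrable_mul_of_memLp_two hF ((hψ.clm_comp Complex.imCLM).ofReal.memLp 2 Ω)
  rw [← integral_const_mul, ← integral_add hr (hi.const_mul _)]
  refine integral_congr_ae (Eventually.of_forall fun x => ?_)
  have := Complex.re_add_im (ψ x)
  simp only [Complex.reCLM_apply, Complex.imCLM_apply]
  linear_combination -F x * this

theorem HasL2Curl.integral_eq_complex {Ω : Set E3} {v c : E3 → Fin 3 → ℂ} (h : HasL2Curl Ω v c)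
    {ψ : E3 → ℂ} (hψ : IsTestFun Ω ψ) (k : Fin 3) :
    ∑ i, ∑ j, crossMat (Pi.single j 1) i k * ∫ x in Ω, v x i * pd j ψ x =
      ∫ x in Ω, c x k * ψ x := by
  rw [integral_mul_eq_re_add_im (h.memLp_curl k) hψ,
    ← h.integral_eq k _ (hψ.clm_comp Complex.reCLM),
    ← h.integral_eq k _ (hψ.clm_comp Complex.imCLM)]
  simp_rw [Finset.mul_sum, ← Finset.sum_add_distrib]
  refine Finset.sum_congr rfl fun i _ => Finset.sum_congr rfl fun j _ => ?_
  rw [integral_mul_eq_re_add_im (h.memLp i) (hψ.pd j)]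
  simp_rw [fun x => pd_clm_comp Complex.reCLM j (hψ.differentiable x),
    fun x => pd_clm_comp Complex.imCLM j (hψ.differentiable x)]
  ring

section

variable {Ω K : Set E3} {v c : E3 → Fin 3 → ℂ}

/-- Both sides are continuous under weak `L²` convergence of `h` and its derivatives, so the
identity passes from test functions to compactly supported `h`. -/
theorem HasL2Curl.sum_integral_eq (hΩ : IsOpen Ω) (hK : IsCompact K) (hKΩ : K ⊆ Ω)
    (hv : HasL2Curl Ω v c) {h : E3 → ℂ} {h' : Fin 3 → E3 → ℂ} (hd : ∀ j, HasL2Deriv Ω j h (h' j))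
    (h0 : ∀ x ∈ Ω \ K, h x = 0) (h0' : ∀ j, ∀ x ∈ Ω \ K, h' j x = 0) (k : Fin 3) :
    ∑ i, ∑ j, crossMat (Pi.single j 1) i k * ∫ x in Ω, v x i * h' j x =
      ∫ x in Ω, c x k * h x := by
  obtain ⟨φ, hφ, hl, hl'⟩ := exists_isTestFun_tendsto hΩ hK hKΩ hd h0 h0'
  refine tendsto_nhds_unique (f := fun n => ∑ i, ∑ j, crossMat (Pi.single j 1) i k *
    ∫ x in Ω, v x i * pd j (φ n) x) (l := atTop) ?_ ?_
  · exact tendsto_finsetSum _ fun i _ => tendsto_finsetSum _ fun j _ =>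
      (hl' j _ (hv.memLp i)).const_mul _
  · simp_rw [fun n => hv.integral_eq_complex (hφ n) k]
    exact hl _ (hv.memLp_curl k)

/-- Integration by parts of the curl against a compactly supported vector field. -/
theorem HasL2Curl.integral_dot_curlOf (hΩ : IsOpen Ω) (hK : IsCompact K) (hKΩ : K ⊆ Ω)
    (hv : HasL2Curl Ω v c) {h : Fin 3 → E3 → ℂ} {h' : Fin 3 → Fin 3 → E3 → ℂ}
    (hd : ∀ j k, HasL2Deriv Ω j (h k) (h' j k)) (h0 : ∀ k, ∀ x ∈ Ω \ K, h k x = 0)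
    (h0' : ∀ j k, ∀ x ∈ Ω \ K, h' j k x = 0) :
    ∫ x in Ω, ∑ i, v x i * curlOf (fun j k => h' j k x) i = ∫ x in Ω, ∑ k, c x k * h k x := by
  have i1 : ∀ i j k, Integrable (fun x => v x i * h' j k x) (volume.restrict Ω) := fun i j k =>
    integrable_mul_of_memLp_two (hv.memLp i) (hd j k).memLp_deriv
  rw [integral_finsetSum _ fun k _ =>
    integrable_mul_of_memLp_two (hv.memLp_curl k) (hd 0 k).memLp]
  simp_rw [← fun k => hv.sum_integral_eq hΩ hK hKΩ (fun j => hd j k) (h0 k) (fun j => h0' j k) k]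
  simp only [curlOf, Finset.mul_sum, mul_left_comm (v _ _)]
  rw [integral_finsetSum _ fun i _ => integrable_finsetSum _ fun j _ =>
    integrable_finsetSum _ fun k _ => (i1 i j k).const_mul _, Finset.sum_comm]
  rw [Finset.sum_comm (s := Finset.univ (α := Fin 3))]
  rw [Finset.sum_comm (s := Finset.univ (α := Fin 3))]
  refine Finset.sum_congr rfl fun i _ => ?_
  rw [integral_finsetSum _ fun j _ => integrable_finsetSum _ fun k _ => (i1 i j k).const_mul _,
    Finset.sum_comm]
  refine Finset.sum_congr rfl fun j _ => ?_
  rw [integral_finsetSum _ fun k _ => (i1 i j k).const_mul _]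
  simp_rw [integral_const_mul]

/-- Curls are divergence free. -/
theorem HasL2Curl.integral_curl_dot_grad (hΩ : IsOpen Ω) (hK : IsCompact K) (hKΩ : K ⊆ Ω)
    (hv : HasL2Curl Ω v c) {h : E3 → ℂ} {h' : Fin 3 → E3 → ℂ} (hd : ∀ j, HasL2Deriv Ω j h (h' j))
    (h0 : ∀ x ∈ Ω \ K, h x = 0) (h0' : ∀ j, ∀ x ∈ Ω \ K, h' j x = 0) :
    ∫ x in Ω, ∑ k, c x k * h' k x = 0 := by
  obtain ⟨φ, hφ, hl, hl'⟩ := exists_isTestFun_tendsto hΩ hK hKΩ hd h0 h0'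
  rw [integral_finsetSum _ fun k _ =>
    integrable_mul_of_memLp_two (hv.memLp_curl k) (hd k).memLp_deriv]
  refine tendsto_nhds_unique (f := fun n => ∑ k, ∫ x in Ω, c x k * pd k (φ n) x) (l := atTop)
    (tendsto_finsetSum _ fun k _ => hl' k _ (hv.memLp_curl k)) ?_
  refine tendsto_const_nhds.congr fun n => ?_
  simp_rw [← fun k => hv.integral_eq_complex ((hφ n).pd k) k]
  rw [Finset.sum_comm]
  symm
  refine Finset.sum_eq_zero fun i _ => ?_
  have hs : ∀ j k, ∫ x in Ω, v x i * pd j (pd k (φ n)) x =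
      ∫ x in Ω, v x i * pd k (pd j (φ n)) x := fun j k => by rw [(hφ n).pd_comm]
  have h01 := hs 1 0
  have h02 := hs 2 0
  have h12 := hs 2 1
  fin_cases i <;> simp only [Fin.sum_univ_three, h01, h02, h12] <;> simp [crossMat]

end

/-! ### Norms of tangential traces -/

theorem enorm_integral_mul_le {X : Type*} [MeasurableSpace X] {μ : Measure X} {f g : X → ℂ}
    (hf : MemLp f 2 μ) (hg : MemLp g 2 μ) :
    ‖∫ x, f x * g x ∂μ‖ₑ ≤ eLpNorm f 2 μ * eLpNorm g 2 μ := by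
  refine (enorm_integral_le_lintegral_enorm _).trans ?_
  have h := eLpNorm_smul_le_mul_eLpNorm (p := 2) (q := 2) (r := 1) hg.1 hf.1
  rw [eLpNorm_one_eq_lintegral_enorm] at h
  exact h

theorem sq_rpow_half (a : ℝ≥0∞) : (a ^ 2) ^ (1 / 2 : ℝ) = a := by
  rw [← ENNReal.rpow_natCast, ← ENNReal.rpow_mul]
  norm_num

theorem eLpNorm_le_normL2 {Ω : Set E3} (v : E3 → Fin 3 → ℂ) (i : Fin 3) :
    eLpNorm (fun x => v x i) 2 (volume.restrict Ω) ≤ normL2 Ω v := by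
  rw [← sq_rpow_half (eLpNorm _ _ _)]
  exact ENNReal.rpow_le_rpow (Finset.single_le_sum
    (f := fun i => eLpNorm (fun x => v x i) 2 (volume.restrict Ω) ^ 2) (fun _ _ => by positivity)
    (Finset.mem_univ i)) (by norm_num)

theorem normL2_le {Ω : Set E3} {v : E3 → Fin 3 → ℂ} {B : ℝ≥0∞}
    (h : ∀ i, eLpNorm (fun x => v x i) 2 (volume.restrict Ω) ≤ B) : normL2 Ω v ≤ 3 * B := by
  rw [← sq_rpow_half (3 * B)]
  refine ENNReal.rpow_le_rpow ?_ (by norm_num)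
  calc _ ≤ ∑ _i : Fin 3, B ^ 2 := Finset.sum_le_sum fun i _ => by gcongr; exact h i
    _ = 3 * B ^ 2 := by simp
    _ ≤ 9 * B ^ 2 := by gcongr; norm_num
    _ = (3 * B) ^ 2 := by rw [mul_pow]; norm_num

theorem normL2_congr {Ω : Set E3} {v v' : E3 → Fin 3 → ℂ} (h : v =ᵐ[volume.restrict Ω] v') :
    normL2 Ω v = normL2 Ω v' := by
  have : ∀ i, eLpNorm (fun x => v x i) 2 (volume.restrict Ω) =
      eLpNorm (fun x => v' x i) 2 (volume.restrict Ω) := fun i => eLpNorm_congr_ae (by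
    filter_upwards [h] with x hx
    rw [hx])
  simp_rw [normL2, this]

theorem HasL2Curl.normHcurl_eq {Ω : Set E3} (hΩ : IsOpen Ω) {v c : E3 → Fin 3 → ℂ}
    (h : HasL2Curl Ω v c) : normHcurl Ω v = normL2 Ω v + normL2 Ω c := by
  rw [normHcurl, normL2_congr (h.weakCurl_ae_eq hΩ)]

theorem enorm_integral_sum_mul_star_le {Ω : Set E3} {u w : E3 → Fin 3 → ℂ}
    (hu : ∀ i, MemLp (fun x => u x i) 2 (volume.restrict Ω))
    (hw : ∀ i, MemLp (fun x => w x i) 2 (volume.restrict Ω)) :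
    ‖∫ x in Ω, ∑ i, u x i * star (w x i)‖ₑ ≤ 3 * (normL2 Ω u * normL2 Ω w) := by
  rw [integral_finsetSum (f := fun i x => u x i * star (w x i)) _ fun i _ =>
    integrable_mul_of_memLp_two (hu i) (hw i).star]
  refine (enorm_sum_le _ _).trans ?_
  calc _ ≤ ∑ _i : Fin 3, normL2 Ω u * normL2 Ω w := Finset.sum_le_sum fun i _ => by
        refine (enorm_integral_mul_le (hu i) (hw i).star).trans ?_
        refine mul_le_mul' (eLpNorm_le_normL2 u i) ?_
        rw [eLpNorm_star]
        exact eLpNorm_le_normL2 w i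
    _ = _ := by simp

section

variable {Ω : Set E3} {v c v' c' w cw : E3 → Fin 3 → ℂ}

theorem HasL2Curl.tangTrace_apply (hΩ : IsOpen Ω) (hv : HasL2Curl Ω v c) (hw : MemHVec Ω 1 w)
    (hcw : HasL2Curl Ω w cw) : tangTrace Ω v ⟨w, hw⟩ =
      (∫ x in Ω, ∑ i, c x i * star (w x i)) - ∫ x in Ω, ∑ i, v x i * star (cw x i) := by
  rw [tangTrace]
  congr 1
  · refine integral_congr_ae ?_
    filter_upwards [hv.weakCurl_ae_eq hΩ] with x hx
    rw [hx]
  · refine integral_congr_ae ?_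
    filter_upwards [hcw.weakCurl_ae_eq hΩ] with x hx
    rw [hx]

theorem integrable_sum_mul_star {u w : E3 → Fin 3 → ℂ}
    (hu : ∀ i, MemLp (fun x => u x i) 2 (volume.restrict Ω))
    (hw : ∀ i, MemLp (fun x => w x i) 2 (volume.restrict Ω)) :
    Integrable (fun x => ∑ i, u x i * star (w x i)) (volume.restrict Ω) :=
  integrable_finsetSum _ fun i _ => integrable_mul_of_memLp_two (hu i) (hw i).star

theorem hasL2Curl_of_memHVec (hΩ : IsOpen Ω) (hw : MemHVec Ω 1 w) :
    HasL2Curl Ω w fun x => curlOf fun j k => weakPd Ω j (fun y => w y k) x :=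
  hasL2Curl_of_hasL2Deriv fun j k => (hw k).hasL2Deriv hΩ le_rfl j

theorem HasL2Curl.tangTrace_sub (hΩ : IsOpen Ω) (hv : HasL2Curl Ω v c)
    (hv' : HasL2Curl Ω v' c') :
    tangTrace Ω v - tangTrace Ω v' = tangTrace Ω fun x => v x - v' x := by
  ext ⟨w, hw⟩
  have hcw := hasL2Curl_of_memHVec hΩ hw
  rw [Pi.sub_apply, hv.tangTrace_apply hΩ hw hcw, hv'.tangTrace_apply hΩ hw hcw,
    (hv.sub hv').tangTrace_apply hΩ hw hcw]
  simp only [Pi.sub_apply, sub_mul, Finset.sum_sub_distrib]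
  rw [integral_sub (integrable_sum_mul_star hv.memLp_curl hcw.memLp)
      (integrable_sum_mul_star hv'.memLp_curl hcw.memLp),
    integral_sub (integrable_sum_mul_star hv.memLp hcw.memLp_curl)
      (integrable_sum_mul_star hv'.memLp hcw.memLp_curl)]
  ring

/-- Cauchy–Schwarz in each of the three components for each of the two integrals defining the trace;
hence the factor `6`. -/
theorem enorm_tangTrace_le (hΩ : IsOpen Ω) (hv : MemHcurl Ω v) (hw : MemHVec Ω 1 w) :
    ‖tangTrace Ω v ⟨w, hw⟩‖ₑ ≤ 6 * normHcurl Ω v * normHcurl Ω w := by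
  have h1 := hv.hasL2Curl hΩ
  have h2 := hasL2Curl_of_memHVec hΩ hw
  rw [h1.tangTrace_apply hΩ hw h2, h2.normHcurl_eq hΩ, normHcurl]
  refine (enorm_sub_le).trans ?_
  refine (add_le_add (enorm_integral_sum_mul_star_le h1.memLp_curl h2.memLp)
    (enorm_integral_sum_mul_star_le h1.memLp h2.memLp_curl)).trans ?_
  have e : ∀ a b c d : ℝ≥0∞, 3 * (b * c) + 3 * (a * d) ≤ 6 * (a + b) * (c + d) := by
    intro a b c d
    calc 3 * (b * c) + 3 * (a * d) ≤ 3 * ((a + b) * (c + d)) + 3 * ((a + b) * (c + d)) := by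
          gcongr <;> simp
      _ = 6 * (a + b) * (c + d) := by ring
  exact e _ _ _ _

/-- The left side depends on `v` only through its trace, so the bound may be applied to every field
with the same trace and the infimum taken. -/
theorem enorm_le_normTH (hΩ : IsOpen Ω) (hv : MemHcurl Ω v) (hw : MemHVec Ω 1 w)
    (hfin : normHcurl Ω w ≠ ⊤) :
    ‖tangTrace Ω v ⟨w, hw⟩‖ₑ ≤ 6 * normTH Ω (tangTrace Ω v) * normHcurl Ω w := by
  -- The infimum is reached by dividing by `6 * normHcurl Ω w`, which must be neither `0` nor `∞`.
  rcases eq_or_ne (normHcurl Ω w) 0 with h0 | h0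
  · refine (enorm_tangTrace_le hΩ hv hw).trans ?_
    simp [h0]
  · have h6 : 6 * normHcurl Ω w ≠ 0 := by simp [h0]
    have h6' : 6 * normHcurl Ω w ≠ ⊤ := ENNReal.mul_ne_top (by simp) hfin
    have key : ‖tangTrace Ω v ⟨w, hw⟩‖ₑ / (6 * normHcurl Ω w) ≤ normTH Ω (tangTrace Ω v) := by
      refine le_iInf fun u => le_iInf fun hu => le_iInf fun he => ?_
      refine ENNReal.div_le_of_le_mul ?_
      rw [← he]
      refine (enorm_tangTrace_le hΩ hu hw).trans (le_of_eq ?_)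
      ring
    refine ((ENNReal.div_le_iff_le_mul (Or.inl h6) (Or.inl h6')).1 key).trans (le_of_eq ?_)
    ring

theorem normTH_le_normTH2_left (p : BdryFunctional Ω × BdryFunctional Ω) :
    normTH Ω p.1 ≤ normTH2 Ω p := by
  rw [← sq_rpow_half (normTH Ω p.1)]
  exact ENNReal.rpow_le_rpow le_self_add (by norm_num)

theorem normTH_le_normTH2_right (p : BdryFunctional Ω × BdryFunctional Ω) :
    normTH Ω p.2 ≤ normTH2 Ω p := by
  rw [← sq_rpow_half (normTH Ω p.2)]
  exact ENNReal.rpow_le_rpow le_add_self (by norm_num)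

theorem normTH_tangTrace_le (hv : MemHcurl Ω v) : normTH Ω (tangTrace Ω v) ≤ normHcurl Ω v :=
  iInf_le_of_le v (iInf_le_of_le hv (iInf_le_of_le rfl le_rfl))

theorem normHcurl_le_of_hasL2Deriv (hΩ : IsOpen Ω) {u : E3 → Fin 3 → ℂ}
    {d : Fin 3 → Fin 3 → E3 → ℂ} (h : ∀ j k, HasL2Deriv Ω j (fun x => u x k) (d j k))
    {B : ℝ≥0∞} (hu : ∀ k, eLpNorm (fun x => u x k) 2 (volume.restrict Ω) ≤ B)
    (hd : ∀ j k, eLpNorm (d j k) 2 (volume.restrict Ω) ≤ B) : normHcurl Ω u ≤ 9 * B := by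
  have hs : ∀ j k j' k', eLpNorm (fun x => d j k x - d j' k' x) 2 (volume.restrict Ω) ≤ 2 * B := by
    intro j k j' k'
    refine (eLpNorm_sub_le (h j k).memLp_deriv.1 (h j' k').memLp_deriv.1 (by norm_num)).trans ?_
    rw [two_mul]
    exact add_le_add (hd j k) (hd j' k')
  have hc : normL2 Ω (fun x => curlOf fun j k => d j k x) ≤ 3 * (2 * B) := by
    refine normL2_le fun i => ?_
    simp only [curlOf_apply]
    fin_cases i
    · exact hs 1 2 2 1
    · exact hs 2 0 0 2
    · exact hs 0 1 1 0
  rw [(hasL2Curl_of_hasL2Deriv h).normHcurl_eq hΩ]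
  refine (add_le_add (normL2_le hu) hc).trans (le_of_eq ?_)
  ring

/-- Since gradients have no curl, only first derivatives of `f` appear. This is why the final
estimate involves just the `H¹` norm of `Y₂`, although gradients of its components are used as test
fields. -/
theorem normHcurl_grad_le (hΩ : IsOpen Ω) {f : E3 → ℂ} {f' : Fin 3 → E3 → ℂ}
    (h : ∀ j, HasL2Deriv Ω j f (f' j)) {B : ℝ≥0∞}
    (hB : ∀ j, eLpNorm (f' j) 2 (volume.restrict Ω) ≤ B) :
    normHcurl Ω (fun x j => f' j x) ≤ 9 * B := by
  have h0 : normL2 Ω (0 : E3 → Fin 3 → ℂ) = 0 := by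
    simp [normL2]
  rw [(hasL2Curl_grad h).normHcurl_eq hΩ, h0, add_zero]
  refine (normL2_le hB).trans ?_
  gcongr
  norm_num

theorem eLpNorm_mul_le {m f : E3 → ℂ} (hΩ : IsOpen Ω) {C : ℝ} (hm : ∀ x ∈ Ω, ‖m x‖ ≤ C) :
    eLpNorm (fun x => m x * f x) 2 (volume.restrict Ω) ≤
      ENNReal.ofReal C * eLpNorm f 2 (volume.restrict Ω) := by
  refine eLpNorm_le_mul_eLpNorm_of_ae_le_mul ?_ _
  filter_upwards [ae_restrict_mem hΩ.measurableSet] with x hx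
  rw [norm_mul]
  exact mul_le_mul_of_nonneg_right (hm x hx) (norm_nonneg _)

/-- Products with a `C¹` multiplier: bound of the derivative given by the Leibniz rule. -/
theorem eLpNorm_leibniz_le {m f f' : E3 → ℂ} (hΩ : IsOpen Ω) {j : Fin 3}
    (hm : IsC1Bounded Ω m) {C : ℝ} (hC : ∀ x ∈ Ω, ‖m x‖ ≤ C) (hC' : ∀ x ∈ Ω, ‖pd j m x‖ ≤ C)
    (hf : HasL2Deriv Ω j f f') {B : ℝ≥0∞} (hB : eLpNorm f 2 (volume.restrict Ω) ≤ B)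
    (hB' : eLpNorm f' 2 (volume.restrict Ω) ≤ B) :
    eLpNorm (fun x => pd j m x * f x + m x * f' x) 2 (volume.restrict Ω) ≤
      2 * (ENNReal.ofReal C * B) := by
  refine (eLpNorm_add_le (hm.memLp_pd_mul hΩ j hf.memLp).1 (hm.memLp_mul hΩ hf.memLp_deriv).1
    (by norm_num)).trans ?_
  rw [two_mul]
  refine add_le_add ((eLpNorm_mul_le hΩ hC').trans ?_) ((eLpNorm_mul_le hΩ hC).trans ?_)
  · gcongr
  · gcongr

end

/-! ### The rows of the adjoint equation -/

/-- For `y = (f̄, ū, ḡ, v̄)` this row reads `∇ × v̄ = ∇ḡ - iω γ^{1/2} ū`, one half of a Maxwell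
system. -/
theorem adjoint_row_inl {ω : ℝ} {σ : E3 → ℝ} {x : E3} {y : I8 → ℂ} {y' : Fin 3 → I8 → ℂ}
    (h : ∑ j, Complex.I • (symbolP (Pi.single j 1) *ᵥ y' j) + (potW ω σ x)ᵀ *ᵥ y = 0)
    (i : Fin 3) :
    Complex.I * y' i (.inr (.inl ())) -
      Complex.I * curlOf (fun j k => y' j (.inr (.inr k))) i +
      kap ω σ x * y (.inl (.inr i)) = 0 := by
  have := congrFun h (.inl (.inr i))
  rw [curlOf_apply]
  fin_cases i <;>
  · simp [Fin.sum_univ_three, symbolP, bordered, Matrix.mulVec, dotProduct, potW_eq, upperN,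
      crossMat, Matrix.one_apply] at this ⊢
    linear_combination this

/-- Multiplied by `γ^{1/2}`, this row becomes the other half, `∇ × (γ^{1/2} ū) = iωγ v̄ - γ
∇(γ^{-1/2} f̄)`: the terms with `∇α` are absorbed into the derivatives of `γ^{±1/2}`. -/
theorem adjoint_row_inr {ω : ℝ} {σ : E3 → ℝ} {x : E3} {y : I8 → ℂ} {y' : Fin 3 → I8 → ℂ}
    (h : ∑ j, Complex.I • (symbolP (Pi.single j 1) *ᵥ y' j) + (potW ω σ x)ᵀ *ᵥ y = 0)
    (i : Fin 3) :
    Complex.I * y' i (.inl (.inl ())) +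
      Complex.I * curlOf (fun j k => y' j (.inl (.inr k))) i +
      kap ω σ x * y (.inr (.inr i)) - Complex.I / 2 * (pd i (alp ω σ) x * y (.inl (.inl ()))
        - curlOf (fun j k => pd j (alp ω σ) x * y (.inl (.inr k))) i) = 0 := by
  have := congrFun h (.inr (.inr i))
  rw [curlOf_apply, curlOf_apply]
  fin_cases i <;>
  · simp [Fin.sum_univ_three, symbolP, bordered, Matrix.mulVec, dotProduct, potW_eq, upperN,
      crossMat, Matrix.one_apply, gradD] at this ⊢
    linear_combination this

/-! ### Pointwise identities between the integrands -/

theorem sum_potW_mulVec_vec8 {ω : ℝ} {σ : E3 → ℝ} {x : E3} (y : I8 → ℂ) (H G : Fin 3 → ℂ) :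
    ∑ k, (potW ω σ x *ᵥ vec8 0 H 0 G) k * y k =
      kap ω σ x * ∑ i, (H i * y (.inl (.inr i)) + G i * y (.inr (.inr i))) -
      Complex.I / 2 * ((∑ i, pd i (alp ω σ) x * G i) * y (.inl (.inl ())) +
        ∑ i, curlOf (fun j k => pd j (alp ω σ) x * G k) i * y (.inl (.inr i))) := by
  rw [curlOf_apply]
  simp [Fin.sum_univ_three, bordered, Matrix.mulVec, dotProduct, potW_eq, upperN, vec8,
      crossMat, Matrix.one_apply, gradD]
  ring

/-- Here `aⱼ = γⱼ^{1/2}`, `bⱼ = γⱼ^{-1/2}`, `pⱼ = ∇αⱼ`, `(F, V, V') = (f̄, ū, v̄)`, and `hr` is the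
second row of the adjoint equation. The two remainders are `-iγ₁ E · ∇((b₂ - b₁) F)` and `i (E ·
∇×(mV) - iωH · mV)` with `m = a₁ - a₂`. Both have zero integral for Maxwell solutions. -/
theorem pointwise_potW_sub {ω a₁ a₂ b₁ b₂ F : ℂ} {p₁ p₂ E H dF V V' : Fin 3 → ℂ}
    {dV : Fin 3 → Fin 3 → ℂ} (h₁ : a₁ ^ 2 * b₁ = a₁) (h₂ : a₂ ^ 2 * b₂ = a₂)
    (hr : ∀ i, Complex.I * dF i + Complex.I * curlOf dV i + ω * a₂ * V' i -
      Complex.I / 2 * (p₂ i * F - curlOf (fun j k => p₂ j * V k) i) = 0) :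
    (ω * a₁ * (∑ i, (H i * V i + (a₁ • E) i * V' i)) - Complex.I / 2 *
      ((∑ i, p₁ i * (a₁ • E) i) * F + ∑ i, curlOf (fun j k => p₁ j * (a₁ • E) k) i * V i)) -
    (ω * a₂ * (∑ i, (H i * V i + (a₁ • E) i * V' i)) - Complex.I / 2 *
      ((∑ i, p₂ i * (a₁ • E) i) * F + ∑ i, curlOf (fun j k => p₂ j * (a₁ • E) k) i * V i)) =
    -Complex.I * ((a₁ ^ 2 - a₂ ^ 2) * ∑ i, E i * (Complex.I * ω * V' i -
      (-1 / 2 * p₂ i * b₂ * F + b₂ * dF i))) +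
    (∑ i, -Complex.I * a₁ ^ 2 * E i *
      ((-1 / 2 * p₂ i * b₂ - -1 / 2 * p₁ i * b₁) * F + (b₂ - b₁) * dF i) +
    Complex.I * ((∑ i, E i * curlOf (fun j k => (1 / 2 * p₁ j * a₁ - 1 / 2 * p₂ j * a₂) * V k +
      (a₁ - a₂) * dV j k) i) - ∑ i, Complex.I * ω * H i * ((a₁ - a₂) * V i))) := by
  have r0 := hr 0
  have r1 := hr 1
  have r2 := hr 2
  simp only [curlOf_apply] at *
  simp only [Fin.sum_univ_three, Pi.smul_apply, smul_eq_mul] at *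
  simp only [Matrix.cons_val] at *
  linear_combination -(a₁ - a₂) * (E 0 * r0 + E 1 * r1 + E 2 * r2) +
    Complex.I * (E 0 * (1 / 2 * p₁ 0 * F - dF 0) + E 1 * (1 / 2 * p₁ 1 * F - dF 1) +
      E 2 * (1 / 2 * p₁ 2 * F - dF 2)) * h₁ +
    Complex.I * (E 0 * (-1 / 2 * p₂ 0 * F + dF 0) + E 1 * (-1 / 2 * p₂ 1 * F + dF 1) +
      E 2 * (-1 / 2 * p₂ 2 * F + dF 2)) * h₂ +
    (ω * (a₁ ^ 2 - a₂ ^ 2) * (E 0 * V' 0 + E 1 * V' 1 + E 2 * V' 2) +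
      ω * (a₁ - a₂) * (H 0 * V 0 + H 1 * V 1 + H 2 * V 2)) * Complex.I_sq

/-- With `e = E - E'`, `h = H - H'` and the dual solution built from `a = γ₂^{1/2} ū - (iω)⁻¹∇ḡ` and
`b = v̄ - (iω)⁻¹∇(γ₂^{-1/2} f̄)`, the left side is `(∇×e)·a - e·(∇×a) - (∇×h)·b + h·(∇×b)`. Insert
`∇×e = iωh`, `∇×h = -iω(γ₂ e + (γ₁ - γ₂)E)`, `∇×a = iωγ₂ b` and `∇×b = -iωa`: all terms cancel but
`iω(γ₁ - γ₂) E · b`. -/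
theorem pointwise_alessandrini {ω a₁ a₂ b₂ o F : ℂ} {p E e h dF dF' V V' : Fin 3 → ℂ}
    {dV dV' : Fin 3 → Fin 3 → ℂ} (h₂ : a₂ ^ 2 * b₂ = a₂) (ho : o * (Complex.I * ω) = 1)
    (hr' : ∀ i, Complex.I * dF' i - Complex.I * curlOf dV' i + ω * a₂ * V i = 0)
    (hr : ∀ i, Complex.I * dF i + Complex.I * curlOf dV i + ω * a₂ * V' i -
      Complex.I / 2 * (p i * F - curlOf (fun j k => p j * V k) i) = 0) :
    -(o * ∑ i, Complex.I * ω * h i * dF' i) -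
    ((∑ i, -(Complex.I * ω * (a₂ ^ 2 * e i + (a₁ ^ 2 - a₂ ^ 2) * E i)) * V' i) -
      ∑ i, h i * curlOf dV' i) +
    o * (∑ i, -(Complex.I * ω * (a₂ ^ 2 * e i + (a₁ ^ 2 - a₂ ^ 2) * E i)) *
      (-1 / 2 * p i * b₂ * F + b₂ * dF i)) +
    ((∑ i, Complex.I * ω * h i * (a₂ * V i)) -
      ∑ i, e i * curlOf (fun j k => 1 / 2 * p j * a₂ * V k + a₂ * dV j k) i) =
    (a₁ ^ 2 - a₂ ^ 2) * ∑ i, E i * (Complex.I * ω * V' i -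
      (-1 / 2 * p i * b₂ * F + b₂ * dF i)) := by
  have r0 := hr 0
  have r1 := hr 1
  have r2 := hr 2
  have s0 := hr' 0
  have s1 := hr' 1
  have s2 := hr' 2
  simp only [curlOf_apply] at *
  simp only [Fin.sum_univ_three] at *
  simp only [Matrix.cons_val] at *
  linear_combination Complex.I * (h 0 * s0 + h 1 * s1 + h 2 * s2) +
    Complex.I * a₂ * (e 0 * r0 + e 1 * r1 + e 2 * r2) +
    (-(h 0 * dF' 0 + h 1 * dF' 1 + h 2 * dF' 2) -
      ((a₂ ^ 2 * e 0 + (a₁ ^ 2 - a₂ ^ 2) * E 0) * (-1 / 2 * p 0 * b₂ * F + b₂ * dF 0) +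
      (a₂ ^ 2 * e 1 + (a₁ ^ 2 - a₂ ^ 2) * E 1) * (-1 / 2 * p 1 * b₂ * F + b₂ * dF 1) +
      (a₂ ^ 2 * e 2 + (a₁ ^ 2 - a₂ ^ 2) * E 2) * (-1 / 2 * p 2 * b₂ * F + b₂ * dF 2))) * ho -
    (e 0 * (-1 / 2 * p 0 * F + dF 0) + e 1 * (-1 / 2 * p 1 * F + dF 1) +
      e 2 * (-1 / 2 * p 2 * F + dF 2)) * h₂ -
    (h 0 * (dF' 0 - (dV' 1 2 - dV' 2 1)) + h 1 * (dF' 1 - (dV' 2 0 - dV' 0 2)) +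
      h 2 * (dF' 2 - (dV' 0 1 - dV' 1 0)) +
      a₂ * (e 0 * (dF 0 + (dV 1 2 - dV 2 1) - 1 / 2 * (p 0 * F) +
          1 / 2 * (p 1 * V 2 - p 2 * V 1)) +
        e 1 * (dF 1 + (dV 2 0 - dV 0 2) - 1 / 2 * (p 1 * F) + 1 / 2 * (p 2 * V 0 - p 0 * V 2)) +
        e 2 * (dF 2 + (dV 0 1 - dV 1 0) - 1 / 2 * (p 2 * F) +
          1 / 2 * (p 0 * V 1 - p 1 * V 0)))) * Complex.I_sq

/-! ### Reduction to the Cauchy data -/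

theorem pd_sub {j : Fin 3} {u v : E3 → ℂ} {x : E3} (hu : DifferentiableAt ℝ u x)
    (hv : DifferentiableAt ℝ v x) : pd j (fun y => u y - v y) x = pd j u x - pd j v x := by
  have : fderiv ℝ (fun y => u y - v y) x = _ := (hu.hasFDerivAt.sub hv.hasFDerivAt).fderiv
  rw [pd, this]
  rfl

theorem integral_eq_of_ae_eq_add_add {X : Type*} [MeasurableSpace X] {μ : Measure X}
    {A B f g h : X → ℂ} (hf : Integrable f μ) (hg : Integrable g μ) (hh : Integrable h μ)
    (hf0 : ∫ x, f x ∂μ = 0) (hgh : ∫ x, g x ∂μ = ∫ x, h x ∂μ) (a b : ℂ)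
    (hA : ∀ᵐ x ∂μ, A x = B x + (a * f x + b * (g x - h x))) :
    ∫ x, A x ∂μ = ∫ x, B x ∂μ := by
  have i1 : Integrable (fun x => b * (g x - h x)) μ := (hg.sub hh).const_mul b
  refine integral_eq_of_ae_eq_add ((hf.const_mul a).add i1) ?_ hA
  have e : ∫ x, (a * f x + b * (g x - h x)) ∂μ = 0 := by
    rw [integral_add (hf.const_mul a) i1, integral_const_mul, integral_const_mul,
      integral_sub hg hh, hf0, hgh]
    simp
  exact e

section

variable {Ω K : Set E3} {M ω : ℝ} {σ₁ σ₂ : E3 → ℝ} {E H E' H' : E3 → Fin 3 → ℂ}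
  {Y : E3 → I8 → ℂ} {k : ℕ}

/-- The integrand `(γ₁ - γ₂) E · (iω v̄ - ∇(γ₂^{-1/2} f̄))` for `Y = (f, ·, ·, v)`. -/
noncomputable def alessandriniDensity (Ω : Set E3) (ω : ℝ) (σ₁ σ₂ : E3 → ℝ)
    (E : E3 → Fin 3 → ℂ) (Y : E3 → I8 → ℂ) (x : E3) : ℂ :=
  (gam ω σ₁ x - gam ω σ₂ x) * ∑ i, E x i * (Complex.I * ω * star (Y x (.inr (.inr i))) -
    (pd i (fun y => (sqrtGam ω σ₂ y)⁻¹) x * star (Y x (.inl (.inl ()))) +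
      (sqrtGam ω σ₂ x)⁻¹ * star (weakPd Ω i (fun y => Y y (.inl (.inl ()))) x)))

theorem sqrtGam_sq_mul_inv (ω : ℝ) (σ : E3 → ℝ) (x : E3) :
    sqrtGam ω σ x ^ 2 * (sqrtGam ω σ x)⁻¹ = sqrtGam ω σ x := by
  rw [sq, mul_assoc, mul_inv_cancel₀ (sqrtGam_ne_zero x), mul_one]

/-- This brings the pairing to a form containing only `γ₁ - γ₂` and `E`, in which the solution for
`σ₂` can be compared. The Maxwell equations for `(E, H)` identify the remainders of
`pointwise_potW_sub` with integrals that vanish. -/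
theorem innerΩ_potW_sub (hΩ : IsOpen Ω) (hK : IsCompact K) (hKΩ : K ⊆ Ω)
    (h₁ : IsC2Bounded Ω M σ₁) (h₂ : IsC2Bounded Ω M σ₂) (hω : 1 ≤ ω)
    (he : ∀ x ∈ Ω \ K, σ₁ x = σ₂ x) (hk : 1 ≤ k) (hY : MemHVec Ω k Y)
    (hPY : ∀ᵐ x ∂(volume.restrict Ω), opPaddWstar Ω ω σ₂ Y x = 0)
    (hEH : IsMaxwellSol Ω ω σ₁ E H) {X : E3 → I8 → ℂ}
    (hX : ∀ᵐ x ∂(volume.restrict Ω), X x = vec8 0 (H x) 0 (sqrtGam ω σ₁ x • E x)) :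
    innerΩ Ω (fun x => (potW ω σ₁ x - potW ω σ₂ x) *ᵥ X x) Y =
      -Complex.I * ∫ x in Ω, alessandriniDensity Ω ω σ₁ σ₂ E Y x := by
  obtain ⟨hE, hH, hM⟩ := hEH
  have hE := hE.hasL2Curl hΩ
  have hH := hH.hasL2Curl hΩ
  have hω0 : (ω : ℂ) ≠ 0 := by
    exact_mod_cast (by linarith : ω ≠ 0)
  have hU : IsOpen (Ω \ K) := hΩ.sdiff hK.isClosed
  have da₁ := h₁.isC1Bounded_sqrtGam hΩ hω
  have da₂ := h₂.isC1Bounded_sqrtGam hΩ hω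
  have db₁ := h₁.isC1Bounded_inv_sqrtGam hΩ hω
  have db₂ := h₂.isC1Bounded_inv_sqrtGam hΩ hω
  -- Where `σ₁ = σ₂` these multipliers and their gradients vanish, so `m ū` and `m' f̄` are
  -- compactly supported and can be integrated by parts against `E` and `H`, which are merely in
  -- `H(curl; Ω)`.
  set m : E3 → ℂ := fun x => sqrtGam ω σ₁ x - sqrtGam ω σ₂ x with hm
  set m' : E3 → ℂ := fun x => (sqrtGam ω σ₂ x)⁻¹ - (sqrtGam ω σ₁ x)⁻¹ with hm'
  have dm : IsC1Bounded Ω m := da₁.sub hΩ da₂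
  have dm' : IsC1Bounded Ω m' := db₂.sub hΩ db₁
  have m0 : ∀ x ∈ Ω \ K, m x = 0 := fun x hx => by
    simp only [hm, sqrtGam_congr (he x hx), sub_self]
  have m0' : ∀ x ∈ Ω \ K, m' x = 0 := fun x hx => by
    simp only [hm', sqrtGam_congr (he x hx), sub_self]
  have p0 : ∀ j, ∀ x ∈ Ω \ K, pd j m x = 0 := fun j x hx => by
    rw [pd_congr hU (v := fun _ => 0) m0 j hx, pd_const]
  have p0' : ∀ j, ∀ x ∈ Ω \ K, pd j m' x = 0 := fun j x hx => by
    rw [pd_congr hU (v := fun _ => 0) m0' j hx, pd_const]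
  have hy := fun n j => ((hY n).hasL2Deriv hΩ hk j).conj
  have d1 := fun j => (hy (.inl (.inl ())) j).mul_left hΩ dm'
  have d2 := fun j i => (hy (.inl (.inr i)) j).mul_left hΩ dm
  have z1 := hH.integral_curl_dot_grad hΩ hK hKΩ d1
    (fun x hx => by simp only [m0' x hx, zero_mul])
    (fun j x hx => by simp only [m0' x hx, p0' j x hx, zero_mul, add_zero])
  have z2 := hE.integral_dot_curlOf hΩ hK hKΩ d2
    (fun i x hx => by simp only [m0 x hx, zero_mul])
    (fun j i x hx => by simp only [m0 x hx, p0 j x hx, zero_mul, add_zero])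
  have i1 := integrable_finsetSum Finset.univ fun i _ =>
    integrable_mul_of_memLp_two (hH.memLp_curl i) (d1 i).memLp_deriv
  have i2 := integrable_finsetSum Finset.univ fun i _ =>
    integrable_mul_of_memLp_two (hE.memLp i) ((hasL2Curl_of_hasL2Deriv (u := fun x i =>
      m x * star (Y x (.inl (.inr i)))) d2).memLp_curl i)
  have i3 := integrable_finsetSum Finset.univ fun i _ =>
    integrable_mul_of_memLp_two (hE.memLp_curl i) (d2 0 i).memLp
  rw [innerΩ, ← integral_const_mul]
  -- The weight `ω⁻¹` comes from `∇ × H = -iωγ₁ E`, which rewrites `-iγ₁ E` as `ω⁻¹ ∇ × H`.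
  refine integral_eq_of_ae_eq_add_add i1 i2 i3 z1 z2 (ω : ℂ)⁻¹ Complex.I ?_
  filter_upwards [hPY, hX, hM, ae_restrict_mem hΩ.measurableSet] with x hx hXx hMx hxΩ
  have hst := adjoint_eq_of_opPaddWstar_eq_zero hx
  have hr := fun i => adjoint_row_inr hst i
  have key := pointwise_potW_sub (ω := ω) (p₁ := fun i => pd i (alp ω σ₁) x) (E := E x)
    (H := H x) (sqrtGam_sq_mul_inv ω σ₁ x) (sqrtGam_sq_mul_inv ω σ₂ x) hr
  rw [hXx]
  simp only [Matrix.sub_mulVec, Pi.sub_apply, sub_mul, Finset.sum_sub_distrib]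
  have s₁ := sum_potW_mulVec_vec8 (ω := ω) (σ := σ₁) (x := x) (fun m => star (Y x m)) (H x)
    (sqrtGam ω σ₁ x • E x)
  have s₂ := sum_potW_mulVec_vec8 (ω := ω) (σ := σ₂) (x := x) (fun m => star (Y x m)) (H x)
    (sqrtGam ω σ₁ x • E x)
  rw [s₁, s₂]
  refine key.trans ?_
  have cH : ∀ i, weakCurl Ω H x i = -(Complex.I * ω * gam ω σ₁ x * E x i) := fun i =>
    eq_neg_of_add_eq_zero_left (congrFun hMx.1 i)
  have cE : ∀ i, weakCurl Ω E x i = Complex.I * ω * H x i := fun i =>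
    sub_eq_zero.1 (congrFun hMx.2 i)
  have pm : ∀ j, pd j m x = 1 / 2 * pd j (alp ω σ₁) x * sqrtGam ω σ₁ x -
      1 / 2 * pd j (alp ω σ₂) x * sqrtGam ω σ₂ x := fun j => by
    rw [pd_sub (da₁.differentiableAt hΩ hxΩ) (da₂.differentiableAt hΩ hxΩ),
      h₁.pd_sqrtGam hΩ j hxΩ, h₂.pd_sqrtGam hΩ j hxΩ]
  have pm' : ∀ j, pd j m' x = -1 / 2 * pd j (alp ω σ₂) x * (sqrtGam ω σ₂ x)⁻¹ -
      -1 / 2 * pd j (alp ω σ₁) x * (sqrtGam ω σ₁ x)⁻¹ := fun j => by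
    rw [pd_sub (db₂.differentiableAt hΩ hxΩ) (db₁.differentiableAt hΩ hxΩ),
      h₁.pd_inv_sqrtGam hΩ j hxΩ, h₂.pd_inv_sqrtGam hΩ j hxΩ]
  simp only [alessandriniDensity, cH, cE, pm, pm',
    h₂.pd_inv_sqrtGam hΩ _ hxΩ, sqrtGam_sq]
  congr 1
  congr 1
  rw [Finset.mul_sum]
  refine Finset.sum_congr rfl fun i _ => ?_
  simp only [hm']
  field_simp

/-- Multiples of the gradient of `m f` as elements of `H¹(Ω)³`. -/
theorem memHVec_grad_mul (hΩ : IsOpen Ω) {m f : E3 → ℂ} (hf : MemH Ω k f) (hk : 2 ≤ k)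
    (hm : IsC1Bounded Ω m) (hm' : ∀ j, IsC1Bounded Ω (pd j m)) :
    MemHVec Ω 1 fun x j => pd j m x * f x + m x * weakPd Ω j f x := fun j =>
  memH_one_of_hasL2Deriv fun i => by
    obtain ⟨g, hg⟩ := hf.exists_hasL2Deriv_weakPd hΩ hk i j
    exact ⟨_, ((hf.hasL2Deriv hΩ (by omega) i).mul_left hΩ (hm' j)).add (hg.mul_left hΩ hm)⟩

theorem normHcurl_grad_mul_le (hΩ : IsOpen Ω) {m f : E3 → ℂ} (hf : MemH Ω k f) (hk : 1 ≤ k)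
    (hm : IsC1Bounded Ω m) {C : ℝ} (hC : ∀ x ∈ Ω, ‖m x‖ ≤ C)
    (hC' : ∀ j, ∀ x ∈ Ω, ‖pd j m x‖ ≤ C) :
    normHcurl Ω (fun x j => pd j m x * f x + m x * weakPd Ω j f x) ≤
      18 * (ENNReal.ofReal C * normH Ω 1 f) := by
  have hd := fun j => hf.hasL2Deriv hΩ hk j
  refine (normHcurl_grad_le hΩ (fun j => (hd j).mul_left hΩ hm) fun j =>
    eLpNorm_leibniz_le hΩ hm hC (hC' j) (hd j) (eLpNorm_le_normH hΩ)
      ((hd j).eLpNorm_le_normH hΩ)).trans (le_of_eq ?_)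
  ring

theorem memHVec_mul (hΩ : IsOpen Ω) {m : E3 → ℂ} {v : E3 → Fin 3 → ℂ} (hv : MemHVec Ω k v)
    (hk : 1 ≤ k) (hm : IsC1Bounded Ω m) : MemHVec Ω 1 fun x i => m x * v x i := fun i =>
  memH_one_of_hasL2Deriv fun j => ⟨_, ((hv i).hasL2Deriv hΩ hk j).mul_left hΩ hm⟩

theorem normHcurl_mul_le (hΩ : IsOpen Ω) {m : E3 → ℂ} {v : E3 → Fin 3 → ℂ}
    {d : Fin 3 → Fin 3 → E3 → ℂ} (hd : ∀ j i, HasL2Deriv Ω j (fun x => v x i) (d j i))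
    (hm : IsC1Bounded Ω m) {C : ℝ} (hC : ∀ x ∈ Ω, ‖m x‖ ≤ C)
    (hC' : ∀ j, ∀ x ∈ Ω, ‖pd j m x‖ ≤ C) {N : ℝ≥0∞} (hN : ∀ i, normH Ω 1 (fun x => v x i) ≤ N) :
    normHcurl Ω (fun x i => m x * v x i) ≤ 18 * (ENNReal.ofReal C * N) := by
  refine (normHcurl_le_of_hasL2Deriv hΩ (B := 2 * (ENNReal.ofReal C * N))
    (fun j i => (hd j i).mul_left hΩ hm) (fun i => ?_) fun j i =>
    eLpNorm_leibniz_le hΩ hm hC (hC' j) (hd j i) ((eLpNorm_le_normH hΩ).trans (hN i))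
      (((hd j i).eLpNorm_le_normH hΩ).trans (hN i))).trans (le_of_eq ?_)
  · refine (eLpNorm_mul_le hΩ hC).trans ?_
    rw [two_mul]
    refine le_trans ?_ le_self_add
    gcongr
    exact (eLpNorm_le_normH hΩ).trans (hN i)
  · ring

end

theorem integral_linear_combination {X : Type*} [MeasurableSpace X] {μ : Measure X}
    {a b b' c d d' : X → ℂ} (ha : Integrable a μ) (hb : Integrable b μ) (hb' : Integrable b' μ)
    (hc : Integrable c μ) (hd : Integrable d μ) (hd' : Integrable d' μ) (o : ℂ) :
    ∫ x, (-(o * a x) - (b x - b' x) + o * c x + (d x - d' x)) ∂μ =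
      -(o * ∫ x, a x ∂μ) - ((∫ x, b x ∂μ) - ∫ x, b' x ∂μ) + o * (∫ x, c x ∂μ) +
        ((∫ x, d x ∂μ) - ∫ x, d' x ∂μ) := by
  have i1 : Integrable (fun x => -(o * a x)) μ := (ha.const_mul o).neg
  have i2 : Integrable (fun x => b x - b' x) μ := hb.sub hb'
  have i3 : Integrable (fun x => d x - d' x) μ := hd.sub hd'
  have i4 : Integrable (fun x => -(o * a x) - (b x - b' x)) μ := i1.sub i2
  have i5 : Integrable (fun x => o * c x) μ := hc.const_mul o
  have i6 : Integrable (fun x => -(o * a x) - (b x - b' x) + o * c x) μ := i4.add i5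
  rw [integral_add i6 i3, integral_add i4 i5, integral_sub i1 i2, integral_neg, integral_const_mul,
    integral_const_mul, integral_sub hb hb', integral_sub hd hd']

theorem normHcurl_ne_top {Ω : Set E3} (hΩ : IsOpen Ω) {v : E3 → Fin 3 → ℂ}
    (hv : MemHcurl Ω v) : normHcurl Ω v ≠ ⊤ := by
  have h : ∀ {u : E3 → Fin 3 → ℂ}, (∀ i, MemLp (fun x => u x i) 2 (volume.restrict Ω)) →
      normL2 Ω u ≠ ⊤ := fun hu => ENNReal.rpow_ne_top_of_nonneg (by norm_num)
    (ENNReal.sum_ne_top.2 fun i _ => ENNReal.pow_ne_top (hu i).2.ne)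
  exact ENNReal.add_ne_top.2 ⟨h hv.1, h (hv.hasL2Curl hΩ).memLp_curl⟩

section

variable {Ω K : Set E3} {M ω : ℝ} {σ₁ σ₂ : E3 → ℝ} {E H E' H' : E3 → Fin 3 → ℂ}
  {Y : E3 → I8 → ℂ} {k : ℕ}

theorem enorm_mul_tangTrace_le (hΩ : IsOpen Ω) {v w : E3 → Fin 3 → ℂ} (hv : MemHcurl Ω v)
    (hw : MemHVec Ω 1 w) {B : ℝ≥0∞} (hB : normHcurl Ω w ≤ B) {o : ℂ} (ho : ‖o‖ ≤ 1) :
    ‖o * tangTrace Ω v ⟨w, hw⟩‖ₑ ≤ 6 * normTH Ω (tangTrace Ω v) * B := by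
  rw [enorm_mul]
  have h1 : ‖o‖ₑ ≤ 1 := by
    rw [← ofReal_norm, ← ENNReal.ofReal_one]
    exact ENNReal.ofReal_le_ofReal ho
  calc _ ≤ 1 * (6 * normTH Ω (tangTrace Ω v) * normHcurl Ω w) := mul_le_mul' h1
        (enorm_le_normTH hΩ hv hw (normHcurl_ne_top hΩ (hasL2Curl_of_memHVec hΩ hw).memHcurl))
    _ ≤ _ := by
      rw [one_mul]
      gcongr

/-- The integral of the density is a boundary pairing with the difference of the Cauchy data. -/
theorem enorm_integral_alessandriniDensity_le (hΩ : IsOpen Ω) (h₂ : IsC2Bounded Ω M σ₂)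
    (hω : 1 ≤ ω) (hM : 0 ≤ M) (hk : 2 ≤ k) (hY : MemHVec Ω k Y)
    (hPY : ∀ᵐ x ∂(volume.restrict Ω), opPaddWstar Ω ω σ₂ Y x = 0)
    (hEH : IsMaxwellSol Ω ω σ₁ E H) (hEH' : IsMaxwellSol Ω ω σ₂ E' H') :
    ‖∫ x in Ω, alessandriniDensity Ω ω σ₁ σ₂ E Y x‖ₑ ≤
      432 * ENNReal.ofReal ((1 + M) ^ 2) *
        normTH2 Ω ((tangTrace Ω E, tangTrace Ω H) - (tangTrace Ω E', tangTrace Ω H')) *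
        normHVec Ω 1 Y := by
  obtain ⟨hE, hH, hS⟩ := hEH
  obtain ⟨hE', hH', hS'⟩ := hEH'
  have ce := (hE.hasL2Curl hΩ).sub (hE'.hasL2Curl hΩ)
  have ch := (hH.hasL2Curl hΩ).sub (hH'.hasL2Curl hΩ)
  have tE := (hE.hasL2Curl hΩ).tangTrace_sub hΩ (hE'.hasL2Curl hΩ)
  have tH := (hH.hasL2Curl hΩ).tangTrace_sub hΩ (hH'.hasL2Curl hΩ)
  have hω0 : (ω : ℂ) ≠ 0 := by exact_mod_cast (by linarith : ω ≠ 0)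
  set o : ℂ := (Complex.I * ω)⁻¹ with ho
  have ho1 : o * (Complex.I * ω) = 1 := inv_mul_cancel₀ (mul_ne_zero Complex.I_ne_zero hω0)
  have hon : ‖o‖ ≤ 1 := by
    rw [ho, norm_inv, norm_mul, Complex.norm_I, one_mul, Complex.norm_real, Real.norm_eq_abs,
      abs_of_pos (by linarith)]
    exact inv_le_one_of_one_le₀ hω
  set N := normHVec Ω 1 Y
  -- One constant dominating `1`, `M`, `1 + M` and `M (1 + M)`, the bounds of `γ₂^{±1/2}` and of
  -- their first derivatives.
  set C := (1 + M) ^ 2 with hC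
  have hC1 : 1 ≤ C := by nlinarith
  have da := h₂.isC1Bounded_sqrtGam hΩ hω
  have db := h₂.isC1Bounded_inv_sqrtGam hΩ hω
  have pa : ∀ j, ∀ x ∈ Ω, pd j (fun y => star (sqrtGam ω σ₂ y)) x =
      star (pd j (sqrtGam ω σ₂) x) := fun j x hx => pd_star (da.differentiableAt hΩ hx)
  have pb : ∀ j, ∀ x ∈ Ω, pd j (fun y => star (sqrtGam ω σ₂ y)⁻¹) x =
      star (pd j (fun y => (sqrtGam ω σ₂ y)⁻¹) x) :=
    fun j x hx => pd_star (db.differentiableAt hΩ hx)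
  have hpb : ∀ j, IsC1Bounded Ω (pd j fun y => star (sqrtGam ω σ₂ y)⁻¹) := fun j =>
    ((h₂.isC1Bounded_pd_inv_sqrtGam hΩ hω j).conj hΩ).congr hΩ (pb j)
  have b1 : ∀ x ∈ Ω, ‖star (sqrtGam ω σ₂ x)⁻¹‖ ≤ C := fun x _ => by
    rw [norm_star]
    exact (norm_inv_sqrtGam_le x).trans hC1
  have b2 : ∀ j, ∀ x ∈ Ω, ‖pd j (fun y => star (sqrtGam ω σ₂ y)⁻¹) x‖ ≤ C := fun j x hx => by
    rw [pb j x hx, norm_star]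
    exact (h₂.norm_pd_inv_sqrtGam_le hΩ hω j hx).trans (by nlinarith)
  have a1 : ∀ x ∈ Ω, ‖star (sqrtGam ω σ₂ x)‖ ≤ C := fun x hx => by
    rw [norm_star]
    exact (h₂.norm_sqrtGam_le hω hx).trans (by nlinarith)
  have a2 : ∀ j, ∀ x ∈ Ω, ‖pd j (fun y => star (sqrtGam ω σ₂ y)) x‖ ≤ C := fun j x hx => by
    rw [pa j x hx, norm_star]
    exact (h₂.norm_pd_sqrtGam_le hΩ hω j hx).trans (by nlinarith)
  have c1 : ∀ x ∈ Ω, ‖(1 : ℂ)‖ ≤ C := fun x _ => by simpa using hC1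
  have c2 : ∀ j, ∀ x ∈ Ω, ‖pd j (fun _ => (1 : ℂ)) x‖ ≤ C := fun j x _ => by
    rw [pd_const, norm_zero]
    linarith
  have c3 : ∀ j, IsC1Bounded Ω (pd j fun _ => (1 : ℂ)) := fun j =>
    (isC1Bounded_const 0).congr hΩ fun x _ => pd_const 1
  have hk1 : 1 ≤ k := by omega
  have hd := fun n j => (hY n).hasL2Deriv hΩ hk1 j
  have hN := fun n => normH_le_normHVec (Ω := Ω) (k := 1) (Y := Y) n
  -- The four test fields are `∇g`, `v`, `∇(γ̄₂^{-1/2} f)` and `γ̄₂^{1/2} u`, the first two with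
  -- multiplier `1` so that the same lemmas apply. Two derivatives of `g` and `f` make the gradients
  -- admissible in `H¹`; the norm bounds use one.
  have m1 := memHVec_grad_mul hΩ (hY (.inr (.inl ()))) hk (isC1Bounded_const 1) c3
  have n1 := normHcurl_grad_mul_le hΩ (hY (.inr (.inl ()))) hk1 (isC1Bounded_const 1) c1 c2
  have l1 := hasL2Curl_grad fun j => (hd (.inr (.inl ())) j).mul_left hΩ (isC1Bounded_const 1)
  have m2 := memHVec_mul hΩ (v := fun x i => Y x (.inr (.inr i))) (fun i => hY _) hk1
    (isC1Bounded_const 1)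
  have n2 := normHcurl_mul_le hΩ (v := fun x i => Y x (.inr (.inr i)))
    (fun j i => hd (.inr (.inr i)) j) (isC1Bounded_const 1) c1 c2 (fun i => hN _)
  have l2 := hasL2Curl_of_hasL2Deriv (u := fun x i => 1 * Y x (.inr (.inr i))) fun j i =>
    (hd (.inr (.inr i)) j).mul_left hΩ (isC1Bounded_const 1)
  have m3 := memHVec_grad_mul hΩ (hY (.inl (.inl ()))) hk (db.conj hΩ) hpb
  have n3 := normHcurl_grad_mul_le hΩ (hY (.inl (.inl ()))) hk1 (db.conj hΩ) b1 b2
  have l3 := hasL2Curl_grad fun j => (hd (.inl (.inl ())) j).mul_left hΩ (db.conj hΩ)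
  have m4 := memHVec_mul hΩ (v := fun x i => Y x (.inl (.inr i))) (fun i => hY _) hk1
    (da.conj hΩ)
  have n4 := normHcurl_mul_le hΩ (v := fun x i => Y x (.inl (.inr i)))
    (fun j i => hd (.inl (.inr i)) j) (da.conj hΩ) a1 a2 (fun i => hN _)
  have l4 := hasL2Curl_of_hasL2Deriv (u := fun x i => star (sqrtGam ω σ₂ x) * Y x (.inl (.inr i)))
    fun j i => (hd (.inl (.inr i)) j).mul_left hΩ (da.conj hΩ)
  -- The Alessandrini identity. Traces act antilinearly on test fields, so the fields are conjugates
  -- of the summands of `a` and `b`, with `o = (iω)⁻¹` kept outside; `|o| ≤ 1` because `ω ≥ 1`.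
  have key : ∫ x in Ω, alessandriniDensity Ω ω σ₁ σ₂ E Y x =
      -(o * tangTrace Ω (fun x => E x - E' x) ⟨_, m1⟩) - tangTrace Ω (fun x => H x - H' x) ⟨_, m2⟩ +
        o * tangTrace Ω (fun x => H x - H' x) ⟨_, m3⟩ +
        tangTrace Ω (fun x => E x - E' x) ⟨_, m4⟩ := by
    rw [ce.tangTrace_apply hΩ m1 l1, ch.tangTrace_apply hΩ m2 l2, ch.tangTrace_apply hΩ m3 l3,
      ce.tangTrace_apply hΩ m4 l4]
    simp only [Pi.zero_apply, star_zero, mul_zero, Finset.sum_const_zero, integral_zero, sub_zero]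
    rw [← integral_linear_combination (integrable_sum_mul_star ce.memLp_curl l1.memLp)
      (integrable_sum_mul_star ch.memLp_curl l2.memLp)
      (integrable_sum_mul_star ch.memLp l2.memLp_curl)
      (integrable_sum_mul_star ch.memLp_curl l3.memLp)
      (integrable_sum_mul_star ce.memLp_curl l4.memLp)
      (integrable_sum_mul_star ce.memLp l4.memLp_curl)]
    refine integral_congr_ae ?_
    filter_upwards [hPY, hS, hS', ae_restrict_mem hΩ.measurableSet] with x hx hx1 hx2 hxΩ
    have hst := adjoint_eq_of_opPaddWstar_eq_zero hx
    have hr := fun i => adjoint_row_inr hst i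
    have key := pointwise_alessandrini (a₁ := sqrtGam ω σ₁ x) (E := E x)
      (e := fun i => E x i - E' x i) (h := fun i => H x i - H' x i)
      (sqrtGam_sq_mul_inv ω σ₂ x) ho1 (fun i => adjoint_row_inl hst i) hr
    have cE : ∀ i, (weakCurl Ω E x - weakCurl Ω E' x) i = Complex.I * ω * (H x i - H' x i) := by
      intro i
      have e1 : weakCurl Ω E x i - Complex.I * ω * H x i = 0 := congrFun hx1.2 i
      have e2 : weakCurl Ω E' x i - Complex.I * ω * H' x i = 0 := congrFun hx2.2 i
      rw [Pi.sub_apply]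
      linear_combination e1 - e2
    have cH : ∀ i, (weakCurl Ω H x - weakCurl Ω H' x) i = -(Complex.I * ω *
        (sqrtGam ω σ₂ x ^ 2 * (E x i - E' x i) +
          (sqrtGam ω σ₁ x ^ 2 - sqrtGam ω σ₂ x ^ 2) * E x i)) := by
      intro i
      have e1 : weakCurl Ω H x i + Complex.I * ω * gam ω σ₁ x * E x i = 0 := congrFun hx1.1 i
      have e2 : weakCurl Ω H' x i + Complex.I * ω * gam ω σ₂ x * E' x i = 0 := congrFun hx2.1 i
      rw [Pi.sub_apply, sqrtGam_sq, sqrtGam_sq]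
      linear_combination e1 - e2
    simp only [alessandriniDensity, h₂.pd_inv_sqrtGam hΩ _ hxΩ]
    rw [← sqrtGam_sq, ← sqrtGam_sq]
    refine key.symm.trans ?_
    simp only [cE, cH, star_add, star_mul', star_curlOf, pa _ x hxΩ, pb _ x hxΩ, star_star,
      pd_const, zero_mul, zero_add, one_mul, h₂.pd_inv_sqrtGam hΩ _ hxΩ,
      h₂.pd_sqrtGam hΩ _ hxΩ, Pi.sub_apply]
  have hTE : normTH Ω (tangTrace Ω fun x => E x - E' x) ≤
      normTH2 Ω ((tangTrace Ω E, tangTrace Ω H) - (tangTrace Ω E', tangTrace Ω H')) := by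
    rw [← tE]
    exact normTH_le_normTH2_left ((tangTrace Ω E, tangTrace Ω H) - (tangTrace Ω E', tangTrace Ω H'))
  have hTH : normTH Ω (tangTrace Ω fun x => H x - H' x) ≤
      normTH2 Ω ((tangTrace Ω E, tangTrace Ω H) - (tangTrace Ω E', tangTrace Ω H')) := by
    rw [← tH]
    exact normTH_le_normTH2_right
      ((tangTrace Ω E, tangTrace Ω H) - (tangTrace Ω E', tangTrace Ω H'))
  set T := normTH2 Ω ((tangTrace Ω E, tangTrace Ω H) - (tangTrace Ω E', tangTrace Ω H'))
  have bd : ∀ {u w : E3 → Fin 3 → ℂ} (hu : MemHcurl Ω u) (hw : MemHVec Ω 1 w),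
      normTH Ω (tangTrace Ω u) ≤ T → normHcurl Ω w ≤ 18 * (ENNReal.ofReal C * N) →
      ∀ {c : ℂ}, ‖c‖ ≤ 1 →
      ‖c * tangTrace Ω u ⟨w, hw⟩‖ₑ ≤ 6 * T * (18 * (ENNReal.ofReal C * N)) :=
    fun hu hw hT hn _ hc => (enorm_mul_tangTrace_le hΩ hu hw hn hc).trans (by gcongr)
  have s1 : 18 * (ENNReal.ofReal C * normH Ω 1 fun x => Y x (.inr (.inl ()))) ≤
      18 * (ENNReal.ofReal C * N) := by
    gcongr
    exact hN _
  have s3 : 18 * (ENNReal.ofReal C * normH Ω 1 fun x => Y x (.inl (.inl ()))) ≤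
      18 * (ENNReal.ofReal C * N) := by
    gcongr
    exact hN _
  have t1 := bd ce.memHcurl m1 hTE (n1.trans s1) hon
  have t2 := bd ch.memHcurl m2 hTH n2 (c := 1) (by simp)
  have t3 := bd ch.memHcurl m3 hTH (n3.trans s3) hon
  have t4 := bd ce.memHcurl m4 hTE n4 (c := 1) (by simp)
  rw [one_mul] at t2 t4
  rw [key]
  -- Four pairings, each at most `6 · 18` times the common quantity, give `432`.
  calc _ ≤ 6 * T * (18 * (ENNReal.ofReal C * N)) + 6 * T * (18 * (ENNReal.ofReal C * N)) +
        6 * T * (18 * (ENNReal.ofReal C * N)) + 6 * T * (18 * (ENNReal.ofReal C * N)) := by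
        refine (enorm_add_le _ _).trans (add_le_add ((enorm_add_le _ _).trans (add_le_add
          (enorm_sub_le.trans (add_le_add ?_ t2)) t3)) t4)
        rw [enorm_neg]
        exact t1
    _ = _ := by ring

end

/-! ### Finiteness, degenerate cases and the conclusion -/

theorem normH_ne_top {Ω : Set E3} {k : ℕ} {f : E3 → ℂ} (h : MemH Ω k f) : normH Ω k f ≠ ⊤ := by
  refine ENNReal.rpow_ne_top_of_nonneg (by norm_num) (ENNReal.sum_ne_top.2 fun j hj =>
    ENNReal.sum_ne_top.2 fun β hβ => ENNReal.pow_ne_top ?_)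
  rw [Finset.mem_range] at hj
  rw [Finset.mem_piAntidiag] at hβ
  obtain ⟨g, hg, hgL⟩ := h β (hβ.1.le.trans (by omega))
  exact ((iInf₂_le g hg).trans_lt hgL.2).ne

theorem normHVec_ne_top {ι : Type*} [Fintype ι] {Ω : Set E3} {k : ℕ} {Y : E3 → ι → ℂ}
    (h : MemHVec Ω k Y) : normHVec Ω k Y ≠ ⊤ :=
  ENNReal.rpow_ne_top_of_nonneg (by norm_num)
    (ENNReal.sum_ne_top.2 fun i _ => ENNReal.pow_ne_top (normH_ne_top (h i)))

theorem MemHVec.mono {ι : Type*} {Ω : Set E3} {k l : ℕ} {Y : E3 → ι → ℂ} (h : MemHVec Ω k Y)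
    (hl : l ≤ k) : MemHVec Ω l Y := fun i β hβ => h i β (hβ.trans hl)

section

variable {Ω K : Set E3} {M ω : ℝ} {σ₁ σ₂ : E3 → ℝ} {E H : E3 → Fin 3 → ℂ}

theorem HasL2Curl.zero : HasL2Curl Ω 0 0 :=
  ⟨fun _ => MemLp.zero', fun _ => MemLp.zero', fun k φ _ => by simp⟩

theorem isMaxwellSol_zero (hΩ : IsOpen Ω) (ω : ℝ) (σ : E3 → ℝ) : IsMaxwellSol Ω ω σ 0 0 := by
  have h := HasL2Curl.zero (Ω := Ω)
  refine ⟨h.memHcurl, h.memHcurl, ?_⟩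
  filter_upwards [h.weakCurl_ae_eq hΩ] with x hx
  simp [hx]

/-- The electric field is controlled by `Y = (0, H, 0, γ^{1/2} E)`. -/
theorem normHcurl_le_normHVec (hΩ : IsOpen Ω) (h₁ : IsC2Bounded Ω M σ₁) (hω : 1 ≤ ω) (hM : 0 ≤ M)
    {X : E3 → I8 → ℂ}
    (hX : ∀ᵐ x ∂(volume.restrict Ω), X x = vec8 0 (H x) 0 (sqrtGam ω σ₁ x • E x)) :
    normHcurl Ω E ≤ 18 * (ENNReal.ofReal ((1 + M) ^ 2) * normHVec Ω 1 X) := by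
  by_cases htop : normHVec Ω 1 X = ⊤
  · have : ENNReal.ofReal ((1 + M) ^ 2) ≠ 0 := by
      rw [Ne, ENNReal.ofReal_eq_zero, not_le]
      positivity
    rw [htop, ENNReal.mul_top this, ENNReal.mul_top (by norm_num)]
    exact le_top
  -- In the remaining case the finite `H¹` norm provides the weak derivatives of `γ^{1/2} E`, and
  -- multiplication by `γ^{-1/2}` recovers `E`.
  have hN := fun n => normH_le_normHVec (Ω := Ω) (k := 1) (Y := X) n
  have hd := fun j (i : Fin 3) => exists_hasL2Deriv_of_normH_ne_top hΩ
    (((hN (.inr (.inr i))).trans_lt (lt_top_iff_ne_top.2 htop)).ne) j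
  choose d hd using hd
  have db := h₁.isC1Bounded_inv_sqrtGam hΩ hω
  have hC := fun x (_ : x ∈ Ω) => (norm_inv_sqrtGam_le (ω := ω) (σ := σ₁) x).trans
    (by nlinarith : 1 ≤ (1 + M) ^ 2)
  have hC' := fun j x (hx : x ∈ Ω) => (h₁.norm_pd_inv_sqrtGam_le hΩ hω j hx).trans
    (by nlinarith : M ≤ (1 + M) ^ 2)
  have hle := normHcurl_mul_le hΩ (v := fun x i => X x (.inr (.inr i))) hd db hC hC' fun i => hN _
  have hcurl := hasL2Curl_of_hasL2Deriv (u := fun x i => (sqrtGam ω σ₁ x)⁻¹ * X x (.inr (.inr i)))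
    fun j i => (hd j i).mul_left hΩ db
  have hae : (fun x i => (sqrtGam ω σ₁ x)⁻¹ * X x (.inr (.inr i))) =ᵐ[volume.restrict Ω] E := by
    filter_upwards [hX] with x hx
    ext i
    rw [hx]
    simp only [vec8, Sum.elim_inr, Pi.smul_apply, smul_eq_mul]
    rw [← mul_assoc, inv_mul_cancel₀ (sqrtGam_ne_zero x), one_mul]
  rw [hcurl.normHcurl_eq hΩ] at hle
  rw [(hcurl.congr hae (ae_eq_refl _)).normHcurl_eq hΩ, ← normL2_congr hae]
  exact hle

/-- Covers `‖Y₁‖ = 0`, where the right side of the estimate is `0` even if the distance is infinite.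
-/
theorem integral_alessandriniDensity_eq_zero {Y : E3 → I8 → ℂ} (hE : MemHcurl Ω E)
    (h0 : normHcurl Ω E = 0) : ∫ x in Ω, alessandriniDensity Ω ω σ₁ σ₂ E Y x = 0 := by
  have h1 : normL2 Ω E = 0 := (add_eq_zero.1 h0).1
  have h2 : ∀ i, ∀ᵐ x ∂(volume.restrict Ω), E x i = 0 := fun i =>
    (eLpNorm_eq_zero_iff (hE.1 i).1 (by norm_num)).1
      (le_antisymm ((eLpNorm_le_normL2 E i).trans h1.le) bot_le)
  refine integral_eq_zero_of_ae ?_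
  filter_upwards [ae_all_iff.2 h2] with x hx
  simp [alessandriniDensity, hx]

end

/-- The passage to the infimum in `[0, ∞]`: `b` is the norm of `ν × E`, `b'` its bound through `Y₁`,
and `t q` the distance to the Cauchy data `q`. The conventions `0 / 0 = 0`, `a / 0 = ∞` and `0 * ∞ =
0` require the degenerate cases to be separated. -/
theorem le_mul_mul_of_iInf_div_le {ι : Type*} [Nonempty ι] {t : ι → ℝ≥0∞} {a b b' c D : ℝ≥0∞}
    (ha : ∀ q, a ≤ c * t q) (hc : c ≠ ⊤) (hb : b ≠ ⊤) (hbb : b ≤ b') (h0 : b' = 0 → a = 0)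
    (hD : ⨅ q, t q / b ≤ D) : a ≤ c * b' * D := by
  rcases eq_or_ne b' 0 with hb' | hb'
  · rw [h0 hb']
    exact zero_le
  rcases eq_or_ne c 0 with rfl | hc0
  · obtain ⟨q⟩ := ‹Nonempty ι›
    simpa using ha q
  -- If `b = 0`, either some `t q` vanishes and then `a = 0`, or every quotient is infinite and so
  -- is `D`.
  rcases eq_or_ne b 0 with rfl | hb0
  · by_cases hq : ∃ q, t q = 0
    · obtain ⟨q, hq⟩ := hq
      have := ha q
      rw [hq, mul_zero] at this
      exact this.trans zero_le
    · push Not at hq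
      have : D = ⊤ := by
        rw [← top_le_iff]
        refine le_trans (le_iInf fun q => ?_) hD
        rw [ENNReal.div_zero (hq q)]
      rw [this, ENNReal.mul_top (mul_ne_zero hc0 hb')]
      exact le_top
  · calc a ≤ c * b * ⨅ q, t q / b := by
          rw [ENNReal.mul_iInf_of_ne (mul_ne_zero hc0 hb0) (ENNReal.mul_ne_top hc hb)]
          refine le_iInf fun q => (ha q).trans (le_of_eq ?_)
          rw [mul_assoc, ENNReal.mul_div_cancel hb0 hb]
      _ ≤ c * b' * D := by gcongr

theorem isC2Bounded_of_bound {Ω : Set E3} {M : ℝ} {σ : E3 → ℝ} (hσ : ContDiffOn ℝ 2 σ Ω)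
    (h : ContDiffOn ℝ 2 (fun x => (σ x : ℂ)) Ω → ∀ x ∈ Ω, ‖(σ x : ℂ)‖ ≤ M ∧
      (∀ i, ‖pd i (fun x => (σ x : ℂ)) x‖ ≤ M) ∧
      ∀ i j, ‖pd i (pd j fun x => (σ x : ℂ)) x‖ ≤ M) : IsC2Bounded Ω M σ := by
  have hc : ContDiffOn ℝ 2 (fun x => (σ x : ℂ)) Ω := Complex.ofRealCLM.contDiff.comp_contDiffOn hσ
  exact ⟨hc, fun x hx => (h hc x hx).1, fun i x hx => (h hc x hx).2.1 i,
    fun i j x hx => (h hc x hx).2.2 i j⟩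

end Maxwell

theorem theorem4p1 (s : ℕ) (hs : (3 / 2 : ℝ) < (s : ℝ)) (Ω : Set E3) (hΩo : IsOpen Ω)
    (hΩc : IsConnected Ω) (hΩb : Bornology.IsBounded Ω) (hΩL : HasLipschitzBoundary Ω) :
    ∃ C : ℝ≥0, ∀ ω : ℝ, 1 ≤ ω → ∀ σ₁ σ₂ : E3 → ℝ,
      ContDiffOn ℝ 2 σ₁ Ω → ContDiffOn ℝ 2 σ₂ Ω →
      MemH Ω (2 * s + 2) (fun x => (σ₁ x : ℂ)) → MemH Ω (2 * s + 2) (fun x => (σ₂ x : ℂ)) →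
      normH Ω (2 * s + 2) (fun x => (σ₁ x : ℂ)) < 1 →
      normH Ω (2 * s + 2) (fun x => (σ₂ x : ℂ)) < 1 →
      (∃ K ⊆ Ω, IsCompact K ∧ ∀ x ∈ Ω \ K, σ₁ x = σ₂ x) →
      ∀ (Z₁ : E3 → I8 → ℂ) (E₁ H₁ : E3 → Fin 3 → ℂ), MemHVec Ω (2 * s) Z₁ →
        IsMaxwellSol Ω ω σ₁ E₁ H₁ →
        (∀ᵐ x ∂(volume.restrict Ω),
          opPsubWt Ω ω σ₁ Z₁ x = vec8 0 (H₁ x) 0 (sqrtGam ω σ₁ x • E₁ x)) →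
      ∀ Y₂ : E3 → I8 → ℂ, MemHVec Ω (2 * s) Y₂ →
        (∀ᵐ x ∂(volume.restrict Ω), opPaddWstar Ω ω σ₂ Y₂ x = 0) →
        ‖innerΩ Ω (fun x => (potQ ω σ₁ x - potQ ω σ₂ x) *ᵥ Z₁ x) Y₂‖ₑ ≤
          (C : ℝ≥0∞) * cauchyDist Ω (cauchyData Ω ω σ₁) (cauchyData Ω ω σ₂) *
            normHVec Ω 1 (opPsubWt Ω ω σ₁ Z₁) * normHVec Ω 1 Y₂ := by
  obtain ⟨M, hM, hbd⟩ := exists_norm_le_of_normH_lt_one hΩo hΩb hΩL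
  -- An integer above `3/2` is at least `2`; this gives the order `2s + 2 ≥ 5` for the Sobolev bound
  -- and the two derivatives of `Y₂` needed for the test fields.
  have hs2 : 2 ≤ s := by
    by_contra hlt
    have : (s : ℝ) ≤ 1 := by exact_mod_cast (by omega : s ≤ 1)
    linarith
  -- `7776 = 432 · 18`; one factor `(1 + M)²` comes from the test fields and one from the bound of
  -- `E₁` by `Y₁`.
  refine ⟨7776 * Real.toNNReal ((1 + M) ^ 2) ^ 2, ?_⟩
  intro ω hω σ₁ σ₂ hσ₁ hσ₂ _ _ hn₁ hn₂ ⟨K, hKΩ, hK, he⟩ Z₁ E₁ H₁ hZ hEH hY₁ Y₂ hY hPY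
  have h₁ := isC2Bounded_of_bound hσ₁ fun hc => hbd (2 * s + 2) _ (by omega) hc hn₁
  have h₂ := isC2Bounded_of_bound hσ₂ fun hc => hbd (2 * s + 2) _ (by omega) hc hn₂
  rw [innerΩ_potQ_sub hΩo hK hKΩ h₁ h₂ hω he (by omega) hZ hY hPY,
    innerΩ_potW_sub hΩo hK hKΩ h₁ h₂ hω he (by omega) hY hPY hEH hY₁]
  have e1 : ‖-Complex.I * ∫ x in Ω, alessandriniDensity Ω ω σ₁ σ₂ E₁ Y₂ x‖ₑ =
      ‖∫ x in Ω, alessandriniDensity Ω ω σ₁ σ₂ E₁ Y₂ x‖ₑ := by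
    rw [enorm_mul, enorm_neg]
    have : ‖Complex.I‖ₑ = 1 := by rw [← ofReal_norm, Complex.norm_I, ENNReal.ofReal_one]
    rw [this, one_mul]
  rw [e1]
  have hE := normHcurl_le_normHVec hΩo h₁ hω hM hY₁
  -- The zero fields always solve the Maxwell system, so the infimum is over a nonempty set.
  have hne : Nonempty (cauchyData Ω ω σ₂) := ⟨⟨_, _, _, isMaxwellSol_zero hΩo ω σ₂, rfl⟩⟩
  have key := le_mul_mul_of_iInf_div_le (ι := cauchyData Ω ω σ₂)
    (t := fun q => normTH2 Ω ((tangTrace Ω E₁, tangTrace Ω H₁) - q.1))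
    (a := ‖∫ x in Ω, alessandriniDensity Ω ω σ₁ σ₂ E₁ Y₂ x‖ₑ)
    (b := normTH Ω (tangTrace Ω E₁))
    (b' := 18 * (ENNReal.ofReal ((1 + M) ^ 2) * normHVec Ω 1 (opPsubWt Ω ω σ₁ Z₁)))
    (c := 432 * ENNReal.ofReal ((1 + M) ^ 2) * normHVec Ω 1 Y₂)
    (D := cauchyDist Ω (cauchyData Ω ω σ₁) (cauchyData Ω ω σ₂)) ?_ ?_ ?_ ?_ ?_ ?_
  · refine key.trans (le_of_eq ?_)
    push_cast
    rw [ENNReal.ofReal]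
    ring
  · rintro ⟨q, E', H', hEH', rfl⟩
    refine (enorm_integral_alessandriniDensity_le hΩo h₂ hω hM (k := 2 * s) (by omega) hY hPY hEH
      hEH').trans (le_of_eq ?_)
    ring
  · exact ENNReal.mul_ne_top (ENNReal.mul_ne_top (by simp) ENNReal.ofReal_ne_top)
      (normHVec_ne_top (hY.mono (by omega)))
  · exact ((normTH_tangTrace_le hEH.1).trans_lt
      (lt_top_iff_ne_top.2 (normHcurl_ne_top hΩo hEH.1))).ne
  · exact (normTH_tangTrace_le hEH.1).trans hE
  · intro h0
    rw [integral_alessandriniDensity_eq_zero hEH.1 (le_antisymm (hE.trans h0.le) bot_le), enorm_zero]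
  -- Only the half of the distance measured from the Cauchy data of `σ₁` to those of `σ₂` enters,
  -- evaluated at the datum of `(E₁, H₁)`.
  · rw [iInf_subtype]
    refine le_trans ?_ (le_max_left _ _)
    exact le_iSup₂ (f := fun p (_ : p ∈ cauchyData Ω ω σ₁) => ⨅ q ∈ cauchyData Ω ω σ₂,
      normTH2 Ω (p - q) / normTH Ω p.1) (tangTrace Ω E₁, tangTrace Ω H₁) ⟨E₁, H₁, hEH, rfl⟩
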